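/- **Group Lemma.** A signature of arity $k$ is a function $\{0,1\}^k\to\mathbb{C}$. Let $\mathcal{G}$ (generators) and $\mathcal{R}$ (recognizers) be finite sets of signatures. A $(\mathcal{G}\,|\,\mathcal{R})$-signature grid $\Omega$ is a finite bipartite multigraph $(U,V,E)$ in which each vertex of $U$ (resp. $V$) is labeled by a signature in $\mathcal{G}$ (resp. $\mathcal{R}$) whose inputs are identified with the incident edges, and $\operatorname{Holant}_\Omega=\sum_{\xi:E\to\{0,1\}}\prod_{w\in U\cup V} f_w(\xi|_{E(w)})$. The problem $\mathrm{Holant}(\mathcal{G}\,|\,\mathcal{R})$ is to compute $\operatorname{Holant}_\Omega$ for a given $(\mathcal{G}\,|\,\mathcal{R})$-grid $\Omega$. A $(\mathcal{G}\,|\,\mathcal{R})$-gadget with $m$ leading and $n$ trailing edges is such a labeled bipartite multigraph with, in addition, $m$ ordered dangling "leading" edges, each incident to a vertex in $U$, and $n$ ordered dangling "trailing" edges, each incident to a vertex in $V$. Its transition matrix is the $2^m\times 2^n$ matrix whose entry at $(b,c)\in\{0,1\}^m\times\{0,1\}^n$ is the sum, over all assignments to the internal edges, of the product of all vertex evaluations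 when the leading edges are assigned $b$ and the trailing edges $c$. A gadget is recursive of arity $d$ if $m=n=d$. A set of gadgets with $n$ trailing and $m$ leading edges is projective from arity $n$ to $m$ if for every $N\in\mathbb{C}^{2^n\times 2}$ of rank $2$ there is a gadget in the set with transition matrix $M$ such that $MN$ has rank $2$. Let $\mathcal{P}$ be a finite set of $(\mathcal{G}\,|\,\mathcal{R})$-gadgets that is projective from arity $2$ to $1$. Let $\mathcal{S}$ be a finite set of recursive $(\mathcal{G}\,|\,\mathcal{R})$-gadgets of arity $d\ge 1$ with nonsingular transition matrices, and let $H$ be the group generated by the transition matrices of the gadgets in $\mathcal{S}$, modulo the scalar matrices $\lambda I$, $\lambda\in\mathbb{C}\setminus\{0\}$. If $H$ is infinite, then for all $X,Y\in\mathbb{C}$ $$\mathrm{Holant}(\mathcal{G}\cup\{(X,Y)\}\,|\,\mathcal{R})\;\le_T^{P}\;\mathrm{Holant}(\mathcal{G}\,|\,\mathcal{R}),$$ where $(X,Y)$ is the unary signature with values $X$ at $0$ and $Y$ at $1$. Here $\le_T^P$ denotes polynomial-time Turing reducibility: there is one oracle program that computes $\operatorname{Holant}_\Omega$ exactly for every grid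 $\Omega$ of the first problem, using an oracle for the second, in time polynomial in the number of vertices and edges of $\Omega$. Computation is exact in the field generated over $\mathbb{Q}$ by $X$, $Y$ and the values of the signatures in $\mathcal{G}\cup\mathcal{R}$, numbers being represented as quotients of integer polynomials in these constants and charged by the size (degree and coefficient length) of the representation. -/

import Mathlib

/-! ## Signatures, gadgets and signature grids -/

/-- A signature: a function `{0,1}^k → ℂ` (`false` is 0 and `true` is 1). -/
structure Signature where
  arity : ℕ
  val : (Fin arity → Bool) → ℂ

/-- The unary signature `(X, Y)`, taking the value `X` at 0 and `Y` at 1. -/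
def Signature.unary (X Y : ℂ) : Signature where
  arity := 1
  val := fun x => if x 0 then Y else X

/-- A `(G | R)`-gadget with `m` leading and `n` trailing dangling edges: a finite bipartite
multigraph whose vertices on one side (`Fin numGen`) are labelled by generators from `G` and on the
other side (`Fin numRec`) by recognizers from `R`, with internal edges `Fin numEdge`.
The inputs of the label of a vertex are its incident edges, in the order given by `genEdge` and
`recEdge`. Every internal edge has one end at a generator and the other at a recognizer;
every leading edge is attached to a generator and every trailing edge to a recognizer (so that
merging trailing edges of one gadget with leading edges of another keeps the graph bipartite). -/
structure Gadget (G R : Set Signature) (m n : ℕ) where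
  numGen : ℕ
  numRec : ℕ
  numEdge : ℕ
  genSig : Fin numGen → Signature
  genSig_mem : ∀ u, genSig u ∈ G
  recSig : Fin numRec → Signature
  recSig_mem : ∀ v, recSig v ∈ R
  genEdge : (Σ u : Fin numGen, Fin (genSig u).arity) ≃ Fin numEdge ⊕ Fin m
  recEdge : (Σ v : Fin numRec, Fin (recSig v).arity) ≃ Fin numEdge ⊕ Fin n

/-- The transition matrix (signature matrix): rows are indexed by the assignments to the leading
edges, columns by those to the trailing edges, and an entry is the sum over all assignments to the
internal edges of the product of the evaluations at all vertices. -/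
def Gadget.transition {G R : Set Signature} {m n : ℕ} (Γ : Gadget G R m n) :
    Matrix (Fin m → Bool) (Fin n → Bool) ℂ :=
  fun b c => ∑ ξ : Fin Γ.numEdge → Bool,
    (∏ u, (Γ.genSig u).val fun i => Sum.elim ξ b (Γ.genEdge ⟨u, i⟩)) *
    (∏ v, (Γ.recSig v).val fun i => Sum.elim ξ c (Γ.recEdge ⟨v, i⟩))

/-- A bipartite signature grid over `(G | R)`: no dangling edges. -/
abbrev SignatureGrid (G R : Set Signature) : Type := Gadget G R 0 0

/-- `Holant_Ω`: the sum over all edge assignments of the product of all vertex evaluations. -/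
def SignatureGrid.holant {G R : Set Signature} (Ω : SignatureGrid G R) : ℂ :=
  Gadget.transition Ω Fin.elim0 Fin.elim0

/-- The size of a grid: number of vertices plus number of edges. -/
def SignatureGrid.size {G R : Set Signature} (Ω : SignatureGrid G R) : ℕ :=
  Ω.numGen + Ω.numRec + Ω.numEdge

/-- A set of `2^m × 2^n` matrices is projective from arity `n` to `m` if every `2^n × 2` matrix of
rank 2 is mapped by one of its members to a matrix of rank 2. -/
def IsProjectiveMatrixSet {n m : ℕ} (M : Set (Matrix (Fin m → Bool) (Fin n → Bool) ℂ)) : Prop :=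
  ∀ N : Matrix (Fin n → Bool) (Fin 2) ℂ, N.rank = 2 → ∃ F ∈ M, (F * N).rank = 2

/-- A set of gadgets with `n` trailing and `m` leading edges is projective from arity `n` to `m`
if the set of its signature matrices is. -/
def IsProjectiveGadgetSet {G R : Set Signature} {n m : ℕ} (P : Set (Gadget G R m n)) : Prop :=
  IsProjectiveMatrixSet (Gadget.transition '' P)

/-- The group generated by the (invertible) transition matrices of the gadgets in `S`, modulo
the nonzero scalar matrices. -/
def transitionGroup {G R : Set Signature} {d : ℕ} (S : Set (Gadget G R d d)) :
    Subgroup (Matrix.ProjGenLinGroup (Fin d → Bool) ℂ) :=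
  Subgroup.closure
    (Matrix.ProjGenLinGroup.mk ''
      {A : GL (Fin d → Bool) ℂ | ∃ s ∈ S, (A : Matrix (Fin d → Bool) (Fin d → Bool) ℂ) =
        s.transition})

/-! ## A machine model: oracle programs on lists and exact numbers, with logarithmic cost

Programs compute on nested pairs (lists, trees) whose leaves are `nil` or complex numbers.
All numbers in a computation lie in the field `ℚ(A)` for a fixed finite set `A` of constants. The
cost of an operation is the size of its operands and its result, a number being charged by the size
of an exact representation as a quotient of integer polynomials in the constants. As `A` is fixed
and finite, a number of height `N` has a representation with polynomially many (in `N`)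
coefficients of at most `N + 1` bits each, so that cost is, up to a polynomial, the number of
steps of a Turing machine that does exact arithmetic in the finitely generated field `ℚ(A)`. -/

/-- `z` has a representation of height at most `N` over the constants `A`: it is a quotient of two
integer polynomials in the constants, of total degree at most `N`, whose coefficients have absolute
values of sum at most `2 ^ N`. -/
def HasHeight (A : Set ℂ) (z : ℂ) (N : ℕ) : Prop :=
  ∃ p q : MvPolynomial A ℤ,
    p.totalDegree ≤ N ∧ q.totalDegree ≤ N ∧
    (∑ s ∈ p.support, |p.coeff s|) ≤ 2 ^ N ∧ (∑ s ∈ q.support, |q.coeff s|) ≤ 2 ^ N ∧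
    MvPolynomial.aeval (fun a : A => (a : ℂ)) q ≠ 0 ∧
    z = MvPolynomial.aeval (fun a : A => (a : ℂ)) p / MvPolynomial.aeval (fun a : A => (a : ℂ)) q

/-- The data on which programs work. -/
inductive Data : Type
  | nil : Data
  | num (z : ℂ) : Data
  | pair (x y : Data) : Data

namespace Data

/-- `HasSize A x N`: the data `x` has a representation of size `N` over the constants `A`. -/
inductive HasSize (A : Set ℂ) : Data → ℕ → Prop
  | nil : HasSize A Data.nil 1
  | num {z : ℂ} {N : ℕ} : HasHeight A z N → HasSize A (Data.num z) (N + 1)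
  | pair {x y : Data} {M N : ℕ} :
      HasSize A x M → HasSize A y N → HasSize A (Data.pair x y) (M + N + 1)

/-- Lists as right-nested pairs. -/
def ofList : List Data → Data
  | [] => nil
  | x :: l => pair x (ofList l)

/-- Natural numbers in unary. -/
def ofNat : ℕ → Data
  | 0 => nil
  | k + 1 => pair nil (ofNat k)

/-- The table of values of a function on `{0,1}^k`, as a binary tree branching on the variables in
order. -/
def ofTable : (k : ℕ) → ((Fin k → Bool) → ℂ) → Data
  | 0, f => num (f Fin.elim0)
  | k + 1, f => pair (ofTable k fun x => f (Fin.cons false x)) (ofTable k fun x => f (Fin.cons true x))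

/-- Truth values: `nil` is false, `pair nil nil` is true. -/
def ofBool : Bool → Data
  | false => nil
  | true => pair nil nil

end Data

/-- The basic operations of the programming language. -/
inductive Op : Type
  | lit (d : Data)
  | id
  | fst
  | snd
  | isPair
  | eq
  | add
  | sub
  | mul
  | div

open Classical in
/-- The effect of a basic operation. Operations on operands of the wrong kind return `nil`. -/
noncomputable def Op.run : Op → Data → Data
  | lit d, _ => d
  | id, x => x
  | fst, Data.pair x _ => x
  | snd, Data.pair _ y => y
  | isPair, Data.pair _ _ => Data.ofBool true
  | eq, Data.pair x y => Data.ofBool (decide (x = y))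
  | add, Data.pair (Data.num z) (Data.num w) => Data.num (z + w)
  | sub, Data.pair (Data.num z) (Data.num w) => Data.num (z - w)
  | mul, Data.pair (Data.num z) (Data.num w) => Data.num (z * w)
  | div, Data.pair (Data.num z) (Data.num w) => Data.num (z / w)
  | _, _ => Data.nil

/-- Oracle programs: basic operations, oracle calls, sequential composition, pairing of two results,
conditionals (`nil` is false, all else is true) and while loops. -/
inductive Program : Type
  | op (o : Op)
  | oracle
  | comp (g f : Program)
  | pair (f g : Program)
  | cond (b f g : Program)
  | loop (b f : Program)

/-- `Eval A O c x y t`: the program `c`, with oracle `O` (`O x y` means that query `x` is answered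
by `y`), started on `x`, halts with output `y` after a computation of cost `t`. -/
inductive Eval (A : Set ℂ) (O : Data → Data → Prop) : Program → Data → Data → ℕ → Prop
  | op {o : Op} {x : Data} {M N : ℕ} :
      Data.HasSize A x M → Data.HasSize A (o.run x) N →
      Eval A O (Program.op o) x (o.run x) (M + N + 1)
  | oracle {x y : Data} {M N : ℕ} :
      O x y → Data.HasSize A x M → Data.HasSize A y N →
      Eval A O Program.oracle x y (M + N + 1)
  | comp {f g : Program} {x y z : Data} {s t : ℕ} :
      Eval A O f x y s → Eval A O g y z t → Eval A O (Program.comp g f) x z (s + t + 1)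
  | pair {f g : Program} {x y z : Data} {s t : ℕ} :
      Eval A O f x y s → Eval A O g x z t →
      Eval A O (Program.pair f g) x (Data.pair y z) (s + t + 1)
  | condTrue {b f g : Program} {x v y : Data} {s t : ℕ} :
      Eval A O b x v s → v ≠ Data.nil → Eval A O f x y t →
      Eval A O (Program.cond b f g) x y (s + t + 1)
  | condFalse {b f g : Program} {x y : Data} {s t : ℕ} :
      Eval A O b x Data.nil s → Eval A O g x y t →
      Eval A O (Program.cond b f g) x y (s + t + 1)
  | loopStop {b f : Program} {x : Data} {s : ℕ} :
      Eval A O b x Data.nil s → Eval A O (Program.loop b f) x x (s + 1)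
  | loopStep {b f : Program} {x v y z : Data} {r s t : ℕ} :
      Eval A O b x v r → v ≠ Data.nil → Eval A O f x y s → Eval A O (Program.loop b f) y z t →
      Eval A O (Program.loop b f) x z (r + s + t + 1)

/-! ## Counting problems and polynomial-time Turing reductions -/

/-- A counting problem with complex values: instances with their size, their encoding as an input,
the value to be computed, and the set of constants from which all numbers are formed. -/
structure CountingProblem where
  Instance : Type
  size : Instance → ℕ
  encode : Instance → Data
  value : Instance → ℂ
  consts : Set ℂ

/-- The oracle for a problem answers the encoding of an instance by its value (and gives no answer
to anything else). -/
def CountingProblem.oracle (B : CountingProblem) (x y : Data) : Prop :=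
  ∃ i : B.Instance, x = B.encode i ∧ y = Data.num (B.value i)

/-- `A ≤_T^P B`: a single program with an oracle for `B` computes the value of every instance of
`A` exactly, at a cost that is polynomially bounded in the size of the instance. -/
def PolyTimeTuringReducible (A B : CountingProblem) : Prop :=
  ∃ (c : Program) (p : Polynomial ℕ), ∀ i : A.Instance, ∃ t ≤ p.eval (A.size i),
    Eval (A.consts ∪ B.consts) B.oracle c (A.encode i) (Data.num (A.value i)) t

/-- A grid is encoded by the list of its generator vertices and the list of its recognizer
vertices; a vertex is given by the table of its label and the list of (the numbers of) its
incident edges, in order. -/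
def SignatureGrid.encode {G R : Set Signature} (Ω : SignatureGrid G R) : Data :=
  Data.pair
    (Data.ofList (List.ofFn fun u =>
      Data.pair (Data.ofTable (Ω.genSig u).arity (Ω.genSig u).val)
        (Data.ofList (List.ofFn fun i =>
          Data.ofNat (Sum.elim Fin.val Fin.val (Ω.genEdge ⟨u, i⟩))))))
    (Data.ofList (List.ofFn fun v =>
      Data.pair (Data.ofTable (Ω.recSig v).arity (Ω.recSig v).val)
        (Data.ofList (List.ofFn fun i =>
          Data.ofNat (Sum.elim Fin.val Fin.val (Ω.recEdge ⟨v, i⟩))))))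

/-- The bipartite Holant problem `Holant(G | R)`; its constants are the values of the signatures. -/
def holantProblem (G R : Set Signature) : CountingProblem where
  Instance := SignatureGrid G R
  size := SignatureGrid.size
  encode := SignatureGrid.encode
  value := SignatureGrid.holant
  consts := {z | ∃ f ∈ G ∪ R, z ∈ Set.range f.val}

/-!
The value of a grid `Ω` with `n` vertices labelled `(X, Y)` is a binary form of degree `n` in
`(X, Y)`, with coefficients that do not depend on `X` and `Y`. Hence it is a linear combination of
the values of this form at any `n + 1` pairwise independent points of `ℂ²`, with coefficients given
by homogeneous Lagrange interpolation (`lagrange_interpolation`). If the points are realized by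
unary `(G | R)`-gadgets without trailing edges, then the values of the form at these points are
values of `(G | R)`-grids, obtained by replacing each vertex labelled `(X, Y)` by a copy of the
gadget. So it is enough to construct, in time polynomial in `n`, that many gadgets with pairwise
independent unary signatures.

Some member of `P` has rank two, and its two rows depend linearly on the two slices of the generator
at its leading edge; so these slices are linearly independent. Taking `d` copies of this generator
gives a starter gadget with `d + r` leading edges, whose signature has full rank `2 ^ d` as a matrix
between the first `d` and the last `r` edges (`exists_starter`). Composing a word of members of `S`
with the starter therefore determines the product of the transition matrices of the word up to a
scalar if the signature is known up to a scalar. A list of words whose signatures are pairwise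
independent can be extended by a word that is one letter longer than a member of the list: otherwise
the products of the members of the list would give all of `transitionGroup S`, as a finite set that
contains `1` and is stable under left multiplication by the generators (`exists_new_word`). So the
greedy search, which adds one word at a time, never stops; all words found in `t` rounds have length
at most `t + 1`.

Projectivity from arity `2` to `1` extends to pairs of independent tensors of higher arity
(`IsProjectiveGadgetSet.exists_act`): two such tensors remain independent under the action on the
first two factors of a suitable member of `P`. With `K` words in `P` of length `d + r - 1`, each pair
of independent signatures of arity `d + r` is kept independent by one of the `K` words. If the
unary signatures obtained from more than `N ^ K` independent signatures represented fewer than `N`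
points of the projective line, then, counting the zero vector as one more value, two of the
signatures would have the same image under all `K` words, a contradiction. A greedy choice thus
finds exactly `N = n + 1` pairwise independent unary signatures (`select_length`).

Programs are not written out. `FP` says that a family of data is computed from another one by one
program at polynomial cost, and is shown to be closed under the usual constructions, among them
loops over lists (`FP.foldl`). A loop needs a bound for the sizes of its intermediate results, which
cannot be obtained from one step alone: a step that increases heights by a constant factor leads to
exponential heights. The bound comes from the meaning of the numbers: the entries of the signature of
a word of gadgets are values of integer polynomials in the constants whose degrees and logarithmic
coefficient norms are linear in the length of the word (`letterTensor_hasHeight`).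
-/


/-! ### Heights of numbers -/

section Height

open MvPolynomial

/-- The sum of the absolute values of the coefficients of an integer polynomial. -/
noncomputable def coeffNorm {σ : Type*} (p : MvPolynomial σ ℤ) : ℤ :=
  ∑ s ∈ p.support, |p.coeff s|

theorem coeffNorm_eq_of_subset {σ : Type*} {p : MvPolynomial σ ℤ} {F : Finset (σ →₀ ℕ)}
    (h : p.support ⊆ F) : coeffNorm p = ∑ s ∈ F, |p.coeff s| := by
  apply Finset.sum_subset h
  intro s _ hs
  simp [MvPolynomial.notMem_support_iff.mp hs]

theorem coeffNorm_zero {σ : Type*} : coeffNorm (0 : MvPolynomial σ ℤ) = 0 := by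
  simp [coeffNorm]

theorem coeffNorm_add_le {σ : Type*} (p q : MvPolynomial σ ℤ) :
    coeffNorm (p + q) ≤ coeffNorm p + coeffNorm q := by
  classical
  rw [coeffNorm_eq_of_subset (MvPolynomial.support_add (p := p) (q := q)),
    coeffNorm_eq_of_subset (p := p) (F := p.support ∪ q.support) Finset.subset_union_left,
    coeffNorm_eq_of_subset (p := q) (F := p.support ∪ q.support) Finset.subset_union_right,
    ← Finset.sum_add_distrib]
  refine Finset.sum_le_sum fun s _ => ?_
  rw [coeff_add]
  exact abs_add_le _ _

theorem coeffNorm_neg {σ : Type*} (p : MvPolynomial σ ℤ) : coeffNorm (-p) = coeffNorm p := by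
  simp [coeffNorm, MvPolynomial.support_neg]

theorem coeffNorm_monomial {σ : Type*} (s : σ →₀ ℕ) (c : ℤ) :
    coeffNorm (monomial s c) = |c| := by
  classical
  rw [coeffNorm_eq_of_subset (F := {s}) (MvPolynomial.support_monomial_subset)]
  simp

theorem coeffNorm_sum_le {σ ι : Type*} (F : Finset ι) (f : ι → MvPolynomial σ ℤ) :
    coeffNorm (∑ i ∈ F, f i) ≤ ∑ i ∈ F, coeffNorm (f i) :=
  Finset.le_sum_of_subadditive coeffNorm coeffNorm_zero.le coeffNorm_add_le F f

theorem coeffNorm_mul_le {σ : Type*} (p q : MvPolynomial σ ℤ) :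
    coeffNorm (p * q) ≤ coeffNorm p * coeffNorm q := by
  conv_lhs => rw [p.as_sum, q.as_sum, Finset.sum_mul_sum]
  refine (coeffNorm_sum_le _ _).trans ?_
  rw [coeffNorm, coeffNorm, Finset.sum_mul_sum]
  refine Finset.sum_le_sum fun s _ => (coeffNorm_sum_le _ _).trans ?_
  refine Finset.sum_le_sum fun t _ => ?_
  rw [monomial_mul, coeffNorm_monomial, abs_mul]

theorem coeffNorm_nonneg {σ : Type*} (p : MvPolynomial σ ℤ) : 0 ≤ coeffNorm p :=
  Finset.sum_nonneg fun _ _ => abs_nonneg _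

/-- `z` is the value of an integer polynomial in the constants of total degree at most `D` whose
coefficients have absolute values of sum at most `B`. In contrast to `HasHeight`, this controls
iterated sums without multiplying denominators. -/
def HasIntHeight (A : Set ℂ) (z : ℂ) (D B : ℕ) : Prop :=
  ∃ p : MvPolynomial A ℤ, p.totalDegree ≤ D ∧ coeffNorm p ≤ B ∧ aeval (fun a : A => (a : ℂ)) p = z

variable {A : Set ℂ}

namespace HasIntHeight

theorem mono {z : ℂ} {D D' B B' : ℕ} (h : HasIntHeight A z D B) (hD : D ≤ D') (hB : B ≤ B') :
    HasIntHeight A z D' B' := by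
  obtain ⟨p, h1, h2, h3⟩ := h
  exact ⟨p, h1.trans hD, h2.trans (by exact_mod_cast hB), h3⟩

theorem of_mem {z : ℂ} (h : z ∈ A) : HasIntHeight A z 1 1 := by
  refine ⟨X ⟨z, h⟩, ?_, ?_, by simp⟩
  · simp
  · rw [X, coeffNorm_monomial]; simp

theorem zero : HasIntHeight A 0 0 0 := ⟨0, by simp, by simp [coeffNorm_zero], by simp⟩

theorem one : HasIntHeight A 1 0 1 :=
  ⟨1, by simp, by rw [← C_1, ← monomial_zero', coeffNorm_monomial]; simp, by simp⟩

theorem neg {z : ℂ} {D B : ℕ} (h : HasIntHeight A z D B) : HasIntHeight A (-z) D B := by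
  obtain ⟨p, h1, h2, rfl⟩ := h
  exact ⟨-p, by rwa [totalDegree_neg], by rwa [coeffNorm_neg], by simp⟩

theorem add {z w : ℂ} {D D' B B' : ℕ} (h : HasIntHeight A z D B) (h' : HasIntHeight A w D' B') :
    HasIntHeight A (z + w) (max D D') (B + B') := by
  obtain ⟨p, h1, h2, rfl⟩ := h
  obtain ⟨q, h1', h2', rfl⟩ := h'
  refine ⟨p + q, (totalDegree_add _ _).trans (max_le_max h1 h1'), ?_, by simp⟩
  push_cast
  exact (coeffNorm_add_le _ _).trans (add_le_add h2 h2')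

theorem mul {z w : ℂ} {D D' B B' : ℕ} (h : HasIntHeight A z D B) (h' : HasIntHeight A w D' B') :
    HasIntHeight A (z * w) (D + D') (B * B') := by
  obtain ⟨p, h1, h2, rfl⟩ := h
  obtain ⟨q, h1', h2', rfl⟩ := h'
  refine ⟨p * q, (totalDegree_mul _ _).trans (add_le_add h1 h1'), ?_, by simp⟩
  push_cast
  exact (coeffNorm_mul_le _ _).trans
    (mul_le_mul h2 h2' (coeffNorm_nonneg _) (by positivity))

theorem sum {ι : Type*} (F : Finset ι) {f : ι → ℂ} {D : ℕ} {B : ι → ℕ}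
    (h : ∀ i ∈ F, HasIntHeight A (f i) D (B i)) :
    HasIntHeight A (∑ i ∈ F, f i) D (∑ i ∈ F, B i) := by
  classical
  induction F using Finset.induction_on with
  | empty => simpa using zero.mono (Nat.zero_le _) le_rfl
  | insert a s ha ih =>
    rw [Finset.sum_insert ha, Finset.sum_insert ha]
    exact ((h a (Finset.mem_insert_self _ _)).add
      (ih fun i hi => h i (Finset.mem_insert_of_mem hi))).mono (by simp) le_rfl

theorem prod {ι : Type*} (F : Finset ι) {f : ι → ℂ} {D B : ι → ℕ}
    (h : ∀ i ∈ F, HasIntHeight A (f i) (D i) (B i)) :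
    HasIntHeight A (∏ i ∈ F, f i) (∑ i ∈ F, D i) (∏ i ∈ F, B i) := by
  classical
  induction F using Finset.induction_on with
  | empty => simpa using one
  | insert a s ha ih =>
    rw [Finset.prod_insert ha, Finset.sum_insert ha, Finset.prod_insert ha]
    exact (h a (Finset.mem_insert_self _ _)).mul
      (ih fun i hi => h i (Finset.mem_insert_of_mem hi))

theorem list_prod {β : Type*} (l : List β) {f : β → ℂ} {D B : ℕ}
    (h : ∀ b ∈ l, HasIntHeight A (f b) D B) :
    HasIntHeight A (l.map f).prod (l.length * D) (B ^ l.length) := by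
  induction l with
  | nil => simpa using one
  | cons b l ih =>
    simp only [List.map_cons, List.prod_cons, List.length_cons]
    refine ((h b (by simp)).mul (ih fun b hb => h b (by simp [hb]))).mono ?_ ?_
    · rw [add_mul, one_mul, add_comm]
    · rw [pow_succ, mul_comm]

theorem hasHeight {z : ℂ} {D B N : ℕ} (h : HasIntHeight A z D B) (hD : D ≤ N) (hB : B ≤ 2 ^ N) :
    HasHeight A z N := by
  obtain ⟨p, h1, h2, rfl⟩ := h
  obtain ⟨q, g1, g2, g3⟩ := one (A := A)
  refine ⟨p, q, h1.trans hD, g1.trans (Nat.zero_le _), h2.trans (by exact_mod_cast hB),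
    g2.trans ?_, by rw [g3]; simp, by rw [g3]; simp⟩
  exact_mod_cast Nat.one_le_two_pow

end HasIntHeight

theorem hasHeight_iff {z : ℂ} {N : ℕ} : HasHeight A z N ↔ ∃ a b : ℂ,
    HasIntHeight A a N (2 ^ N) ∧ HasIntHeight A b N (2 ^ N) ∧ b ≠ 0 ∧ z = a / b := by
  constructor
  · rintro ⟨p, q, h1, h2, h3, h4, h5, h6⟩
    exact ⟨_, _, ⟨p, h1, by exact_mod_cast h3, rfl⟩, ⟨q, h2, by exact_mod_cast h4, rfl⟩, h5, h6⟩
  · rintro ⟨_, _, ⟨p, h1, h3, rfl⟩, ⟨q, h2, h4, rfl⟩, h5, h6⟩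
    exact ⟨p, q, h1, h2, by exact_mod_cast h3, by exact_mod_cast h4, h5, h6⟩

namespace HasHeight

theorem mono {z : ℂ} {M N : ℕ} (h : HasHeight A z M) (hMN : M ≤ N) : HasHeight A z N := by
  obtain ⟨a, b, ha, hb, h1, h2⟩ := hasHeight_iff.mp h
  have := Nat.pow_le_pow_right (n := 2) (by norm_num) hMN
  exact hasHeight_iff.mpr ⟨a, b, ha.mono hMN this, hb.mono hMN this, h1, h2⟩

theorem zero : HasHeight A 0 0 := HasIntHeight.zero.hasHeight le_rfl (by norm_num)

theorem one : HasHeight A 1 0 := HasIntHeight.one.hasHeight le_rfl (by norm_num)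

theorem neg {z : ℂ} {M : ℕ} (h : HasHeight A z M) : HasHeight A (-z) M := by
  obtain ⟨a, b, ha, hb, h1, h2⟩ := hasHeight_iff.mp h
  exact hasHeight_iff.mpr ⟨-a, b, ha.neg, hb, h1, by rw [h2, neg_div]⟩

theorem add {z w : ℂ} {M N : ℕ} (h : HasHeight A z M) (h' : HasHeight A w N) :
    HasHeight A (z + w) (M + N + 1) := by
  obtain ⟨a, b, ha, hb, h1, rfl⟩ := hasHeight_iff.mp h
  obtain ⟨c, d, hc, hd, h1', rfl⟩ := hasHeight_iff.mp h'
  refine hasHeight_iff.mpr ⟨a * d + b * c, b * d, ?_, ?_, mul_ne_zero h1 h1',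
    div_add_div _ _ h1 h1'⟩
  · refine ((ha.mul hd).add (hb.mul hc)).mono (by simp) (le_of_eq ?_)
    ring
  · refine (hb.mul hd).mono (by omega) ?_
    rw [← pow_add]
    exact Nat.pow_le_pow_right (by norm_num) (by omega)

theorem sub {z w : ℂ} {M N : ℕ} (h : HasHeight A z M) (h' : HasHeight A w N) :
    HasHeight A (z - w) (M + N + 1) := by
  rw [sub_eq_add_neg]; exact h.add h'.neg

theorem mul {z w : ℂ} {M N : ℕ} (h : HasHeight A z M) (h' : HasHeight A w N) :
    HasHeight A (z * w) (M + N) := by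
  obtain ⟨a, b, ha, hb, h1, rfl⟩ := hasHeight_iff.mp h
  obtain ⟨c, d, hc, hd, h1', rfl⟩ := hasHeight_iff.mp h'
  refine hasHeight_iff.mpr ⟨a * c, b * d, ?_, ?_, mul_ne_zero h1 h1', div_mul_div_comm _ _ _ _⟩
  · rw [pow_add]; exact ha.mul hc
  · rw [pow_add]; exact hb.mul hd

theorem inv {z : ℂ} {M : ℕ} (h : HasHeight A z M) : HasHeight A z⁻¹ M := by
  by_cases hz : z = 0
  · subst hz
    rw [inv_zero]
    exact zero.mono (Nat.zero_le _)
  obtain ⟨a, b, ha, hb, h1, rfl⟩ := hasHeight_iff.mp h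
  exact hasHeight_iff.mpr ⟨b, a, hb, ha, fun h => hz (by simp [h]), inv_div _ _⟩

theorem div {z w : ℂ} {M N : ℕ} (h : HasHeight A z M) (h' : HasHeight A w N) :
    HasHeight A (z / w) (M + N) := by
  rw [div_eq_mul_inv]; exact h.mul h'.inv

theorem list_sum {β : Type*} (l : List β) {f : β → ℂ} {M : ℕ}
    (h : ∀ b ∈ l, HasHeight A (f b) M) :
    HasHeight A (l.map f).sum (l.length * (M + 1)) := by
  induction l with
  | nil => simpa using zero
  | cons b l ih =>
    simp only [List.map_cons, List.sum_cons, List.length_cons]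
    refine ((h b (by simp)).add (ih fun b hb => h b (by simp [hb]))).mono ?_
    rw [add_mul]
    omega

theorem list_prod {β : Type*} (l : List β) {f : β → ℂ} {M : ℕ}
    (h : ∀ b ∈ l, HasHeight A (f b) M) :
    HasHeight A (l.map f).prod (l.length * M) := by
  induction l with
  | nil => simpa using one
  | cons b l ih =>
    simp only [List.map_cons, List.prod_cons, List.length_cons]
    refine ((h b (by simp)).mul (ih fun b hb => h b (by simp [hb]))).mono ?_
    rw [add_mul]
    omega

end HasHeight

end Height

/-! ### Sizes of data and polynomially bounded families -/

/-- `x` has a representation of size at most `N`. -/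
def Data.SizeLE (A : Set ℂ) (x : Data) (N : ℕ) : Prop := ∃ M ≤ N, Data.HasSize A x M

namespace Data

variable {A : Set ℂ}

theorem SizeLE.mono {x : Data} {M N : ℕ} (h : SizeLE A x M) (hMN : M ≤ N) : SizeLE A x N := by
  obtain ⟨K, h1, h2⟩ := h
  exact ⟨K, h1.trans hMN, h2⟩

theorem HasSize.le {x : Data} {M : ℕ} (h : HasSize A x M) : SizeLE A x M := ⟨M, le_rfl, h⟩

theorem SizeLE.nil : SizeLE A nil 1 := HasSize.nil.le

theorem SizeLE.num {z : ℂ} {N : ℕ} (h : HasHeight A z N) : SizeLE A (Data.num z) (N + 1) :=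
  (HasSize.num h).le

theorem SizeLE.pair {x y : Data} {M N : ℕ} (h : SizeLE A x M) (h' : SizeLE A y N) :
    SizeLE A (Data.pair x y) (M + N + 1) := by
  obtain ⟨K, h1, h2⟩ := h
  obtain ⟨K', h1', h2'⟩ := h'
  exact ⟨_, by omega, h2.pair h2'⟩

theorem SizeLE.pair_inv {x y : Data} {N : ℕ} (h : SizeLE A (Data.pair x y) N) :
    ∃ M K, M + K + 1 ≤ N ∧ SizeLE A x M ∧ SizeLE A y K := by
  obtain ⟨K, h1, h2⟩ := h
  cases h2 with
  | pair hx hy => exact ⟨_, _, h1, hx.le, hy.le⟩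

theorem SizeLE.fst {x y : Data} {N : ℕ} (h : SizeLE A (Data.pair x y) N) : SizeLE A x N := by
  obtain ⟨M, K, h1, h2, h3⟩ := h.pair_inv
  exact h2.mono (by omega)

theorem SizeLE.snd {x y : Data} {N : ℕ} (h : SizeLE A (Data.pair x y) N) : SizeLE A y N := by
  obtain ⟨M, K, h1, h2, h3⟩ := h.pair_inv
  exact h3.mono (by omega)

theorem SizeLE.num_inv {z : ℂ} {N : ℕ} (h : SizeLE A (Data.num z) N) : HasHeight A z N := by
  obtain ⟨K, h1, h2⟩ := h
  cases h2 with
  | num hz => exact hz.mono (by omega)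

theorem SizeLE.ofBool (b : Bool) : SizeLE A (ofBool b) 3 := by
  cases b
  · exact SizeLE.nil.mono (by norm_num)
  · exact SizeLE.nil.pair SizeLE.nil

/-- The result of a basic operation is hardly larger than its operand, up to a constant which
accounts for the literals. -/
theorem SizeLE.run (o : Op) (hlit : ∀ d, o = Op.lit d → ∃ N, SizeLE A d N) :
    ∃ K, ∀ x N, SizeLE A x N → SizeLE A (o.run x) (N + K) := by
  cases o with
  | lit d =>
    obtain ⟨K, hK⟩ := hlit d rfl
    exact ⟨K, fun x N _ => hK.mono (by omega)⟩
  | id => exact ⟨0, fun x N h => h⟩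
  | fst =>
    refine ⟨1, fun x N h => ?_⟩
    cases x with
    | pair y z => exact h.fst.mono (by omega)
    | _ => exact SizeLE.nil.mono (by omega)
  | snd =>
    refine ⟨1, fun x N h => ?_⟩
    cases x with
    | pair y z => exact h.snd.mono (by omega)
    | _ => exact SizeLE.nil.mono (by omega)
  | isPair =>
    refine ⟨3, fun x N h => ?_⟩
    cases x with
    | pair y z => exact (SizeLE.ofBool true).mono (by omega)
    | _ => exact SizeLE.nil.mono (by omega)
  | eq =>
    refine ⟨3, fun x N h => ?_⟩
    cases x with
    | pair y z => exact (SizeLE.ofBool _).mono (by omega)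
    | _ => exact SizeLE.nil.mono (by omega)
  | add =>
    refine ⟨2, fun x N h => ?_⟩
    match x, h with
    | Data.pair (Data.num z) (Data.num w), h =>
      obtain ⟨M, K, h1, h2, h3⟩ := h.pair_inv
      exact (SizeLE.num (h2.num_inv.add h3.num_inv)).mono (by omega)
    | Data.nil, _ | Data.num _, _ | Data.pair Data.nil _, _ | Data.pair (Data.pair _ _) _, _
    | Data.pair (Data.num _) Data.nil, _ | Data.pair (Data.num _) (Data.pair _ _), _ =>
      exact SizeLE.nil.mono (by omega)
  | sub =>
    refine ⟨2, fun x N h => ?_⟩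
    match x, h with
    | Data.pair (Data.num z) (Data.num w), h =>
      obtain ⟨M, K, h1, h2, h3⟩ := h.pair_inv
      exact (SizeLE.num (h2.num_inv.sub h3.num_inv)).mono (by omega)
    | Data.nil, _ | Data.num _, _ | Data.pair Data.nil _, _ | Data.pair (Data.pair _ _) _, _
    | Data.pair (Data.num _) Data.nil, _ | Data.pair (Data.num _) (Data.pair _ _), _ =>
      exact SizeLE.nil.mono (by omega)
  | mul =>
    refine ⟨2, fun x N h => ?_⟩
    match x, h with
    | Data.pair (Data.num z) (Data.num w), h =>
      obtain ⟨M, K, h1, h2, h3⟩ := h.pair_inv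
      exact (SizeLE.num (h2.num_inv.mul h3.num_inv)).mono (by omega)
    | Data.nil, _ | Data.num _, _ | Data.pair Data.nil _, _ | Data.pair (Data.pair _ _) _, _
    | Data.pair (Data.num _) Data.nil, _ | Data.pair (Data.num _) (Data.pair _ _), _ =>
      exact SizeLE.nil.mono (by omega)
  | div =>
    refine ⟨2, fun x N h => ?_⟩
    match x, h with
    | Data.pair (Data.num z) (Data.num w), h =>
      obtain ⟨M, K, h1, h2, h3⟩ := h.pair_inv
      exact (SizeLE.num (h2.num_inv.div h3.num_inv)).mono (by omega)
    | Data.nil, _ | Data.num _, _ | Data.pair Data.nil _, _ | Data.pair (Data.pair _ _) _, _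
    | Data.pair (Data.num _) Data.nil, _ | Data.pair (Data.num _) (Data.pair _ _), _ =>
      exact SizeLE.nil.mono (by omega)

theorem SizeLE.ofNat (k : ℕ) : SizeLE A (ofNat k) (2 * k + 1) := by
  induction k with
  | zero => exact SizeLE.nil
  | succ k ih => exact (SizeLE.nil.pair ih).mono (by omega)

theorem SizeLE.ofList {l : List Data} {N : ℕ} (h : ∀ x ∈ l, SizeLE A x N) :
    SizeLE A (ofList l) (l.length * (N + 1) + 1) := by
  induction l with
  | nil => exact SizeLE.nil.mono (by simp)
  | cons x l ih =>
    refine ((h x (by simp)).pair (ih fun y hy => h y (by simp [hy]))).mono ?_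
    simp only [List.length_cons, add_mul]
    omega

theorem SizeLE.length_le {l : List Data} {N : ℕ} (h : SizeLE A (Data.ofList l) N) :
    l.length ≤ N := by
  induction l generalizing N with
  | nil => simp
  | cons x l ih =>
    obtain ⟨M, K, h1, h2, h3⟩ := h.pair_inv
    have := ih h3
    simp only [List.length_cons]
    omega

theorem SizeLE.of_mem {l : List Data} {N : ℕ} (h : SizeLE A (Data.ofList l) N) {x : Data}
    (hx : x ∈ l) : SizeLE A x N := by
  induction l with
  | nil => simp at hx
  | cons y l ih =>
    rcases List.mem_cons.mp hx with rfl | hx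
    · exact h.fst
    · exact ih h.snd hx

theorem SizeLE.ofTable {k : ℕ} {f : (Fin k → Bool) → ℂ} {N : ℕ} (h : ∀ b, HasHeight A (f b) N) :
    SizeLE A (ofTable k f) (2 ^ k * (N + 2) - 1) := by
  induction k with
  | zero => exact (SizeLE.num (h _)).mono (by omega)
  | succ k ih =>
    refine ((ih fun b => h _).pair (ih fun b => h _)).mono ?_
    have : 0 < 2 ^ k * (N + 2) := by positivity
    rw [pow_succ, mul_comm (2 ^ k) 2, mul_assoc]
    omega

end Data

/-- The family `f` of natural numbers is bounded by a polynomial in the parameter `n`. -/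
def PolyBounded {α : Type} (n f : α → ℕ) : Prop := ∃ p : Polynomial ℕ, ∀ a, f a ≤ p.eval (n a)

namespace PolyBounded

variable {α β : Type} {n f g : α → ℕ}

theorem self : PolyBounded n n := ⟨Polynomial.X, by simp⟩

theorem const (k : ℕ) : PolyBounded n fun _ => k := ⟨Polynomial.C k, by simp⟩

theorem eval (p : Polynomial ℕ) : PolyBounded n fun a => p.eval (n a) := ⟨p, fun _ => le_rfl⟩

theorem mono (hg : PolyBounded n g) (h : ∀ a, f a ≤ g a) : PolyBounded n f := by
  obtain ⟨p, hp⟩ := hg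
  exact ⟨p, fun a => (h a).trans (hp a)⟩

theorem add (hf : PolyBounded n f) (hg : PolyBounded n g) : PolyBounded n fun a => f a + g a := by
  obtain ⟨p, hp⟩ := hf
  obtain ⟨q, hq⟩ := hg
  exact ⟨p + q, fun a => by rw [Polynomial.eval_add]; exact add_le_add (hp a) (hq a)⟩

theorem mul (hf : PolyBounded n f) (hg : PolyBounded n g) : PolyBounded n fun a => f a * g a := by
  obtain ⟨p, hp⟩ := hf
  obtain ⟨q, hq⟩ := hg
  exact ⟨p * q, fun a => by rw [Polynomial.eval_mul]; exact Nat.mul_le_mul (hp a) (hq a)⟩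

theorem comp (hf : PolyBounded n f) (g : β → α) :
    PolyBounded (fun b => n (g b)) fun b => f (g b) := by
  obtain ⟨p, hp⟩ := hf
  exact ⟨p, fun b => hp _⟩

end PolyBounded

/-- The family `x` of data has representations of polynomially bounded size. -/
def PolySize (A : Set ℂ) {α : Type} (n : α → ℕ) (x : α → Data) : Prop :=
  ∃ f, PolyBounded n f ∧ ∀ a, Data.SizeLE A (x a) (f a)

namespace PolySize

open Data (nil num pair SizeLE ofList ofNat ofBool ofTable)

variable {A : Set ℂ} {α β : Type} {n : α → ℕ} {x y : α → Data}

theorem of_le {f : α → ℕ} (h : ∀ a, SizeLE A (x a) (f a)) (hf : PolyBounded n f) :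
    PolySize A n x := ⟨f, hf, h⟩

theorem comp (h : PolySize A n x) (g : β → α) :
    PolySize A (fun b => n (g b)) fun b => x (g b) := by
  obtain ⟨f, hf, h⟩ := h
  exact ⟨_, hf.comp g, fun b => h _⟩

theorem pair (hx : PolySize A n x) (hy : PolySize A n y) :
    PolySize A n fun a => Data.pair (x a) (y a) := by
  obtain ⟨f, hf, hx⟩ := hx
  obtain ⟨g, hg, hy⟩ := hy
  exact ⟨_, (hf.add hg).add (.const 1), fun a => (hx a).pair (hy a)⟩

theorem fst (h : PolySize A n fun a => Data.pair (x a) (y a)) : PolySize A n x := by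
  obtain ⟨f, hf, h⟩ := h
  exact ⟨f, hf, fun a => (h a).fst⟩

theorem snd (h : PolySize A n fun a => Data.pair (x a) (y a)) : PolySize A n y := by
  obtain ⟨f, hf, h⟩ := h
  exact ⟨f, hf, fun a => (h a).snd⟩

theorem num {z : α → ℂ} {f : α → ℕ} (h : ∀ a, HasHeight A (z a) (f a)) (hf : PolyBounded n f) :
    PolySize A n fun a => Data.num (z a) :=
  ⟨_, hf.add (.const 1), fun a => SizeLE.num (h a)⟩

theorem num_inv {z : α → ℂ} (h : PolySize A n fun a => Data.num (z a)) :
    ∃ f, PolyBounded n f ∧ ∀ a, HasHeight A (z a) (f a) := by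
  obtain ⟨f, hf, h⟩ := h
  exact ⟨f, hf, fun a => (h a).num_inv⟩

theorem ofNat {f : α → ℕ} (hf : PolyBounded n f) : PolySize A n fun a => Data.ofNat (f a) :=
  ⟨_, ((PolyBounded.const 2).mul hf).add (.const 1), fun _ => SizeLE.ofNat _⟩

/-- A family of lists has polynomially bounded size if the lengths and, uniformly, the elements
have. The elements are indexed by the pairs of an index and a member of the list. -/
theorem listOf {l : α → List β} {e : α → β → Data} {f : α → ℕ}
    (hf : PolyBounded n f) (hlen : ∀ a, (l a).length ≤ f a)
    (he : PolySize A (fun c : {p : α × β // p.2 ∈ l p.1} => n c.1.1) fun c => e c.1.1 c.1.2) :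
    PolySize A n fun a => ofList ((l a).map (e a)) := by
  obtain ⟨g, ⟨p, hp⟩, hg⟩ := he
  refine ⟨_, (hf.mul ((PolyBounded.eval p).add (.const 1))).add (.const 1), fun a => ?_⟩
  refine (SizeLE.ofList (N := p.eval (n a)) ?_).mono ?_
  · intro y hy
    obtain ⟨b, hb, rfl⟩ := List.mem_map.mp hy
    exact (hg ⟨(a, b), hb⟩).mono (hp _)
  · rw [List.length_map]
    exact Nat.add_le_add_right (Nat.mul_le_mul_right _ (hlen a)) 1

theorem length {l : α → List β} {e : α → β → Data}
    (h : PolySize A n fun a => ofList ((l a).map (e a))) :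
    PolyBounded n fun a => (l a).length := by
  obtain ⟨f, hf, h⟩ := h
  exact hf.mono fun a => by simpa using (h a).length_le

theorem mem {l : α → List β} {e : α → β → Data}
    (h : PolySize A n fun a => ofList ((l a).map (e a))) :
    PolySize A (fun c : {p : α × β // p.2 ∈ l p.1} => n c.1.1) fun c => e c.1.1 c.1.2 := by
  obtain ⟨f, hf, h⟩ := h
  exact ⟨fun c => f c.1.1, hf.comp _, fun c => (h _).of_mem (List.mem_map_of_mem c.2)⟩

end PolySize

/-! ### Polynomial-time computable families -/

/-- The family `y` of data is computed from the family `x` by a single oracle program, at a cost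
that is polynomially bounded in the parameter `n`. The index type is arbitrary: it collects the
values of all variables on which the data depend, and is changed when passing to the body of a
loop. -/
def FP (A : Set ℂ) (O : Data → Data → Prop) {α : Type} (n : α → ℕ) (x y : α → Data) : Prop :=
  ∃ (c : Program) (f : α → ℕ), PolyBounded n f ∧ ∀ a, ∃ t ≤ f a, Eval A O c (x a) (y a) t

/-- The cost of a computation bounds the sizes of its input and of its output. -/
theorem Eval.sizeLE {A : Set ℂ} {O : Data → Data → Prop} {c : Program} {x y : Data} {t : ℕ}
    (h : Eval A O c x y t) : x.SizeLE A t ∧ y.SizeLE A t := by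
  induction h with
  | op h1 h2 => exact ⟨h1.le.mono (by omega), h2.le.mono (by omega)⟩
  | oracle _ h1 h2 => exact ⟨h1.le.mono (by omega), h2.le.mono (by omega)⟩
  | comp _ _ h1 h2 => exact ⟨h1.1.mono (by omega), h2.2.mono (by omega)⟩
  | pair _ _ h1 h2 => exact ⟨h1.1.mono (by omega), h1.2.pair h2.2⟩
  | condTrue _ _ _ h1 h2 => exact ⟨h1.1.mono (by omega), h2.2.mono (by omega)⟩
  | condFalse _ _ h1 h2 => exact ⟨h1.1.mono (by omega), h2.2.mono (by omega)⟩
  | loopStop _ h1 => exact ⟨h1.1.mono (by omega), h1.1.mono (by omega)⟩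
  | loopStep _ _ _ _ h1 _ h3 => exact ⟨h1.1.mono (by omega), h3.2.mono (by omega)⟩

/-- The situation of a loop over the lists `l a` before it treats the element `cur`. -/
structure FoldCtx {α β : Type} (l : α → List β) where
  base : α
  pre : List β
  cur : β
  suf : List β
  eq : l base = pre ++ cur :: suf

/-- The pairs of an index and a member of the list at this index. -/
abbrev MemCtx {α β : Type} (l : α → List β) : Type := {p : α × β // p.2 ∈ l p.1}

namespace FP

open Data (nil num pair SizeLE ofList ofNat ofBool ofTable)

variable {A : Set ℂ} {O : Data → Data → Prop} {α β γ : Type} {n : α → ℕ} {x y z : α → Data}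

theorem left (h : FP A O n x y) : PolySize A n x := by
  obtain ⟨c, f, hf, h⟩ := h
  refine ⟨f, hf, fun a => ?_⟩
  obtain ⟨t, ht, h⟩ := h a
  exact h.sizeLE.1.mono ht

theorem right (h : FP A O n x y) : PolySize A n y := by
  obtain ⟨c, f, hf, h⟩ := h
  refine ⟨f, hf, fun a => ?_⟩
  obtain ⟨t, ht, h⟩ := h a
  exact h.sizeLE.2.mono ht

theorem comp (h : FP A O n x y) (g : β → α) :
    FP A O (fun b => n (g b)) (fun b => x (g b)) fun b => y (g b) := by
  obtain ⟨c, f, hf, h⟩ := h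
  exact ⟨c, _, hf.comp g, fun b => h _⟩

theorem trans (h : FP A O n x y) (h' : FP A O n y z) : FP A O n x z := by
  obtain ⟨c, f, hf, h⟩ := h
  obtain ⟨c', f', hf', h'⟩ := h'
  refine ⟨.comp c' c, _, (hf.add hf').add (.const 1), fun a => ?_⟩
  obtain ⟨t, ht, h⟩ := h a
  obtain ⟨t', ht', h'⟩ := h' a
  exact ⟨_, by omega, h.comp h'⟩

theorem pair (h : FP A O n x y) (h' : FP A O n x z) :
    FP A O n x fun a => Data.pair (y a) (z a) := by
  obtain ⟨c, f, hf, h⟩ := h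
  obtain ⟨c', f', hf', h'⟩ := h'
  refine ⟨.pair c c', _, (hf.add hf').add (.const 1), fun a => ?_⟩
  obtain ⟨t, ht, h⟩ := h a
  obtain ⟨t', ht', h'⟩ := h' a
  exact ⟨_, by omega, h.pair h'⟩

theorem op (o : Op) (hlit : ∀ d, o = Op.lit d → ∃ N, SizeLE A d N) (h : FP A O n x y) :
    FP A O n x fun a => o.run (y a) := by
  obtain ⟨K, hK⟩ := SizeLE.run o hlit
  refine h.trans ?_
  obtain ⟨f, hf, hy⟩ := h.right
  refine ⟨.op o, _, (hf.add (hf.add (.const K))).add (.const 1), fun a => ?_⟩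
  obtain ⟨M, hM, h1⟩ := hy a
  obtain ⟨N, hN, h2⟩ := hK _ _ (hy a)
  exact ⟨_, by omega, .op h1 h2⟩

theorem refl (hx : PolySize A n x) : FP A O n x x := by
  obtain ⟨f, hf, hx⟩ := hx
  refine ⟨.op .id, _, (hf.add hf).add (.const 1), fun a => ?_⟩
  obtain ⟨M, hM, h1⟩ := hx a
  exact ⟨_, by omega, .op h1 h1⟩

theorem const (hx : PolySize A n x) (d : Data) (hd : ∃ N, SizeLE A d N) :
    FP A O n x fun _ => d :=
  op (.lit d) (fun _ h => by cases h; exact hd) (refl hx)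

theorem nil (hx : PolySize A n x) : FP A O n x fun _ => Data.nil := const hx _ ⟨_, SizeLE.nil⟩

theorem fst' (h : FP A O n x y) : FP A O n x fun a => Op.fst.run (y a) :=
  op .fst (fun _ h => by cases h) h

theorem snd' (h : FP A O n x y) : FP A O n x fun a => Op.snd.run (y a) :=
  op .snd (fun _ h => by cases h) h

theorem fst (h : FP A O n x fun a => Data.pair (y a) (z a)) : FP A O n x y := fst' h

theorem snd (h : FP A O n x fun a => Data.pair (y a) (z a)) : FP A O n x z := snd' h

theorem add {f g : α → ℂ} (hf : FP A O n x fun a => num (f a))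
    (hg : FP A O n x fun a => num (g a)) :
    FP A O n x fun a => num (f a + g a) :=
  op .add (fun _ h => by cases h) (hf.pair hg)

theorem sub {f g : α → ℂ} (hf : FP A O n x fun a => num (f a))
    (hg : FP A O n x fun a => num (g a)) :
    FP A O n x fun a => num (f a - g a) :=
  op .sub (fun _ h => by cases h) (hf.pair hg)

theorem mul {f g : α → ℂ} (hf : FP A O n x fun a => num (f a))
    (hg : FP A O n x fun a => num (g a)) :
    FP A O n x fun a => num (f a * g a) :=
  op .mul (fun _ h => by cases h) (hf.pair hg)

theorem div {f g : α → ℂ} (hf : FP A O n x fun a => num (f a))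
    (hg : FP A O n x fun a => num (g a)) :
    FP A O n x fun a => num (f a / g a) :=
  op .div (fun _ h => by cases h) (hf.pair hg)

theorem constNum (hx : PolySize A n x) {w : ℂ} {N : ℕ} (hw : HasHeight A w N) :
    FP A O n x fun _ => num w := const hx _ ⟨_, SizeLE.num hw⟩

theorem constBool (hx : PolySize A n x) (b : Bool) : FP A O n x fun _ => ofBool b :=
  const hx _ ⟨_, SizeLE.ofBool b⟩

open Classical in
theorem eq (hy : FP A O n x y) (hz : FP A O n x z) :
    FP A O n x fun a => ofBool (decide (y a = z a)) :=
  op .eq (fun _ h => by cases h) (hy.pair hz)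

theorem isPair (hy : FP A O n x y) : FP A O n x fun a => Op.isPair.run (y a) :=
  op .isPair (fun _ h => by cases h) hy

/-- Case distinction: it is enough to compute `y` where a computable test succeeds and where it
fails. -/
theorem byCases {b : α → Bool} (hb : FP A O n x fun a => ofBool (b a))
    (h1 : FP A O (fun a : {a // b a = true} => n a) (fun a => x a) fun a => y a)
    (h0 : FP A O (fun a : {a // b a = false} => n a) (fun a => x a) fun a => y a) :
    FP A O n x y := by
  obtain ⟨c, f, hf, h⟩ := hb
  obtain ⟨c1, f1, ⟨p1, hf1⟩, h1⟩ := h1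
  obtain ⟨c0, f0, ⟨p0, hf0⟩, h0⟩ := h0
  refine ⟨.cond c c1 c0, fun a => f a + (p1.eval (n a) + p0.eval (n a)) + 1,
    (hf.add (.add (.eval p1) (.eval p0))).add (.const 1), fun a => ?_⟩
  obtain ⟨t, ht, h⟩ := h a
  beta_reduce at h
  cases hba : b a with
  | true =>
    obtain ⟨t', ht', h'⟩ := h1 ⟨a, hba⟩
    have := hf1 ⟨a, hba⟩
    exact ⟨_, by simp only at *; omega, .condTrue h (by simp [hba, ofBool]) h'⟩
  | false =>
    obtain ⟨t', ht', h'⟩ := h0 ⟨a, hba⟩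
    have := hf0 ⟨a, hba⟩
    rw [hba] at h
    exact ⟨_, by simp only at *; omega, .condFalse h h'⟩

theorem ite {b : α → Prop} [DecidablePred b] (hb : FP A O n x fun a => ofBool (decide (b a)))
    (hy : FP A O n x y) (hz : FP A O n x z) : FP A O n x fun a => if b a then y a else z a := by
  refine byCases hb ?_ ?_
  · convert hy.comp (Subtype.val : {a // decide (b a) = true} → α) using 2 with a
    simp [of_decide_eq_true a.2]
  · convert hz.comp (Subtype.val : {a // decide (b a) = false} → α) using 2 with a
    simp [of_decide_eq_false a.2]

theorem not {b : α → Bool} (hb : FP A O n x fun a => ofBool (b a)) :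
    FP A O n x fun a => ofBool (!b a) := by
  refine byCases hb ?_ ?_
  · convert constBool (hb.left.comp _) false using 3 with a
    simp [a.2]
  · convert constBool (hb.left.comp _) true using 3 with a
    simp [a.2]

theorem and {b c : α → Bool} (hb : FP A O n x fun a => ofBool (b a))
    (hc : FP A O n x fun a => ofBool (c a)) : FP A O n x fun a => ofBool (b a && c a) := by
  refine byCases hb ?_ ?_
  · convert hc.comp (Subtype.val : {a // b a = true} → α) using 3 with a
    simp [a.2]
  · convert constBool (hb.left.comp _) false using 3 with a
    simp [a.2]

/-- A variable of an outer computation is available in the body of a loop. -/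
theorem lift {g : β → α} {w : β → Data} (h : FP A O n x y)
    (hw : PolySize A (fun b => n (g b)) fun b => Data.pair (x (g b)) (w b)) :
    FP A O (fun b => n (g b)) (fun b => Data.pair (x (g b)) (w b)) fun b => y (g b) :=
  (fst (refl hw)).trans (h.comp g)

/-- Loops over a list: if the initial state is computable, and the next state from the variables,
the current element and the current state, then so is the final state. The computability of the body
is required only at the states that occur, but uniformly in the position in the list; it includes a
polynomial bound for the sizes of these states. -/
theorem foldl {σ : Type} {l : α → List β} {e : α → β → Data} {s0 : α → σ} {eσ : α → σ → Data}
    {f : α → σ → β → σ}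
    (hl : FP A O n x fun a => ofList ((l a).map (e a)))
    (h0 : FP A O n x fun a => eσ a (s0 a))
    (hbody : FP A O (fun c : FoldCtx l => n c.base)
      (fun c => Data.pair (x c.base) (Data.pair (e c.base c.cur)
        (eσ c.base (c.pre.foldl (f c.base) (s0 c.base)))))
      (fun c => eσ c.base (f c.base (c.pre.foldl (f c.base) (s0 c.base)) c.cur))) :
    FP A O n x fun a => eσ a ((l a).foldl (f a) (s0 a)) := by
  -- the state of the machine loop: the remaining list, the variables and the state
  let st : α → List β → List β → Data := fun a pre suf =>
    Data.pair (ofList (suf.map (e a))) (Data.pair (x a) (eσ a (pre.foldl (f a) (s0 a))))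
  have hlen : PolyBounded n fun a => (l a).length := hl.right.length
  have hstep : FP A O (fun c : FoldCtx l => n c.base) (fun c => st c.base c.pre (c.cur :: c.suf))
      fun c => st c.base (c.pre ++ [c.cur]) c.suf := by
    have hin := hbody.left
    have hsuf : PolySize A (fun c : FoldCtx l => n c.base)
        fun c => ofList (c.suf.map (e c.base)) := by
      refine PolySize.listOf (hlen.comp FoldCtx.base) (fun c => by simp [c.eq]; omega) ?_
      exact hl.right.mem.comp fun c : {p : FoldCtx l × β // p.2 ∈ p.1.suf} =>
        (⟨(c.1.1.base, c.1.2), by simp [c.1.1.eq, c.2]⟩ : MemCtx l)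
    have h1 : FP A O (fun c : FoldCtx l => n c.base)
        (fun c => st c.base c.pre (c.cur :: c.suf)) (fun c => st c.base c.pre (c.cur :: c.suf)) :=
      refl ((hin.snd.fst.pair hsuf).pair (hin.fst.pair hin.snd.snd))
    refine (h1.fst.snd.pair (h1.snd.fst.pair
      ((h1.snd.fst.pair (h1.fst.fst.pair h1.snd.snd)).trans hbody))).trans (refl ?_) |>.trans ?_
    · exact hsuf.pair (hin.fst.pair hbody.right)
    · simp only [st, List.foldl_append, List.foldl_cons, List.foldl_nil]
      exact refl (hsuf.pair (hin.fst.pair hbody.right))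
  have hinit : FP A O n x fun a => st a [] (l a) := hl.pair ((refl hl.left).pair h0)
  obtain ⟨c, k, ⟨p, hp⟩, hc⟩ := hstep
  obtain ⟨q, hq, hinitsize⟩ := hinit.right
  -- every state is the initial one or has been computed by the body
  have hsize : ∀ a pre suf, l a = pre ++ suf → SizeLE A (st a pre suf) (q a + p.eval (n a)) := by
    intro a pre suf h
    rcases List.eq_nil_or_concat pre with rfl | ⟨pre', b, rfl⟩
    · rw [List.nil_append] at h
      subst h
      exact (hinitsize a).mono (by omega)
    · rw [List.concat_eq_append]
      obtain ⟨t, ht, hE⟩ := hc ⟨a, pre', b, suf, by simpa using h⟩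
      have := hp ⟨a, pre', b, suf, by simpa using h⟩
      exact hE.sizeLE.2.mono (by simp only at *; omega)
  have hrun : ∀ a suf pre, l a = pre ++ suf → ∃ t ≤ (suf.length + 1) *
      (2 * (q a + p.eval (n a)) + p.eval (n a) + 3),
      Eval A O (.loop (.op .fst) c) (st a pre suf) (st a (l a) []) t := by
    intro a suf
    induction suf with
    | nil =>
      intro pre h
      obtain ⟨M, hM, h1⟩ := hsize a pre [] h
      have he : Eval A O (.op .fst) (st a pre []) Data.nil (M + 1 + 1) :=
        Eval.op (o := .fst) h1 Data.HasSize.nil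
      rw [List.append_nil] at h
      rw [h]
      exact ⟨_, by simp only [List.length_nil]; omega, he.loopStop⟩
    | cons b suf ih =>
      intro pre h
      obtain ⟨M, hM, h1⟩ := hsize a pre (b :: suf) h
      obtain ⟨N, hN, h2⟩ := (hsize a pre (b :: suf) h).fst
      have he : Eval A O (.op .fst) (st a pre (b :: suf)) (ofList ((b :: suf).map (e a)))
          (M + N + 1) := Eval.op (o := .fst) h1 h2
      obtain ⟨t, ht, hE⟩ := hc ⟨a, pre, b, suf, h⟩
      have hpt := hp ⟨a, pre, b, suf, h⟩
      obtain ⟨t', ht', hE'⟩ := ih (pre ++ [b]) (by simpa using h)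
      refine ⟨_, ?_, Eval.loopStep he (by simp [ofList]) hE hE'⟩
      simp only [List.length_cons, add_mul] at *
      omega
  refine hinit.trans (FP.snd (y := fun a => x a) (FP.snd (y := fun a => Data.nil) ?_))
  refine ⟨.loop (.op .fst) c, _, (hlen.add (.const 1)).mul
    ((((PolyBounded.const 2).mul (hq.add (.eval p))).add (.eval p)).add
      (.const 3)), fun a => ?_⟩
  exact hrun a (l a) [] rfl

end FP

/-! ### Lists, unary numbers and tables in polynomial time -/

namespace FP

open Data (nil num pair SizeLE ofList ofNat ofBool ofTable)

variable {A : Set ℂ} {O : Data → Data → Prop} {α β γ : Type} {n : α → ℕ} {x y z : α → Data}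

theorem nilList (hx : PolySize A n x) (e : α → β → Data) :
    FP A O n x fun a => ofList (([] : List β).map (e a)) := nil hx

theorem cons {l : α → List β} {e : α → β → Data} {b : α → β} (hb : FP A O n x fun a => e a (b a))
    (hl : FP A O n x fun a => ofList ((l a).map (e a))) :
    FP A O n x fun a => ofList ((b a :: l a).map (e a)) := hb.pair hl

theorem foldCtx_cur_size {l : α → List β} {e : α → β → Data}
    (hl : PolySize A n fun a => ofList ((l a).map (e a))) :
    PolySize A (fun c : FoldCtx l => n c.base) fun c => e c.base c.cur :=
  hl.mem.comp fun c : FoldCtx l => (⟨(c.base, c.cur), by simp [c.eq]⟩ : MemCtx l)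

theorem reverse {l : α → List β} {e : α → β → Data}
    (hl : FP A O n x fun a => ofList ((l a).map (e a))) :
    FP A O n x fun a => ofList ((l a).reverse.map (e a)) := by
  have key : ∀ a, (l a).reverse = (l a).foldl (fun acc b => b :: acc) [] := by
    intro a; simp [← List.foldr_reverse]
  simp only [key]
  refine foldl (eσ := fun a s => ofList (s.map (e a))) (f := fun _ acc b => b :: acc) hl
    (nilList hl.left e) ?_
  have hs : PolySize A (fun c : FoldCtx l => n c.base) fun c => ofList
      ((c.pre.foldl (fun acc b => b :: acc) []).map (e c.base)) := by
    simp only [← List.foldr_reverse]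
    refine PolySize.listOf (hl.right.length.comp FoldCtx.base) (fun c => by simp [c.eq]) ?_
    exact hl.right.mem.comp fun c : {p : FoldCtx l × β // p.2 ∈ _} =>
      (⟨(c.1.1.base, c.1.2), by have := c.2; simp_all [c.1.1.eq]⟩ : MemCtx l)
  have h := refl (O := O) ((hl.left.comp FoldCtx.base).pair ((foldCtx_cur_size hl.right).pair hs))
  exact cons h.snd.fst h.snd.snd

theorem append {l l' : α → List β} {e : α → β → Data}
    (hl : FP A O n x fun a => ofList ((l a).map (e a)))
    (hl' : FP A O n x fun a => ofList ((l' a).map (e a))) :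
    FP A O n x fun a => ofList ((l a ++ l' a).map (e a)) := by
  have key : ∀ a, l a ++ l' a = (l a).reverse.foldl (fun acc b => b :: acc) (l' a) := by
    intro a; simp
  simp only [key]
  refine foldl (eσ := fun a s => ofList (s.map (e a))) (f := fun _ acc b => b :: acc) hl.reverse
    hl' ?_
  have hr := hl.reverse.right
  have hs : PolySize A (fun c : FoldCtx fun a => (l a).reverse => n c.base) fun c => ofList
      ((c.pre.foldl (fun acc b => b :: acc) (l' c.base)).map (e c.base)) := by
    refine PolySize.listOf ((hr.length.add hl'.right.length).comp FoldCtx.base)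
      (fun c => ?_) ?_
    · simp [c.eq]
    · obtain ⟨f, hf, hf'⟩ := hr.mem
      obtain ⟨g, hg, hg'⟩ := hl'.right.mem
      obtain ⟨p, hp⟩ := hf
      obtain ⟨q, hq⟩ := hg
      refine ⟨fun c => p.eval (n c.1.1.base) + q.eval (n c.1.1.base),
        (PolyBounded.eval p).add (.eval q), fun c => ?_⟩
      have hc : c.1.2 ∈ (l c.1.1.base).reverse ∨ c.1.2 ∈ l' c.1.1.base := by
        have := c.2
        have h2 := c.1.1.eq
        simp only [List.foldl_flip_cons_eq_append, List.mem_append] at this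
        rw [h2]
        simp only [List.mem_append, List.mem_cons]
        rcases this with h | h
        · simp at h; tauto
        · exact .inr h
      rcases hc with h | h
      · exact (hf' ⟨(c.1.1.base, c.1.2), h⟩).mono ((hp _).trans (by simp))
      · exact (hg' ⟨(c.1.1.base, c.1.2), h⟩).mono ((hq _).trans (by simp))
  have h := refl (O := O) ((hl.left.comp FoldCtx.base).pair ((foldCtx_cur_size hr).pair hs))
  exact cons h.snd.fst h.snd.snd

/-- The input of a computation in the scope of a bound element of a list. -/
theorem memCtx_input {l : α → List β} {e : α → β → Data} (hx : PolySize A n x)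
    (hl : PolySize A n fun a => ofList ((l a).map (e a))) :
    PolySize A (fun c : MemCtx l => n c.1.1) fun c => Data.pair (x c.1.1) (e c.1.1 c.1.2) :=
  (hx.comp fun c : MemCtx l => c.1.1).pair hl.mem

/-- A computation in the scope of a bound element of a list can be used as the body of a loop. -/
theorem toFold {l : α → List β} {e : α → β → Data} {w : α → β → Data}
    (h : FP A O (fun c : MemCtx l => n c.1.1) (fun c => Data.pair (x c.1.1) (e c.1.1 c.1.2))
      fun c => w c.1.1 c.1.2) {s : FoldCtx l → Data}
    (hs : PolySize A (fun c : FoldCtx l => n c.base) s) :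
    FP A O (fun c : FoldCtx l => n c.base)
      (fun c => Data.pair (x c.base) (Data.pair (e c.base c.cur) (s c)))
      fun c => w c.base c.cur := by
  have h' := h.comp fun c : FoldCtx l => (⟨(c.base, c.cur), by simp [c.eq]⟩ : MemCtx l)
  have h0 := refl (O := O) (h'.left.fst.pair (h'.left.snd.pair hs))
  exact (h0.fst.pair h0.snd.fst).trans h'

theorem flatMap {l : α → List β} {e : α → β → Data} {g : α → β → List γ} {e' : α → γ → Data}
    (hl : FP A O n x fun a => ofList ((l a).map (e a)))
    (hg : FP A O (fun c : MemCtx l => n c.1.1) (fun c => Data.pair (x c.1.1) (e c.1.1 c.1.2))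
      fun c => ofList ((g c.1.1 c.1.2).map (e' c.1.1))) :
    FP A O n x fun a => ofList (((l a).flatMap (g a)).map (e' a)) := by
  have key : ∀ a, (l a).flatMap (g a) = (l a).foldl (fun acc b => acc ++ g a b) [] := by
    intro a
    rw [List.flatMap_eq_foldl]
  simp only [key]
  refine foldl (eσ := fun a s => ofList (s.map (e' a))) (f := fun a acc b => acc ++ g a b) hl
    (nilList hl.left e') ?_
  have hs : PolySize A (fun c : FoldCtx l => n c.base) fun c => ofList
      ((c.pre.foldl (fun acc b => acc ++ g c.base b) []).map (e' c.base)) := by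
    simp only [← List.flatMap_eq_foldl]
    obtain ⟨p, hp⟩ := hg.right.length
    refine PolySize.listOf (f := fun c => (l c.base).length * p.eval (n c.base))
      ((hl.right.length.comp FoldCtx.base).mul (.eval p)) (fun c => ?_) ?_
    · rw [List.length_flatMap]
      refine (List.sum_le_card_nsmul _ (p.eval (n c.base)) ?_).trans ?_
      · intro k hk
        obtain ⟨b, hb, rfl⟩ := List.mem_map.mp hk
        exact hp ⟨(c.base, b), by simp [c.eq, hb]⟩
      · simp [c.eq, add_mul]
    · obtain ⟨f, ⟨q, hq⟩, hf⟩ := hg.right.mem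
      refine ⟨fun c => q.eval (n c.1.1.base), .eval q, fun c => ?_⟩
      obtain ⟨b, hb, hc⟩ := List.mem_flatMap.mp c.2
      exact (hf ⟨(⟨(c.1.1.base, b), by simp [c.1.1.eq, hb]⟩, c.1.2), hc⟩).mono (hq _)
  have h := refl (O := O) ((hl.left.comp FoldCtx.base).pair ((foldCtx_cur_size hl.right).pair hs))
  exact append h.snd.snd (toFold (w := fun a b => ofList ((g a b).map (e' a))) hg hs)

theorem map {l : α → List β} {e : α → β → Data} {g : α → β → γ} {e' : α → γ → Data}
    (hl : FP A O n x fun a => ofList ((l a).map (e a)))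
    (hg : FP A O (fun c : MemCtx l => n c.1.1) (fun c => Data.pair (x c.1.1) (e c.1.1 c.1.2))
      fun c => e' c.1.1 (g c.1.1 c.1.2)) :
    FP A O n x fun a => ofList (((l a).map (g a)).map (e' a)) := by
  have key : ∀ a, (l a).map (g a) = (l a).flatMap fun b => [g a b] := by
    intro a
    induction l a with
    | nil => rfl
    | cons b l ih => simp [ih]
  simp only [key]
  exact flatMap hl (hg.pair (nil hg.left))

theorem filter {l : α → List β} {e : α → β → Data} {g : α → β → Bool}
    (hl : FP A O n x fun a => ofList ((l a).map (e a)))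
    (hg : FP A O (fun c : MemCtx l => n c.1.1) (fun c => Data.pair (x c.1.1) (e c.1.1 c.1.2))
      fun c => ofBool (g c.1.1 c.1.2)) :
    FP A O n x fun a => ofList (((l a).filter (g a)).map (e a)) := by
  have key : ∀ a, (l a).filter (g a) = (l a).flatMap fun b => if g a b then [b] else [] := by
    intro a
    induction l a with
    | nil => rfl
    | cons b l ih => by_cases h : g a b <;> simp [h, ih]
  simp only [key]
  refine flatMap hl (byCases hg ?_ ?_)
  · have h := (refl (O := O) hg.left).comp
      (Subtype.val : {c : MemCtx l // g c.1.1 c.1.2 = true} → MemCtx l)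
    convert h.snd.pair (nil h.left) using 2 with c
    simp [c.2, ofList]
  · have h := (refl (O := O) hg.left).comp
      (Subtype.val : {c : MemCtx l // g c.1.1 c.1.2 = false} → MemCtx l)
    convert nil h.left using 2 with c
    simp [c.2, ofList]

theorem all {l : α → List β} {e : α → β → Data} {g : α → β → Bool}
    (hl : FP A O n x fun a => ofList ((l a).map (e a)))
    (hg : FP A O (fun c : MemCtx l => n c.1.1) (fun c => Data.pair (x c.1.1) (e c.1.1 c.1.2))
      fun c => ofBool (g c.1.1 c.1.2)) :
    FP A O n x fun a => ofBool ((l a).all (g a)) := by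
  have key : ∀ a, (l a).all (g a) = (l a).foldl (fun acc b => acc && g a b) true := by
    intro a
    have : ∀ (L : List β) (c : Bool),
        (c && L.all (g a)) = L.foldl (fun acc b => acc && g a b) c := by
      intro L
      induction L with
      | nil => simp
      | cons b L ih => intro c; rw [List.foldl_cons, ← ih, List.all_cons, Bool.and_assoc]
    simpa using this (l a) true
  simp only [key]
  refine foldl (eσ := fun _ s => ofBool s) (f := fun a acc b => acc && g a b) hl
    (constBool hl.left true) ?_
  have hs : PolySize A (fun c : FoldCtx l => n c.base) fun c => ofBool
      (c.pre.foldl (fun acc b => acc && g c.base b) true) :=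
    ⟨_, .const 3, fun c => SizeLE.ofBool _⟩
  have h := refl (O := O) ((hl.left.comp FoldCtx.base).pair ((foldCtx_cur_size hl.right).pair hs))
  exact and h.snd.snd (toFold (w := fun a b => ofBool (g a b)) hg hs)

theorem ofNat_eq (k : ℕ) : ofNat k = ofList ((List.replicate k ()).map fun _ => Data.nil) := by
  induction k with
  | zero => rfl
  | succ k ih => simp [ofNat, ofList, List.replicate_succ, ih]

theorem length {l : α → List β} {e : α → β → Data}
    (hl : FP A O n x fun a => ofList ((l a).map (e a))) :
    FP A O n x fun a => ofNat (l a).length := by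
  have h := map (g := fun _ _ => ()) (e' := fun _ _ => Data.nil) hl
    (nil (memCtx_input hl.left hl.right))
  simp only [ofNat_eq]
  convert h using 5
  simp

theorem sum {l : α → List β} {e : α → β → Data} {g : α → β → ℂ}
    (hl : FP A O n x fun a => ofList ((l a).map (e a)))
    (hg : FP A O (fun c : MemCtx l => n c.1.1) (fun c => Data.pair (x c.1.1) (e c.1.1 c.1.2))
      fun c => num (g c.1.1 c.1.2)) :
    FP A O n x fun a => num ((l a).map (g a)).sum := by
  have key : ∀ a, ((l a).map (g a)).sum = (l a).foldl (fun acc b => acc + g a b) 0 := by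
    intro a
    rw [List.sum_eq_foldl, List.foldl_map]
  simp only [key]
  refine foldl (eσ := fun _ s => num s) (f := fun a acc b => acc + g a b) hl
    (constNum hl.left HasHeight.zero) ?_
  have hs : PolySize A (fun c : FoldCtx l => n c.base) fun c => num
      (c.pre.foldl (fun acc b => acc + g c.base b) 0) := by
    obtain ⟨f, ⟨p, hp⟩, hf⟩ := hg.right.num_inv
    refine PolySize.num (f := fun c => (l c.base).length * (p.eval (n c.base) + 1)) (fun c => ?_)
      ((hl.right.length.comp FoldCtx.base).mul ((PolyBounded.eval p).add (.const 1)))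
    rw [← List.foldl_map (f := fun b => g c.base b) (g := fun acc z => acc + z),
      ← List.sum_eq_foldl]
    refine (HasHeight.list_sum (M := p.eval (n c.base)) c.pre fun b hb =>
      (hf ⟨(c.base, b), by simp [c.eq, hb]⟩).mono (hp _)).mono ?_
    exact Nat.mul_le_mul_right _ (by simp [c.eq])
  have h := refl (O := O) ((hl.left.comp FoldCtx.base).pair ((foldCtx_cur_size hl.right).pair hs))
  exact add h.snd.snd (toFold (w := fun a b => num (g a b)) hg hs)

theorem prod {l : α → List β} {e : α → β → Data} {g : α → β → ℂ}
    (hl : FP A O n x fun a => ofList ((l a).map (e a)))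
    (hg : FP A O (fun c : MemCtx l => n c.1.1) (fun c => Data.pair (x c.1.1) (e c.1.1 c.1.2))
      fun c => num (g c.1.1 c.1.2)) :
    FP A O n x fun a => num ((l a).map (g a)).prod := by
  have key : ∀ a, ((l a).map (g a)).prod = (l a).foldl (fun acc b => acc * g a b) 1 := by
    intro a
    rw [List.prod_eq_foldl, List.foldl_map]
  simp only [key]
  refine foldl (eσ := fun _ s => num s) (f := fun a acc b => acc * g a b) hl
    (constNum hl.left HasHeight.one) ?_
  have hs : PolySize A (fun c : FoldCtx l => n c.base) fun c => num
      (c.pre.foldl (fun acc b => acc * g c.base b) 1) := by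
    obtain ⟨f, ⟨p, hp⟩, hf⟩ := hg.right.num_inv
    refine PolySize.num (f := fun c => (l c.base).length * (p.eval (n c.base))) (fun c => ?_)
      ((hl.right.length.comp FoldCtx.base).mul (PolyBounded.eval p))
    rw [← List.foldl_map (f := fun b => g c.base b) (g := fun acc z => acc * z),
      ← List.prod_eq_foldl]
    refine (HasHeight.list_prod (M := p.eval (n c.base)) c.pre fun b hb =>
      (hf ⟨(c.base, b), by simp [c.eq, hb]⟩).mono (hp _)).mono ?_
    exact Nat.mul_le_mul_right _ (by simp [c.eq])
  have h := refl (O := O) ((hl.left.comp FoldCtx.base).pair ((foldCtx_cur_size hl.right).pair hs))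
  exact mul h.snd.snd (toFold (w := fun a b => num (g a b)) hg hs)

theorem tail {l : α → List β} {e : α → β → Data}
    (hl : FP A O n x fun a => ofList ((l a).map (e a))) :
    FP A O n x fun a => ofList ((l a).tail.map (e a)) := by
  convert hl.snd' using 2 with a
  cases l a <;> rfl

theorem drop {l : α → List β} {e : α → β → Data}
    (hl : FP A O n x fun a => ofList ((l a).map (e a))) (k : ℕ) :
    FP A O n x fun a => ofList (((l a).drop k).map (e a)) := by
  induction k with
  | zero => simpa using hl
  | succ k ih => simpa using ih.tail

theorem takeOne {l : α → List β} {e : α → β → Data}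
    (hl : FP A O n x fun a => ofList ((l a).map (e a))) :
    FP A O n x fun a => ofList (((l a).take 1).map (e a)) := by
  have hb : FP A O n x fun a => ofBool !(l a).isEmpty := by
    convert hl.isPair using 2 with a
    cases l a <;> rfl
  refine byCases hb ?_ ?_
  · have h := hl.comp (Subtype.val : {a // (!(l a).isEmpty) = true} → α)
    convert h.fst'.pair (nil h.left) using 2 with a
    have := a.2
    cases h : l a <;> simp_all [ofList, Op.run]
  · convert nil (hl.left.comp (Subtype.val : {a // (!(l a).isEmpty) = false} → α)) using 2 with a
    have := a.2
    cases h : l a <;> simp_all [ofList]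

/-- The product of two unary numbers, represented by lists of the given lengths. -/
theorem replicateMul {f g : α → ℕ}
    (hf : FP A O n x fun a => ofNat (f a)) (hg : FP A O n x fun a => ofNat (g a)) :
    FP A O n x fun a => ofNat (f a * g a) := by
  simp only [ofNat_eq] at hf hg
  have h := flatMap (g := fun a _ => List.replicate (g a) ()) (e' := fun _ _ => Data.nil) hf
    (lift hg (memCtx_input hf.left hf.right))
  convert h.length using 3 with a
  simp

theorem natPow {f : α → ℕ} (hf : FP A O n x fun a => ofNat (f a)) (k : ℕ) :
    FP A O n x fun a => ofNat (f a ^ k) := by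
  induction k with
  | zero => simpa using const hf.left (ofNat 1) ⟨_, SizeLE.ofNat 1⟩
  | succ k ih => simpa [pow_succ] using replicateMul ih hf

theorem natAdd {f : α → ℕ} (hf : FP A O n x fun a => ofNat (f a)) (k : ℕ) :
    FP A O n x fun a => ofNat (f a + k) := by
  induction k with
  | zero => simpa using hf
  | succ k ih => exact (nil ih.left).pair ih

/-- A list of fixed length is computable if its elements are. -/
theorem ofFn {k : ℕ} {f : α → Fin k → β} {e : α → β → Data} (hx : PolySize A n x)
    (h : ∀ i, FP A O n x fun a => e a (f a i)) :
    FP A O n x fun a => ofList ((List.ofFn (f a)).map (e a)) := by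
  induction k with
  | zero => simpa only [List.ofFn_zero] using nilList hx e
  | succ k ih =>
    simp only [List.ofFn_succ]
    exact cons (h 0) (ih fun i => h i.succ)

theorem constList {f : α → β → γ} {e : α → γ → Data} (hx : PolySize A n x) (L : List β)
    (h : ∀ b ∈ L, FP A O n x fun a => e a (f a b)) :
    FP A O n x fun a => ofList ((L.map (f a)).map (e a)) := by
  induction L with
  | nil => exact nil hx
  | cons b L ih => exact cons (h b (by simp)) (ih fun c hc => h c (by simp [hc]))

theorem ofTable {k : ℕ} {f : α → (Fin k → Bool) → ℂ} (h : ∀ b, FP A O n x fun a => num (f a b)) :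
    FP A O n x fun a => Data.ofTable k (f a) := by
  induction k with
  | zero => exact h _
  | succ k ih => exact (ih fun b => h _).pair (ih fun b => h _)

theorem ofTable_apply {k : ℕ} {f : α → (Fin k → Bool) → ℂ}
    (h : FP A O n x fun a => Data.ofTable k (f a)) (b : Fin k → Bool) :
    FP A O n x fun a => num (f a b) := by
  induction k with
  | zero =>
    rw [Subsingleton.elim b Fin.elim0]
    exact h
  | succ k ih =>
    rw [← Fin.cons_self_tail b]
    cases b 0
    · exact ih (fst h) _
    · exact ih (snd h) _

theorem finsetSum {ι : Type} (F : Finset ι) {f : α → ι → ℂ} (hx : PolySize A n x)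
    (h : ∀ i, FP A O n x fun a => num (f a i)) : FP A O n x fun a => num (∑ i ∈ F, f a i) := by
  classical
  induction F using Finset.induction_on with
  | empty => simpa using constNum hx HasHeight.zero
  | insert i s hi ih => simpa only [Finset.sum_insert hi] using add (h i) ih

open Classical in
/-- A test that all components of two vectors of fixed length satisfy a computable relation. -/
theorem forallFinite {ι : Type} [Finite ι] {p : α → ι → Prop} (hx : PolySize A n x)
    (h : ∀ i, FP A O n x fun a => ofBool (decide (p a i))) :
    FP A O n x fun a => ofBool (decide (∀ i, p a i)) := by
  have := Fintype.ofFinite ι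
  have key : ∀ F : Finset ι, FP A O n x fun a => ofBool (decide (∀ i ∈ F, p a i)) := by
    intro F
    induction F using Finset.induction_on with
    | empty => simpa using constBool hx true
    | insert i s hi ih => simpa only [Finset.forall_mem_insert, Bool.decide_and] using and (h i) ih
  convert key Finset.univ using 4
  simp

open Classical in
theorem numEq {f g : α → ℂ} (hf : FP A O n x fun a => num (f a))
    (hg : FP A O n x fun a => num (g a)) :
    FP A O n x fun a => ofBool (decide (f a = g a)) := by
  convert eq hf hg using 4 with a
  simp

/-- Dispatch on a letter of a finite alphabet. -/
theorem finiteCases {Λ : Type} [Finite Λ] {code : Λ → Data} (hcode : Function.Injective code)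
    {b : α → Λ} (hb : FP A O n x fun a => code (b a))
    (h : ∀ c, FP A O (fun a : {a // b a = c} => n a) (fun a => x a) fun a => y a) :
    FP A O n x y := by
  classical
  have := Fintype.ofFinite Λ
  have key : ∀ F : Finset Λ,
      FP A O (fun a : {a // b a ∈ F} => n a) (fun a => x a) fun a => y a := by
    intro F
    induction F using Finset.induction_on with
    | empty =>
      exact ⟨.op .id, fun _ => 0, .const 0, fun a => absurd a.2 (by simp)⟩
    | insert c s hc ih =>
      refine byCases (b := fun a => decide (b a.1 = c)) ?_ ?_ ?_
      · have h1 := hb.comp (Subtype.val : {a // b a ∈ insert c s} → α)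
        by_cases hne : Nonempty {a // b a ∈ insert c s ∧ b a = c}
        · obtain ⟨a0, h0, rfl⟩ := hne
          obtain ⟨f, hf, hf'⟩ := hb.right
          convert eq h1 (const h1.left (code (b a0)) ⟨_, hf' a0⟩) using 4 with a
          exact hcode.eq_iff.symm
        · convert constBool h1.left false using 3 with a
          simp only [decide_eq_false_iff_not]
          exact fun h => hne ⟨a.1, a.2, h⟩
      · exact (h c).comp fun a : {a : {a // b a ∈ insert c s} // decide (b a.1 = c) = true} =>
          (⟨a.1.1, of_decide_eq_true a.2⟩ : {a // b a = c})
      · exact ih.comp fun a : {a : {a // b a ∈ insert c s} // decide (b a.1 = c) = false} =>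
          (⟨a.1.1, by
            have h1 := a.1.2
            have h2 := of_decide_eq_false a.2
            simp only [Finset.mem_insert] at h1
            tauto⟩ : {a // b a ∈ s})
  exact (key Finset.univ).comp fun a => (⟨a, Finset.mem_univ _⟩ : {a // b a ∈ Finset.univ})

end FP

/-! ### Partially built grids -/

/-- A labelled vertex together with the numbers of its incident edges. -/
abbrev LabelledVertex : Type := Σ f : Signature, (Fin f.arity → ℕ)

namespace LabelledVertex

/-- The value of the label under an assignment to all edges. -/
def eval (ξ : ℕ → Bool) (v : LabelledVertex) : ℂ := v.1.val fun i => ξ (v.2 i)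

/-- The incident edges, in order. -/
def edges (v : LabelledVertex) : List ℕ := List.ofFn v.2

/-- The encoding of a vertex in the encoding of a grid. -/
def enc (v : LabelledVertex) : Data :=
  Data.pair (Data.ofTable v.1.arity v.1.val) (Data.ofList (v.edges.map Data.ofNat))

theorem eval_congr {ξ ξ' : ℕ → Bool} {v : LabelledVertex} (h : ∀ e ∈ v.edges, ξ e = ξ' e) :
    v.eval ξ = v.eval ξ' := by
  unfold eval
  congr 1
  funext i
  exact h _ (by simp [edges])

end LabelledVertex

/-- A partially built grid: the vertices so far, the number `fresh` of edges so far, and the list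
`bd` of those edges that still lack their end at a generator. -/
structure OpenGrid where
  gens : List LabelledVertex
  recs : List LabelledVertex
  fresh : ℕ
  bd : List ℕ

/-- Extends an assignment to the edges `0, …, k - 1` by the junk value `false`. -/
def extendAssignment {k : ℕ} (ξ : Fin k → Bool) (e : ℕ) : Bool :=
  if h : e < k then ξ ⟨e, h⟩ else false

/-- Tensors of all arities at once: a function on bit strings, of which only the restriction to the
strings of one length is relevant. -/
abbrev Tensor : Type := List Bool → ℂ

/-- The gadget acts on the first factors of a tensor by its transition matrix. -/
noncomputable def Gadget.act {G R : Set Signature} {m n : ℕ} (Γ : Gadget G R m n) (t : Tensor) :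
    Tensor :=
  fun l => ∑ c : Fin n → Bool,
    Γ.transition (fun i => l.getD i false) c * t (List.ofFn c ++ l.drop m)

namespace OpenGrid

/-- The value of a partially built grid whose open edges are closed by the tensor `t`. -/
noncomputable def value (st : OpenGrid) (t : Tensor) : ℂ :=
  ∑ ξ : Fin st.fresh → Bool,
    ((st.gens.map (LabelledVertex.eval (extendAssignment ξ))).prod *
      (st.recs.map (LabelledVertex.eval (extendAssignment ξ))).prod) *
      t (st.bd.map (extendAssignment ξ))

/-- The edge at the generator side of a gadget that is attached to an open grid: the leading edges
are merged with the first open edges. -/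
def genLabel (st : OpenGrid) {k m : ℕ} : Fin k ⊕ Fin m → ℕ :=
  Sum.elim (fun i => st.fresh + i) fun j => st.bd.getD j 0

/-- The edge at the recognizer side of a gadget that is attached to an open grid. -/
def recLabel (st : OpenGrid) {k n : ℕ} : Fin k ⊕ Fin n → ℕ :=
  Sum.elim (fun i => st.fresh + i) fun j => st.fresh + k + j

/-- Attach a gadget: its leading edges are merged with the first open edges, and its trailing edges
become the first open edges. -/
def attach {G R : Set Signature} {m n : ℕ} (Γ : Gadget G R m n) (st : OpenGrid) : OpenGrid where
  gens := (List.ofFn fun u => (⟨Γ.genSig u, fun i => st.genLabel (Γ.genEdge ⟨u, i⟩)⟩ :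
    LabelledVertex)) ++ st.gens
  recs := (List.ofFn fun v => (⟨Γ.recSig v, fun i => st.recLabel (Γ.recEdge ⟨v, i⟩)⟩ :
    LabelledVertex)) ++ st.recs
  fresh := st.fresh + Γ.numEdge + n
  bd := (List.ofFn fun j : Fin n => st.fresh + Γ.numEdge + j) ++ st.bd.drop m

/-- The labels are admissible, and every edge has exactly one end at a recognizer and exactly one
end at a generator or in the list of open edges. -/
structure Valid (G R : Set Signature) (st : OpenGrid) : Prop where
  gen_mem : ∀ v ∈ st.gens, v.1 ∈ G
  rec_mem : ∀ v ∈ st.recs, v.1 ∈ R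
  gen_edges : (st.gens.flatMap LabelledVertex.edges ++ st.bd).Perm (List.range st.fresh)
  rec_edges : (st.recs.flatMap LabelledVertex.edges).Perm (List.range st.fresh)

theorem extendAssignment_append_left {k l : ℕ} (a : Fin k → Bool) (b : Fin l → Bool) {e : ℕ}
    (he : e < k) : extendAssignment (Fin.append a b) e = extendAssignment a e := by
  have h : (⟨e, by omega⟩ : Fin (k + l)) = Fin.castAdd l ⟨e, he⟩ := rfl
  simp only [extendAssignment, he, dif_pos, show e < k + l by omega]
  rw [h, Fin.append_left]

theorem extendAssignment_append_right {k l : ℕ} (a : Fin k → Bool) (b : Fin l → Bool)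
    (i : Fin l) : extendAssignment (Fin.append a b) (k + i) = b i := by
  have h : (⟨k + i, by omega⟩ : Fin (k + l)) = Fin.natAdd k i := rfl
  simp only [extendAssignment, show k + (i : ℕ) < k + l by omega, dif_pos]
  rw [h, Fin.append_right]

theorem sum_append {k l : ℕ} (F : (Fin (k + l) → Bool) → ℂ) :
    ∑ ξ, F ξ = ∑ a : Fin k → Bool, ∑ b : Fin l → Bool, F (Fin.append a b) := by
  rw [← (Fin.appendEquiv k l).sum_comp, Fintype.sum_prod_type]
  rfl

variable {G R : Set Signature}

namespace Valid

variable {st : OpenGrid}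

theorem gen_lt (h : Valid G R st) {v : LabelledVertex} (hv : v ∈ st.gens) {e : ℕ}
    (he : e ∈ v.edges) : e < st.fresh := by
  rw [← List.mem_range, ← h.gen_edges.mem_iff]
  exact List.mem_append_left _ (List.mem_flatMap.mpr ⟨v, hv, he⟩)

theorem rec_lt (h : Valid G R st) {v : LabelledVertex} (hv : v ∈ st.recs) {e : ℕ}
    (he : e ∈ v.edges) : e < st.fresh := by
  rw [← List.mem_range, ← h.rec_edges.mem_iff]
  exact List.mem_flatMap.mpr ⟨v, hv, he⟩

theorem bd_lt (h : Valid G R st) {e : ℕ} (he : e ∈ st.bd) : e < st.fresh := by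
  rw [← List.mem_range, ← h.gen_edges.mem_iff]
  exact List.mem_append_right _ he

end Valid

/-- Attaching a gadget is adjoint to its action on tensors. -/
theorem value_attach {m n : ℕ} (Γ : Gadget G R m n) {st : OpenGrid} (h : Valid G R st)
    (hm : m ≤ st.bd.length) (t : Tensor) : (attach Γ st).value t = st.value (Γ.act t) := by
  have h1 : (attach Γ st).value t = ∑ a : Fin st.fresh → Bool, ∑ b : Fin Γ.numEdge → Bool,
      ∑ c : Fin n → Bool,
        (((attach Γ st).gens.map (LabelledVertex.eval
          (extendAssignment (Fin.append (Fin.append a b) c)))).prod *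
        ((attach Γ st).recs.map (LabelledVertex.eval
          (extendAssignment (Fin.append (Fin.append a b) c)))).prod) *
        t ((attach Γ st).bd.map (extendAssignment (Fin.append (Fin.append a b) c))) := by
    unfold value
    have := sum_append (k := st.fresh + Γ.numEdge) (l := n) (fun ξ =>
        (((attach Γ st).gens.map (LabelledVertex.eval (extendAssignment ξ))).prod *
        ((attach Γ st).recs.map (LabelledVertex.eval (extendAssignment ξ))).prod) *
        t ((attach Γ st).bd.map (extendAssignment ξ)))
    refine this.trans ?_
    rw [sum_append]
  rw [h1]
  unfold value
  refine Finset.sum_congr rfl fun a _ => ?_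
  rw [Gadget.act, Finset.mul_sum, Finset.sum_comm]
  refine Finset.sum_congr rfl fun c _ => ?_
  rw [Gadget.transition, Finset.sum_mul, Finset.mul_sum]
  refine Finset.sum_congr rfl fun b _ => ?_
  set ξ := extendAssignment (Fin.append (Fin.append a b) c) with hξ
  have e1 : ∀ e < st.fresh, ξ e = extendAssignment a e := fun e he => by
    rw [hξ, extendAssignment_append_left _ _ (by omega), extendAssignment_append_left _ _ he]
  have e2 : ∀ i : Fin Γ.numEdge, ξ (st.fresh + i) = b i := fun i => by
    rw [hξ, extendAssignment_append_left _ _ (by omega), extendAssignment_append_right]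
  have e3 : ∀ j : Fin n, ξ (st.fresh + Γ.numEdge + j) = c j := fun j => by
    rw [hξ, extendAssignment_append_right]
  have g1 : st.gens.map (LabelledVertex.eval ξ) =
      st.gens.map (LabelledVertex.eval (extendAssignment a)) :=
    List.map_congr_left fun v hv => LabelledVertex.eval_congr fun e he => e1 e (h.gen_lt hv he)
  have r1 : st.recs.map (LabelledVertex.eval ξ) =
      st.recs.map (LabelledVertex.eval (extendAssignment a)) :=
    List.map_congr_left fun v hv => LabelledVertex.eval_congr fun e he => e1 e (h.rec_lt hv he)
  have b1 : (attach Γ st).bd.map ξ =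
      List.ofFn c ++ (st.bd.map (extendAssignment a)).drop m := by
    simp only [attach, List.map_append, List.map_ofFn]
    congr 1
    · congr 1
      funext j
      exact e3 j
    · rw [← List.map_drop]
      exact List.map_congr_left fun e he => e1 e (h.bd_lt (List.mem_of_mem_drop he))
  have g2 : ∀ x : Fin Γ.numEdge ⊕ Fin m, ξ (st.genLabel x) =
      Sum.elim b (fun i : Fin m => (st.bd.map (extendAssignment a)).getD i false) x := by
    rintro (i | j)
    · exact e2 i
    · have hj : (j : ℕ) < st.bd.length := by omega
      simp only [genLabel, Sum.elim_inr]
      rw [List.getD_eq_getElem _ _ hj, List.getD_eq_getElem _ _ (by simpa using hj),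
        List.getElem_map]
      exact e1 _ (h.bd_lt (List.getElem_mem _))
  have r2 : ∀ x : Fin Γ.numEdge ⊕ Fin n, ξ (st.recLabel x) = Sum.elim b c x := by
    rintro (i | j)
    · exact e2 i
    · exact e3 j
  rw [b1]
  simp only [attach, List.map_append, List.prod_append, g1, r1, List.map_ofFn, List.prod_ofFn]
  simp only [Function.comp_def, LabelledVertex.eval, g2, r2]
  ring

/-- The edges at the vertices of a family, as a multiset. -/
theorem flatMap_edges_ofFn {N : ℕ} {sig : Fin N → Signature} {τ : Type} [Fintype τ]
    (e : (Σ u, Fin (sig u).arity) ≃ τ) (φ : τ → ℕ) :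
    (((List.ofFn fun u => (⟨sig u, fun i => φ (e ⟨u, i⟩)⟩ : LabelledVertex)).flatMap
      LabelledVertex.edges : List ℕ) : Multiset ℕ) = (Finset.univ : Finset τ).val.map φ := by
  classical
  have h1 : (Finset.univ : Finset τ).val =
      (Finset.univ : Finset (Σ u, Fin (sig u).arity)).val.map e := by
    rw [← Finset.map_univ_equiv e]; rfl
  rw [h1, Multiset.map_map, ← Finset.univ_sigma_univ]
  have h2 : (Finset.univ.sigma fun u => (Finset.univ : Finset (Fin (sig u).arity))).val =
      Multiset.sigma (Finset.univ : Finset (Fin N)).val fun u => Finset.univ.val := rfl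
  rw [h2, ← Multiset.coe_bind, ← Fin.univ_val_map, Multiset.bind_map]
  simp only [Multiset.sigma, Multiset.map_bind, Multiset.map_map]
  refine congrArg _ (funext fun u => ?_)
  simp only [LabelledVertex.edges, Function.comp_def]
  rw [← Fin.univ_val_map]

theorem univ_val_map_sum {k m : ℕ} (f : Fin k → ℕ) (g : Fin m → ℕ) :
    (Finset.univ : Finset (Fin k ⊕ Fin m)).val.map (Sum.elim f g) =
      ((List.ofFn f ++ List.ofFn g : List ℕ) : Multiset ℕ) := by
  rw [← Finset.univ_disjSum_univ, Finset.val_disjSum, Multiset.disjSum, Multiset.map_add,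
    Multiset.map_map, Multiset.map_map, ← Multiset.coe_add, ← Fin.univ_val_map, ← Fin.univ_val_map]
  rfl

theorem range_add_eq (a b : ℕ) :
    List.range (a + b) = List.range a ++ List.ofFn fun i : Fin b => a + (i : ℕ) := by
  rw [List.range_add]
  congr 1
  apply List.ext_getElem <;> simp

theorem Valid.attach {m n : ℕ} (Γ : Gadget G R m n) {st : OpenGrid} (h : Valid G R st)
    (hm : m ≤ st.bd.length) : Valid G R (attach Γ st) where
  gen_mem v hv := by
    rcases List.mem_append.mp hv with hv | hv
    · obtain ⟨u, rfl⟩ := (List.mem_ofFn' _ _).mp hv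
      exact Γ.genSig_mem u
    · exact h.gen_mem v hv
  rec_mem v hv := by
    rcases List.mem_append.mp hv with hv | hv
    · obtain ⟨u, rfl⟩ := (List.mem_ofFn' _ _).mp hv
      exact Γ.recSig_mem u
    · exact h.rec_mem v hv
  gen_edges := by
    have hb : (List.ofFn fun j : Fin m => st.bd.getD j 0) = st.bd.take m := by
      apply List.ext_getElem
      · simpa using hm
      · intro i h1 h2
        simp only [List.length_ofFn] at h1
        simp [show i < st.bd.length by omega]
    have h1 := flatMap_edges_ofFn Γ.genEdge st.genLabel
    have h2 := h.gen_edges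
    rw [← Multiset.coe_eq_coe] at h2 ⊢
    rw [genLabel, univ_val_map_sum, hb] at h1
    simp only [OpenGrid.attach, List.flatMap_append, range_add_eq, ← Multiset.coe_add] at h1 h2 ⊢
    rw [genLabel, h1, ← h2]
    conv_rhs => rw [← List.take_append_drop m st.bd, ← Multiset.coe_add]
    abel
  rec_edges := by
    have h1 := flatMap_edges_ofFn Γ.recEdge st.recLabel
    have h2 := h.rec_edges
    rw [← Multiset.coe_eq_coe] at h2 ⊢
    rw [recLabel, univ_val_map_sum] at h1
    simp only [OpenGrid.attach, List.flatMap_append, range_add_eq, ← Multiset.coe_add] at h1 h2 ⊢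
    rw [recLabel, h1, ← h2]
    abel

/-- The encoding of an open grid without open edges. -/
def encGrid (st : OpenGrid) : Data :=
  Data.pair (Data.ofList (st.gens.map LabelledVertex.enc))
    (Data.ofList (st.recs.map LabelledVertex.enc))

/-- If the edge numbers at the vertices enumerate `0, …, N - 1`, then they give a bijection from the
inputs of the vertices to the edges. -/
theorem edge_bijective {l : List LabelledVertex} {N : ℕ}
    (h : (l.flatMap LabelledVertex.edges).Perm (List.range N)) :
    ∃ e : (Σ u : Fin l.length, Fin (l.get u).1.arity) ≃ Fin N,
      ∀ u i, (e ⟨u, i⟩ : ℕ) = (l.get u).2 i := by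
  let φ : (Σ u : Fin l.length, Fin (l.get u).1.arity) → ℕ := fun p => (l.get p.1).2 p.2
  have h1 := flatMap_edges_ofFn (Equiv.refl _) φ
  have h2 : (List.ofFn fun u => (⟨(l.get u).1, fun i => φ (Equiv.refl _ ⟨u, i⟩)⟩ :
      LabelledVertex)) = l := List.ofFn_get l
  rw [h2, Multiset.coe_eq_coe.mpr h] at h1
  have hlt : ∀ p, φ p < N := fun p => by
    have : φ p ∈ (Finset.univ.val.map φ : Multiset ℕ) :=
      Multiset.mem_map_of_mem φ (Finset.mem_val.mpr (Finset.mem_univ p))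
    rw [← h1] at this
    simpa using this
  refine ⟨Equiv.ofBijective (fun p => ⟨φ p, hlt p⟩) ⟨?_, ?_⟩, fun u i => rfl⟩
  · intro p q hpq
    have hn : (Finset.univ.val.map φ : Multiset ℕ).Nodup := by
      rw [← h1]; exact List.nodup_range
    exact Multiset.inj_on_of_nodup_map hn p (Finset.mem_univ p) q (Finset.mem_univ q)
      (Fin.ext_iff.mp hpq)
  · intro k
    have : (k : ℕ) ∈ (Finset.univ.val.map φ : Multiset ℕ) := by
      rw [← h1]; simp
    obtain ⟨p, _, hp⟩ := Multiset.mem_map.mp this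
    exact ⟨p, Fin.ext hp⟩

/-- A valid open grid without open edges is a signature grid. -/
theorem Valid.exists_grid {st : OpenGrid} (h : Valid G R st) (hbd : st.bd = []) :
    ∃ Ω : SignatureGrid G R, Ω.encode = st.encGrid ∧ Ω.holant = st.value fun _ => 1 := by
  have hg := h.gen_edges
  rw [hbd, List.append_nil] at hg
  obtain ⟨eg, heg⟩ := edge_bijective hg
  obtain ⟨er, her⟩ := edge_bijective h.rec_edges
  refine ⟨{ numGen := st.gens.length
            numRec := st.recs.length
            numEdge := st.fresh
            genSig := fun u => (st.gens.get u).1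
            genSig_mem := fun u => h.gen_mem _ (List.get_mem _ _)
            recSig := fun v => (st.recs.get v).1
            recSig_mem := fun v => h.rec_mem _ (List.get_mem _ _)
            genEdge := eg.trans (Equiv.sumEmpty _ _).symm
            recEdge := er.trans (Equiv.sumEmpty _ _).symm }, ?_, ?_⟩
  · simp only [SignatureGrid.encode, encGrid, Equiv.trans_apply, Equiv.sumEmpty_symm_apply,
      Sum.elim_inl, heg, her]
    congr 2
    · conv_rhs => rw [← List.ofFn_get st.gens, List.map_ofFn]
      congr 1
      funext u
      simp only [LabelledVertex.enc, LabelledVertex.edges, List.map_ofFn, Function.comp_def]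
    · conv_rhs => rw [← List.ofFn_get st.recs, List.map_ofFn]
      congr 1
      funext u
      simp only [LabelledVertex.enc, LabelledVertex.edges, List.map_ofFn, Function.comp_def]
  · simp only [SignatureGrid.holant, Gadget.transition, value, mul_one]
    refine Finset.sum_congr rfl fun ξ _ => ?_
    have key : ∀ e : Fin st.fresh, ξ e = extendAssignment ξ e := fun e => by
      simp [extendAssignment]
    congr 1
    · conv_rhs => rw [← List.ofFn_get st.gens, List.map_ofFn, List.prod_ofFn]
      refine Finset.prod_congr rfl fun u _ => ?_
      simp only [LabelledVertex.eval, Function.comp_def, Equiv.trans_apply,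
        Equiv.sumEmpty_symm_apply, Sum.elim_inl, key, heg]
    · conv_rhs => rw [← List.ofFn_get st.recs, List.map_ofFn, List.prod_ofFn]
      refine Finset.prod_congr rfl fun u _ => ?_
      simp only [LabelledVertex.eval, Function.comp_def, Equiv.trans_apply,
        Equiv.sumEmpty_symm_apply, Sum.elim_inl, key, her]

end OpenGrid

/-! ### Homogeneous Lagrange interpolation -/

/-- The determinant of two binary vectors. -/
def det2 (u v : Bool → ℂ) : ℂ := u false * v true - u true * v false

theorem det2_self (u : Bool → ℂ) : det2 u u = 0 := by rw [det2]; ring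

/-- Binary forms of degree `k`. -/
def IsForm (k : ℕ) (f : (Bool → ℂ) → ℂ) : Prop :=
  ∃ c : ℕ → ℂ, ∀ w, f w = ∑ i ∈ Finset.range (k + 1), c i * (w true ^ i * w false ^ (k - i))

namespace IsForm

variable {k : ℕ} {f g : (Bool → ℂ) → ℂ}

theorem one : IsForm 0 fun _ => 1 := ⟨fun _ => 1, fun w => by simp⟩

theorem zero : IsForm k fun _ => 0 := ⟨fun _ => 0, fun w => by simp⟩

theorem add (hf : IsForm k f) (hg : IsForm k g) : IsForm k fun w => f w + g w := by
  obtain ⟨c, hc⟩ := hf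
  obtain ⟨d, hd⟩ := hg
  exact ⟨fun i => c i + d i, fun w => by
    beta_reduce; rw [hc, hd, ← Finset.sum_add_distrib]; simp only [add_mul]⟩

theorem const_mul (a : ℂ) (hf : IsForm k f) : IsForm k fun w => a * f w := by
  obtain ⟨c, hc⟩ := hf
  exact ⟨fun i => a * c i, fun w => by
    beta_reduce; rw [hc, Finset.mul_sum]; simp only [mul_assoc]⟩

theorem sum {ι : Type*} (F : Finset ι) {f : ι → (Bool → ℂ) → ℂ} (hf : ∀ i ∈ F, IsForm k (f i)) :
    IsForm k fun w => ∑ i ∈ F, f i w := by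
  classical
  induction F using Finset.induction_on with
  | empty => simpa using zero
  | insert a s ha ih =>
    simp only [Finset.sum_insert ha]
    exact (hf a (by simp)).add (ih fun i hi => hf i (by simp [hi]))

theorem linear_mul (a b : ℂ) (hf : IsForm k f) :
    IsForm (k + 1) fun w => (a * w false + b * w true) * f w := by
  obtain ⟨c, hc⟩ := hf
  refine IsForm.add (f := fun w => a * w false * f w) (g := fun w => b * w true * f w) ?_ ?_ |>
    fun h => by simpa only [add_mul] using h
  · refine ⟨fun i => if i ≤ k then a * c i else 0, fun w => ?_⟩
    beta_reduce
    rw [Finset.sum_range_succ _ (k + 1), if_neg (by omega), zero_mul, add_zero, hc, Finset.mul_sum]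
    refine Finset.sum_congr rfl fun i hi => ?_
    have hi : i ≤ k := by simpa [Nat.lt_succ_iff] using hi
    rw [if_pos hi, show k + 1 - i = k - i + 1 by omega, pow_succ]
    ring
  · refine ⟨fun i => if i = 0 then 0 else b * c (i - 1), fun w => ?_⟩
    beta_reduce
    rw [Finset.sum_range_succ' _ (k + 1), if_pos rfl, zero_mul, add_zero, hc, Finset.mul_sum]
    refine Finset.sum_congr rfl fun i _ => ?_
    rw [if_neg (by omega), Nat.add_sub_cancel, Nat.add_sub_add_right, pow_succ]
    ring

theorem prod_linear {ι : Type*} (F : Finset ι) (a b : ι → ℂ) :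
    IsForm F.card fun w => ∏ i ∈ F, (a i * w false + b i * w true) := by
  classical
  induction F using Finset.induction_on with
  | empty => simpa using one
  | insert j s hj ih =>
    simp only [Finset.prod_insert hj, Finset.card_insert_of_notMem hj]
    exact ih.linear_mul (a j) (b j)

theorem list_prod (l : List Bool) : IsForm l.length fun w => (l.map w).prod := by
  induction l with
  | nil => simpa using one
  | cons b l ih =>
    simp only [List.map_cons, List.prod_cons, List.length_cons]
    cases b
    · simpa using ih.linear_mul 1 0
    · simpa using ih.linear_mul 0 1

/-- A binary form of degree `k` with `k + 1` pairwise independent zeros vanishes. -/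
theorem eq_zero (hf : IsForm k f) (u : Fin (k + 1) → Bool → ℂ)
    (hu : ∀ i j, i ≠ j → det2 (u i) (u j) ≠ 0) (h0 : ∀ i, f (u i) = 0) (w : Bool → ℂ) :
    f w = 0 := by
  obtain ⟨c, hc⟩ := hf
  let V := Matrix.projVandermonde (fun i => u i true) fun i => u i false
  have hV : V.det ≠ 0 := by
    rw [Matrix.det_projVandermonde]
    refine Finset.prod_ne_zero_iff.mpr fun i _ => Finset.prod_ne_zero_iff.mpr fun j hj => ?_
    have := hu i j (Finset.mem_Ioi.mp hj).ne
    intro h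
    apply this
    rw [det2, ← h]
    ring
  have hz : (fun i : Fin (k + 1) => c i) = 0 := by
    refine Matrix.eq_zero_of_mulVec_eq_zero hV (funext fun i => ?_)
    have := h0 i
    rw [hc, Finset.sum_range] at this
    rw [Pi.zero_apply, ← this, Matrix.mulVec, dotProduct]
    refine Finset.sum_congr rfl fun j _ => ?_
    rw [show V i j = _ from Matrix.projVandermonde_apply, Fin.val_rev, Nat.add_sub_add_right,
      mul_comm]
  rw [hc, Finset.sum_range (n := k + 1)]
  exact Finset.sum_eq_zero fun i _ => by
    rw [show c (i : Fin (k + 1)) = 0 from congrFun hz i, zero_mul]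

end IsForm

open Classical in
/-- The factor at `v` of the Lagrange basis form for the node `u`. -/
noncomputable def lagrangeFactor (w u v : Bool → ℂ) : ℂ :=
  if det2 u v = 0 then 1 else det2 w v / det2 u v

/-- Interpolation of the form `w ↦ ∏ w (l i)` of degree `k` at `k + 1` pairwise independent
nodes. -/
theorem lagrange_interpolation {k : ℕ} (u : Fin (k + 1) → Bool → ℂ)
    (hu : ∀ i j, i ≠ j → det2 (u i) (u j) ≠ 0) (w : Bool → ℂ) (l : List Bool) (hl : l.length = k) :
    ∑ i, (∏ j, lagrangeFactor w (u i) (u j)) * (l.map (u i)).prod = (l.map w).prod := by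
  classical
  have hform : IsForm k fun w => ∑ i, (∏ j, lagrangeFactor w (u i) (u j)) * (l.map (u i)).prod := by
    refine IsForm.sum _ fun i _ => ?_
    have h1 := (IsForm.prod_linear (Finset.univ.erase i)
      (fun j => u j true / det2 (u i) (u j)) fun j => - u j false / det2 (u i) (u j)).const_mul
      (l.map (u i)).prod
    rw [Finset.card_erase_of_mem (Finset.mem_univ i), Finset.card_univ, Fintype.card_fin,
      Nat.add_sub_cancel] at h1
    refine Eq.mp (congrArg (IsForm k) (funext fun w => ?_)) h1
    rw [mul_comm, ← Finset.mul_prod_erase _ _ (Finset.mem_univ i)]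
    rw [show lagrangeFactor w (u i) (u i) = 1 from if_pos (det2_self _), one_mul]
    congr 1
    refine Finset.prod_congr rfl fun j hj => ?_
    rw [lagrangeFactor, if_neg (hu i j (Finset.ne_of_mem_erase hj).symm),
      show det2 w (u j) = w false * u j true - w true * u j false from rfl]
    ring
  have hdiff := hform.add ((IsForm.list_prod l).const_mul (-1) |> fun h => by rwa [hl] at h)
  have := hdiff.eq_zero u hu (fun m => ?_) w
  · linear_combination this
  rw [Finset.sum_eq_single m]
  · rw [Finset.prod_eq_one]
    · ring
    · intro j _
      by_cases hj : m = j
      · subst hj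
        exact if_pos (det2_self _)
      · rw [lagrangeFactor, if_neg (hu m j hj), div_self (hu m j hj)]
  · intro i _ him
    rw [Finset.prod_eq_zero (Finset.mem_univ m), zero_mul]
    rw [lagrangeFactor, if_neg (hu i m him), det2_self, zero_div]
  · simp

/-! ### Words of gadgets -/

/-- A gadget together with its numbers of leading and trailing edges. -/
structure Piece (G R : Set Signature) where
  m : ℕ
  n : ℕ
  gadget : Gadget G R m n

namespace Piece

variable {G R : Set Signature}

/-- The action of a composition of gadgets on tensors. -/
noncomputable def actList (c : List (Piece G R)) (t : Tensor) : Tensor :=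
  c.foldr (fun p t => p.gadget.act t) t

/-- The tensor that a word of gadgets realizes (relevant on the strings of the length to which the
word fits). -/
noncomputable def tensor (c : List (Piece G R)) : Tensor := actList c fun _ => 1

/-- The composition of the gadgets in the word has `k` leading edges and no trailing edges, where
each gadget is attached to the first open edges. -/
def Fits : List (Piece G R) → ℕ → Prop
  | [], k => k = 0
  | p :: c, k => p.m ≤ k ∧ Fits c (p.n + (k - p.m))

theorem actList_append {c : List (Piece G R)} {k : ℕ} (hc : Fits c k) (t : Tensor) {l : List Bool}
    (hl : l.length = k) (r : List Bool) : actList c t (l ++ r) = tensor c l * t r := by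
  induction c generalizing k l with
  | nil =>
    obtain rfl : k = 0 := hc
    obtain rfl : l = [] := List.length_eq_zero_iff.mp hl
    simp [actList, tensor]
  | cons p c ih =>
    obtain ⟨h1, h2⟩ := hc
    simp only [actList, tensor, List.foldr_cons, Gadget.act, Finset.sum_mul] at ih ⊢
    refine Finset.sum_congr rfl fun b _ => ?_
    rw [List.drop_append_of_le_length (by omega), ← List.append_assoc,
      ih h2 (by simp [hl]), mul_assoc]
    congr 2
    funext i
    simp [List.getD_eq_getElem?_getD, List.getElem?_append_left (show (i : ℕ) < l.length by omega)]

/-- Attach all gadgets of a word to an open grid. -/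
def attachList (c : List (Piece G R)) (st : OpenGrid) : OpenGrid :=
  c.foldl (fun st p => OpenGrid.attach p.gadget st) st

theorem attachList_spec {c : List (Piece G R)} {k : ℕ} (hc : Fits c k) {st : OpenGrid}
    (h : st.Valid G R) (hk : k ≤ st.bd.length) :
    (attachList c st).Valid G R ∧ (attachList c st).bd = st.bd.drop k ∧
      ∀ t, (attachList c st).value t = st.value (actList c t) := by
  induction c generalizing k st with
  | nil =>
    obtain rfl : k = 0 := hc
    exact ⟨h, rfl, fun t => rfl⟩
  | cons p c ih =>
    obtain ⟨h1, h2⟩ := hc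
    have hm := h1.trans hk
    obtain ⟨i1, i2, i3⟩ := ih h2 (h.attach p.gadget hm) (by simp [OpenGrid.attach]; omega)
    refine ⟨i1, ?_, fun t => ?_⟩
    · refine i2.trans ?_
      simp only [OpenGrid.attach]
      rw [List.drop_append, List.drop_eq_nil_of_le (by simp), List.nil_append,
        List.length_ofFn, List.drop_drop]
      congr 1
      omega
    · exact (i3 t).trans (OpenGrid.value_attach p.gadget h hm _)

theorem value_congr {st : OpenGrid} {t t' : Tensor}
    (h : ∀ l, l.length = st.bd.length → t l = t' l) :
    st.value t = st.value t' := by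
  unfold OpenGrid.value
  exact Finset.sum_congr rfl fun ξ _ => by rw [h _ (by simp)]

/-- Closing every open edge by a copy of a unary word of gadgets evaluates the open grid at the
corresponding power of a unary tensor. -/
theorem attachList_replicate {c : List (Piece G R)} (hc : Fits c 1) (j : ℕ) {st : OpenGrid}
    (h : st.Valid G R) (hj : st.bd.length = j) :
    (attachList (List.replicate j c).flatten st).Valid G R ∧
    (attachList (List.replicate j c).flatten st).bd = [] ∧
    (attachList (List.replicate j c).flatten st).value (fun _ => 1) =
      st.value fun l => (l.map fun b => tensor c [b]).prod := by
  induction j generalizing st with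
  | zero =>
    refine ⟨h, List.length_eq_zero_iff.mp hj, value_congr fun l hl => ?_⟩
    rw [List.length_eq_zero_iff.mp (hl.trans hj)]
    rfl
  | succ j ih =>
    obtain ⟨h1, h2, h3⟩ := attachList_spec hc h (by omega)
    have he : attachList (List.replicate (j + 1) c).flatten st =
        attachList (List.replicate j c).flatten (attachList c st) := by
      simp [attachList, List.replicate_succ]
    obtain ⟨i1, i2, i3⟩ := ih h1 (by rw [h2]; simp [hj])
    rw [he]
    refine ⟨i1, i2, ?_⟩
    rw [i3, h3]
    refine value_congr fun l hl => ?_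
    cases l with
    | nil => simp [hj] at hl
    | cons b l =>
      exact actList_append hc _ (l := [b]) rfl l

end Piece

/-! ### The open grid left by the vertices labelled with the unary signature -/

namespace OpenGrid

variable {G R : Set Signature}

/-- The values of `(X, Y)`. -/
def unaryVec (X Y : ℂ) (b : Bool) : ℂ := if b then Y else X

/-- All generator vertices of a grid. -/
def genVertices (Ω : SignatureGrid G R) : List LabelledVertex :=
  List.ofFn fun u => ⟨Ω.genSig u, fun i => Sum.elim Fin.val Fin.val (Ω.genEdge ⟨u, i⟩)⟩

/-- All recognizer vertices of a grid. -/
def recVertices (Ω : SignatureGrid G R) : List LabelledVertex :=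
  List.ofFn fun v => ⟨Ω.recSig v, fun i => Sum.elim Fin.val Fin.val (Ω.recEdge ⟨v, i⟩)⟩

theorem encode_eq (Ω : SignatureGrid G R) : Ω.encode =
    Data.pair (Data.ofList ((genVertices Ω).map LabelledVertex.enc))
      (Data.ofList ((recVertices Ω).map LabelledVertex.enc)) := by
  simp only [SignatureGrid.encode, genVertices, recVertices, List.map_ofFn, Function.comp_def,
    LabelledVertex.enc, LabelledVertex.edges]

theorem genVertices_edges (Ω : SignatureGrid G R) :
    ((genVertices Ω).flatMap LabelledVertex.edges).Perm (List.range Ω.numEdge) := by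
  rw [← Multiset.coe_eq_coe, genVertices, flatMap_edges_ofFn Ω.genEdge, univ_val_map_sum]
  rw [Multiset.coe_eq_coe, List.ofFn_zero, List.append_nil]
  exact List.Perm.of_eq (by apply List.ext_getElem <;> simp)

theorem recVertices_edges (Ω : SignatureGrid G R) :
    ((recVertices Ω).flatMap LabelledVertex.edges).Perm (List.range Ω.numEdge) := by
  rw [← Multiset.coe_eq_coe, recVertices, flatMap_edges_ofFn Ω.recEdge, univ_val_map_sum]
  rw [Multiset.coe_eq_coe, List.ofFn_zero, List.append_nil]
  exact List.Perm.of_eq (by apply List.ext_getElem <;> simp)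

theorem holant_eq (Ω : SignatureGrid G R) : Ω.holant = ∑ ξ : Fin Ω.numEdge → Bool,
    ((genVertices Ω).map (LabelledVertex.eval (extendAssignment ξ))).prod *
      ((recVertices Ω).map (LabelledVertex.eval (extendAssignment ξ))).prod := by
  rw [SignatureGrid.holant, Gadget.transition]
  refine Finset.sum_congr rfl fun ξ _ => ?_
  have key : ∀ x : Fin Ω.numEdge ⊕ Fin 0, Sum.elim ξ Fin.elim0 x =
      extendAssignment ξ (Sum.elim Fin.val Fin.val x) := by
    rintro (i | i)
    · simp [extendAssignment]
    · exact i.elim0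
  simp only [genVertices, recVertices, List.map_ofFn, List.prod_ofFn, Function.comp_def,
    LabelledVertex.eval, key]

open Classical in
/-- Delete the vertices labelled with `(X, Y)`; their edges become open. -/
noncomputable def ofGrid (X Y : ℂ) (Ω : SignatureGrid G R) : OpenGrid where
  gens := (genVertices Ω).filter fun v => !decide (v.1 = Signature.unary X Y)
  recs := recVertices Ω
  fresh := Ω.numEdge
  bd := ((genVertices Ω).filter fun v => decide (v.1 = Signature.unary X Y)).flatMap
    LabelledVertex.edges

theorem ofGrid_valid (X Y : ℂ) (Ω : SignatureGrid (G ∪ {Signature.unary X Y}) R) :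
    (ofGrid X Y Ω).Valid G R where
  gen_mem v hv := by
    obtain ⟨h1, h2⟩ := List.mem_filter.mp hv
    obtain ⟨u, rfl⟩ := (List.mem_ofFn' _ _).mp h1
    have := Ω.genSig_mem u
    simp_all
  rec_mem v hv := by
    obtain ⟨u, rfl⟩ := (List.mem_ofFn' _ _).mp hv
    exact Ω.recSig_mem u
  gen_edges := by
    classical
    refine (List.Perm.trans ?_ (genVertices_edges Ω))
    have := (List.filter_append_perm (fun v => decide (v.1 = Signature.unary X Y))
      (genVertices Ω)).flatMap_right LabelledVertex.edges
    rw [List.flatMap_append] at this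
    exact List.perm_append_comm.trans this
  rec_edges := recVertices_edges Ω

theorem ofGrid_value (X Y : ℂ) (Ω : SignatureGrid G R) :
    Ω.holant = (ofGrid X Y Ω).value fun l => (l.map (unaryVec X Y)).prod := by
  classical
  rw [holant_eq, value]
  refine Finset.sum_congr rfl fun ξ _ => ?_
  rw [← ((List.filter_append_perm (fun v => decide (v.1 = Signature.unary X Y))
      (genVertices Ω)).map _).prod_eq, List.map_append, List.prod_append]
  have key : ∀ L : List LabelledVertex, (∀ v ∈ L, v.1 = Signature.unary X Y) →
      (L.map (LabelledVertex.eval (extendAssignment ξ))).prod =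
      (((L.flatMap LabelledVertex.edges).map (extendAssignment ξ)).map (unaryVec X Y)).prod := by
    intro L hL
    induction L with
    | nil => rfl
    | cons v L ih =>
      rw [List.map_cons, List.prod_cons, ih fun w hw => hL w (by simp [hw]), List.flatMap_cons,
        List.map_append, List.map_append, List.prod_append]
      congr 1
      obtain ⟨f, es⟩ := v
      obtain rfl : f = _ := hL _ (List.mem_cons_self ..)
      have h1 : LabelledVertex.edges ⟨Signature.unary X Y, es⟩ = [es (0 : Fin 1)] := by
        exact List.ofFn_succ (n := 0)
      rw [h1]
      simp [LabelledVertex.eval, Signature.unary, unaryVec]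
  rw [key _ fun v hv => by simpa using (List.mem_filter.mp hv).2]
  simp only [ofGrid]
  ring

end OpenGrid

/-! ### Projective sets of gadgets separate tensors -/

/-- Two vectors are linearly dependent: all `2 × 2` minors vanish. -/
def Parallel {ι : Type*} (x y : ι → ℂ) : Prop := ∀ p q, x p * y q = x q * y p

theorem Parallel.symm {ι : Type*} {x y : ι → ℂ} (h : Parallel x y) : Parallel y x :=
  fun p q => by linear_combination h q p

theorem Parallel.exists_smul {ι : Type*} {x y : ι → ℂ} (h : Parallel x y) :
    ∃ α β : ℂ, (α ≠ 0 ∨ β ≠ 0) ∧ ∀ p, α * x p + β * y p = 0 := by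
  by_cases hx : ∃ p, x p ≠ 0
  · obtain ⟨p, hp⟩ := hx
    exact ⟨y p, -x p, .inr (neg_ne_zero.mpr hp), fun q => by linear_combination - h p q⟩
  · push Not at hx
    exact ⟨1, 0, .inl one_ne_zero, fun q => by simp [hx]⟩

theorem rank_eq_two_iff {ι : Type*} [Fintype ι] (N : Matrix ι (Fin 2) ℂ) :
    N.rank = 2 ↔ ¬ Parallel (fun p => N p 0) fun p => N p 1 := by
  classical
  constructor
  · intro h hpar
    obtain ⟨α, β, hne, hz⟩ := hpar.exists_smul
    have h1 := N.mulVecLin.finrank_range_add_finrank_ker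
    rw [← Matrix.rank, h, Module.finrank_fin_fun] at h1
    have hker : LinearMap.ker N.mulVecLin = ⊥ := Submodule.finrank_eq_zero.mp (by omega)
    have h2 : ![α, β] ∈ LinearMap.ker N.mulVecLin := by
      rw [LinearMap.mem_ker, Matrix.mulVecLin_apply]
      funext p
      simp only [Matrix.mulVec, dotProduct, Fin.sum_univ_two, Matrix.cons_val_zero,
        Matrix.cons_val_one, Pi.zero_apply]
      linear_combination hz p
    rw [hker, Submodule.mem_bot] at h2
    have h3 := congrFun h2 0
    have h4 := congrFun h2 1
    simp at h3 h4
    tauto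
  · intro h
    rw [Parallel] at h
    push Not at h
    obtain ⟨p, q, hpq⟩ := h
    refine le_antisymm N.rank_le_card_width ?_
    refine le_trans (le_of_eq ?_) (N.rank_submatrix_le ![p, q] id)
    rw [Matrix.rank_of_isUnit, Fintype.card_fin]
    rw [Matrix.isUnit_iff_isUnit_det, isUnit_iff_ne_zero, Matrix.det_fin_two]
    simp only [Matrix.submatrix_apply, Matrix.cons_val_zero, Matrix.cons_val_one, id]
    intro h0
    apply hpq
    linear_combination h0

section Projective

variable {G R : Set Signature} {P : Set (Gadget G R 1 2)}

theorem IsProjectiveGadgetSet.exists_not_parallel (hP : IsProjectiveGadgetSet P)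
    {x y : (Fin 2 → Bool) → ℂ} (h : ¬ Parallel x y) :
    ∃ F ∈ P, ¬ Parallel (F.transition.mulVec x) (F.transition.mulVec y) := by
  obtain ⟨_, ⟨F, hF, rfl⟩, hr⟩ := hP (Matrix.of fun p i => ![x, y] i p)
    ((rank_eq_two_iff _).mpr (by simpa using h))
  refine ⟨F, hF, ?_⟩
  rw [rank_eq_two_iff] at hr
  simp only [Matrix.mul_apply, Matrix.of_apply, Matrix.cons_val_zero, Matrix.cons_val_one] at hr
  exact hr

theorem not_parallel_ne_zero {ι : Type*} {x y : ι → ℂ} (h : ¬ Parallel x y) :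
    (∃ p, x p ≠ 0) ∧ ∃ p, y p ≠ 0 := by
  constructor
  · by_contra! hx
    exact h fun p q => by simp [hx]
  · by_contra! hx
    exact h fun p q => by simp [hx]

/-- One member of a projective set is nonzero on two given nonzero vectors. -/
theorem IsProjectiveGadgetSet.exists_ne_zero (hP : IsProjectiveGadgetSet P)
    {x y : (Fin 2 → Bool) → ℂ} (hx : ∃ p, x p ≠ 0) (hy : ∃ p, y p ≠ 0) :
    ∃ F ∈ P, (∃ p, F.transition.mulVec x p ≠ 0) ∧ ∃ p, F.transition.mulVec y p ≠ 0 := by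
  by_cases h : Parallel x y
  · obtain ⟨p, hp⟩ := hx
    obtain ⟨q, hq⟩ : ∃ q : Fin 2 → Bool, q ≠ p := exists_ne p
    have hz : ¬ Parallel x (Pi.single q 1) := fun hz => by
      have := hz p q
      simp [Ne.symm hq] at this
      exact hp this
    obtain ⟨F, hF, hn⟩ := hP.exists_not_parallel hz
    obtain ⟨⟨p', hp'⟩, -⟩ := not_parallel_ne_zero hn
    refine ⟨F, hF, ⟨p', hp'⟩, p', ?_⟩
    have hyx : y = (y p / x p) • x := by
      funext r
      have := h p r
      rw [Pi.smul_apply, smul_eq_mul]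
      field_simp
      linear_combination this
    have hy0 : y p / x p ≠ 0 := by
      intro h0
      obtain ⟨r, hr⟩ := hy
      rw [hyx, h0, zero_smul] at hr
      exact hr rfl
    rw [hyx, Matrix.mulVec_smul, Pi.smul_apply, smul_eq_mul]
    exact mul_ne_zero hy0 hp'
  · obtain ⟨F, hF, hn⟩ := hP.exists_not_parallel h
    exact ⟨F, hF, not_parallel_ne_zero hn⟩

/-- Two dependent vectors that are not both zero are multiples of a common nonzero vector. -/
theorem Parallel.exists_common {ι : Type*} {x y : ι → ℂ} (h : Parallel x y)
    (hne : (∃ p, x p ≠ 0) ∨ ∃ p, y p ≠ 0) :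
    ∃ (w : ι → ℂ) (α β : ℂ), (∃ p, w p ≠ 0) ∧ x = α • w ∧ y = β • w := by
  by_cases hx : ∃ p, x p ≠ 0
  · obtain ⟨p, hp⟩ := hx
    refine ⟨x, 1, y p / x p, ⟨p, hp⟩, (one_smul _ _).symm, funext fun r => ?_⟩
    have := h p r
    rw [Pi.smul_apply, smul_eq_mul]
    field_simp
    linear_combination this
  · refine ⟨y, 0, 1, hne.resolve_left hx, ?_, (one_smul _ _).symm⟩
    push Not at hx
    funext r
    simp [hx]

/-- Two tensors of arity `k` are linearly dependent. -/
def Tensor.ParallelOn (k : ℕ) (t t' : Tensor) : Prop :=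
  Parallel (fun b : Fin k → Bool => t (List.ofFn b)) fun b => t' (List.ofFn b)

open Tensor

theorem Tensor.parallelOn_iff {k : ℕ} {t t' : Tensor} : ParallelOn k t t' ↔
    ∀ l l' : List Bool, l.length = k → l'.length = k → t l * t' l' = t l' * t' l := by
  constructor
  · intro h l l' hl hl'
    subst hl
    have := h l.get fun i => l'.get (Fin.cast hl'.symm i)
    have e : (List.ofFn fun i => l'.get (Fin.cast hl'.symm i)) = l' := by
      apply List.ext_getElem
      · simp [hl']
      · simp
    beta_reduce at this
    rw [e, List.ofFn_get] at this
    exact this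
  · intro h b b'
    exact h _ _ (by simp) (by simp)

theorem Gadget.act_cons (F : Gadget G R 1 2) (t : Tensor) (b : Bool) (l : List Bool) :
    F.act t (b :: l) = F.transition.mulVec (fun c => t (List.ofFn c ++ l)) fun _ => b := by
  rw [Gadget.act, Matrix.mulVec, dotProduct]
  refine Finset.sum_congr rfl fun c _ => ?_
  congr 2
  funext i
  simp [Fin.fin_one_eq_zero i]

/-- Projectivity from arity `2` to `1` implies projectivity from arity `k + 2` to `k + 1`. -/
theorem IsProjectiveGadgetSet.exists_act (hP : IsProjectiveGadgetSet P) {k : ℕ} {t t' : Tensor}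
    (h : ¬ ParallelOn (k + 2) t t') : ∃ F ∈ P, ¬ ParallelOn (k + 1) (F.act t) (F.act t') := by
  rw [parallelOn_iff] at h
  push Not at h
  obtain ⟨l, l', hl, hl', hne⟩ := h
  -- the columns of a tensor, viewed as a matrix with rows indexed by the first two factors
  let col : Tensor → List Bool → (Fin 2 → Bool) → ℂ := fun t i c => t (List.ofFn c ++ i)
  have hsplit : ∀ l : List Bool, l.length = k + 2 →
      ∃ (c : Fin 2 → Bool) (i : List Bool), i.length = k ∧ l = List.ofFn c ++ i := by
    intro l hl
    match l, hl with
    | a :: b :: i, hl => exact ⟨![a, b], i, by simpa using hl, by simp⟩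
  obtain ⟨c, i, hi, rfl⟩ := hsplit l hl
  obtain ⟨c', i', hi', rfl⟩ := hsplit l' hl'
  have hout : ∀ (F : Gadget G R 1 2) (t : Tensor) (i : List Bool) (p : Fin 1 → Bool),
      F.act t (p 0 :: i) = F.transition.mulVec (col t i) p := by
    intro F t i p
    rw [Gadget.act_cons]
    congr 1
    funext j
    rw [Fin.fin_one_eq_zero j]
  by_cases hcol : ∃ j : List Bool, j.length = k ∧ ¬ Parallel (col t j) (col t' j)
  · obtain ⟨j, hj, hnp⟩ := hcol
    obtain ⟨F, hF, hn⟩ := hP.exists_not_parallel hnp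
    refine ⟨F, hF, fun hpar => hn fun p q => ?_⟩
    rw [parallelOn_iff] at hpar
    have := hpar (p 0 :: j) (q 0 :: j) (by simp [hj]) (by simp [hj])
    simpa only [hout] using this
  · push Not at hcol
    -- all columns are dependent, so that the independence is visible in two different columns
    have hne' : col t i c * col t' i' c' ≠ col t i' c' * col t' i c := hne
    obtain ⟨w, α, β, hw, h1, h2⟩ := (hcol i hi).exists_common (by
      by_contra! h0
      exact hne' (by rw [h0.1, h0.2]; ring))
    obtain ⟨w', α', β', hw', h1', h2'⟩ := (hcol i' hi').exists_common (by
      by_contra! h0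
      exact hne' (by rw [h0.1, h0.2]; ring))
    obtain ⟨F, hF, ⟨p, hp⟩, q, hq⟩ := hP.exists_ne_zero hw hw'
    refine ⟨F, hF, fun hpar => ?_⟩
    rw [parallelOn_iff] at hpar
    have := hpar (p 0 :: i) (q 0 :: i') (by simp [hi]) (by simp [hi'])
    simp only [hout, h1, h2, h1', h2', Matrix.mulVec_smul, Pi.smul_apply, smul_eq_mul] at this hne'
    apply hne'
    have h3 : (α * β' - α' * β) * (F.transition.mulVec w p * F.transition.mulVec w' q) = 0 := by
      linear_combination this
    have h4 := (mul_eq_zero.mp h3).resolve_right (mul_ne_zero hp hq)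
    linear_combination w c * w' c' * h4

/-- The words of members of a projective set are projective from arity `k + 1` to `1`. -/
theorem IsProjectiveGadgetSet.exists_actList (hP : IsProjectiveGadgetSet P) {k : ℕ}
    {t t' : Tensor} (h : ¬ ParallelOn (k + 1) t t') : ∃ σ : List P, σ.length = k ∧
      ¬ ParallelOn 1 (Piece.actList (σ.map fun F : P => (⟨1, 2, F.1⟩ : Piece G R)) t)
        (Piece.actList (σ.map fun F : P => (⟨1, 2, F.1⟩ : Piece G R)) t') := by
  induction k generalizing t t' with
  | zero => exact ⟨[], rfl, h⟩
  | succ k ih =>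
    obtain ⟨F, hF, hn⟩ := hP.exists_act h
    obtain ⟨σ, hσ, hn'⟩ := ih hn
    refine ⟨σ ++ [⟨F, hF⟩], by simp [hσ], ?_⟩
    simpa [Piece.actList] using hn'

end Projective

/-! ### A starter of full rank -/

open Tensor

section Starter

variable {G R : Set Signature}

/-- The slice of a function on bit strings at the value `b` of the `i`-th bit. -/
def slice {k : ℕ} (f : (Fin k → Bool) → ℂ) (i : Fin k) (b : Bool) (o : Fin k → Bool) : ℂ :=
  f (Function.update o i b)

/-- If a set of gadgets is projective, then some generator depends nondegenerately on one of its
inputs: the leading edge of a gadget of rank `2` is attached to such an input. -/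
theorem exists_slice_not_parallel {P : Set (Gadget G R 1 2)} (hP : IsProjectiveGadgetSet P) :
    ∃ g ∈ G, ∃ i : Fin g.arity, ¬ Parallel (slice g.val i false) (slice g.val i true) := by
  classical
  have h0 : ¬ Parallel (Pi.single (fun _ => false) 1 : (Fin 2 → Bool) → ℂ)
      (Pi.single (fun _ => true) 1) := fun h => by
    have := h (fun _ => false) fun _ => true
    have hne : (fun _ => true : Fin 2 → Bool) ≠ fun _ => false := fun h => by
      simpa using congrFun h 0
    simp [hne] at this
  obtain ⟨F, hF, hn⟩ := hP.exists_not_parallel h0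
  obtain ⟨⟨u, i⟩, hui⟩ : ∃ x, F.genEdge.symm (Sum.inr 0) = x := ⟨_, rfl⟩
  have hE : F.genEdge ⟨u, i⟩ = Sum.inr 0 := by rw [← hui, Equiv.apply_symm_apply]
  refine ⟨F.genSig u, F.genSig_mem u, i, fun hpar => ?_⟩
  obtain ⟨α, β, hne, hz⟩ := hpar.exists_smul
  -- the same linear relation holds between the two rows of the transition matrix
  have hrow : ∀ c,
      α * F.transition (fun _ => false) c + β * F.transition (fun _ => true) c = 0 := by
    intro c
    simp only [Gadget.transition, Finset.mul_sum, ← Finset.sum_add_distrib]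
    refine Finset.sum_eq_zero fun ξ _ => ?_
    have hother : ∀ v ∈ Finset.univ.erase u, ∀ b b' : Bool,
        ((F.genSig v).val fun j => Sum.elim ξ (fun _ => b) (F.genEdge ⟨v, j⟩)) =
        (F.genSig v).val fun j => Sum.elim ξ (fun _ => b') (F.genEdge ⟨v, j⟩) := by
      intro v hv b b'
      congr 1
      funext j
      cases h : F.genEdge ⟨v, j⟩ with
      | inl e => rfl
      | inr e =>
        exfalso
        rw [Fin.fin_one_eq_zero e, ← hE] at h
        have := F.genEdge.injective h
        exact Finset.ne_of_mem_erase hv (congrArg Sigma.fst this)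
    have hthis : ∀ b : Bool,
        ((F.genSig u).val fun j => Sum.elim ξ (fun _ => b) (F.genEdge ⟨u, j⟩)) =
        slice (F.genSig u).val i b fun j => Sum.elim ξ (fun _ => false) (F.genEdge ⟨u, j⟩) := by
      intro b
      unfold slice
      congr 1
      funext j
      by_cases hj : j = i
      · subst hj
        simp [hE]
      · rw [Function.update_of_ne hj]
        cases h : F.genEdge ⟨u, j⟩ with
        | inl e => rfl
        | inr e =>
          exfalso
          rw [Fin.fin_one_eq_zero e, ← hE] at h
          exact hj (eq_of_heq (Sigma.mk.inj (F.genEdge.injective h)).2)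
    rw [← Finset.mul_prod_erase _ _ (Finset.mem_univ u),
      ← Finset.mul_prod_erase (a := u) _ (fun v => (F.genSig v).val fun j =>
        Sum.elim ξ (fun _ => true) (F.genEdge ⟨v, j⟩)) (Finset.mem_univ u),
      Finset.prod_congr rfl fun v hv => hother v hv true false, hthis, hthis]
    linear_combination (∏ v ∈ Finset.univ.erase u, (F.genSig v).val fun j =>
      Sum.elim ξ (fun _ => false) (F.genEdge ⟨v, j⟩)) * (∏ v, (F.recSig v).val fun j =>
      Sum.elim ξ c (F.recEdge ⟨v, j⟩)) * hz fun j =>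
        Sum.elim ξ (fun _ => false) (F.genEdge ⟨u, j⟩)
  have hvec : ∀ x : (Fin 2 → Bool) → ℂ, α * F.transition.mulVec x (fun _ => false) +
      β * F.transition.mulVec x (fun _ => true) = 0 := by
    intro x
    simp only [Matrix.mulVec, dotProduct, Finset.mul_sum, ← Finset.sum_add_distrib]
    exact Finset.sum_eq_zero fun c _ => by linear_combination x c * hrow c
  have hb : ∀ p : Fin 1 → Bool, p = (fun _ => false) ∨ p = fun _ => true := by
    intro p
    cases h : p 0
    · exact .inl (funext fun j => by rw [Fin.fin_one_eq_zero j, h])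
    · exact .inr (funext fun j => by rw [Fin.fin_one_eq_zero j, h])
  apply hn
  have key : ∀ x y : (Fin 2 → Bool) → ℂ,
      F.transition.mulVec x (fun _ => false) * F.transition.mulVec y (fun _ => true) =
      F.transition.mulVec x (fun _ => true) * F.transition.mulVec y (fun _ => false) := by
    intro x y
    have hx := hvec x
    have hy := hvec y
    rcases hne with hα | hβ
    · apply mul_left_cancel₀ hα
      linear_combination F.transition.mulVec y (fun _ => true) * hx -
        F.transition.mulVec x (fun _ => true) * hy
    · apply mul_left_cancel₀ hβ
      linear_combination F.transition.mulVec x (fun _ => false) * hy -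
        F.transition.mulVec y (fun _ => false) * hx
  intro p q
  rcases hb p with rfl | rfl <;> rcases hb q with rfl | rfl
  · ring
  · exact key _ _
  · exact (key _ _).symm
  · ring

/-- Two independent vectors have a dual family. -/
theorem exists_dual {ι : Type*} [Fintype ι] {s : Bool → ι → ℂ} (h : ¬ Parallel (s false) (s true)) :
    ∃ H : Bool → ι → ℂ, ∀ b b', ∑ o, H b o * s b' o = if b = b' then 1 else 0 := by
  classical
  rw [Parallel] at h
  push Not at h
  obtain ⟨p, q, hpq⟩ := h
  have hD : s false p * s true q - s false q * s true p ≠ 0 := sub_ne_zero.mpr hpq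
  set D := s false p * s true q - s false q * s true p with hDdef
  refine ⟨fun b => cond b
    (Pi.single q (s false p / D) - Pi.single p (s false q / D))
    (Pi.single p (s true q / D) - Pi.single q (s true p / D)), fun b b' => ?_⟩
  cases b <;> cases b' <;>
    simp [sub_mul, Finset.sum_sub_distrib, Pi.single_apply, Finset.sum_ite_eq'] <;>
    field_simp <;> rw [hDdef] <;> ring

/-- The tensor power of a pair of independent vectors has full rank. -/
theorem tensorPower_injective {ι : Type*} [Fintype ι] {d : ℕ} {s : Bool → ι → ℂ}
    (h : ¬ Parallel (s false) (s true)) (z : (Fin d → Bool) → ℂ)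
    (hz : ∀ o : Fin d → ι, ∑ c, z c * ∏ u, s (c u) (o u) = 0) : z = 0 := by
  classical
  obtain ⟨H, hH⟩ := exists_dual h
  funext b
  have h1 : ∑ o : Fin d → ι, (∏ u, H (b u) (o u)) * ∑ c, z c * ∏ u, s (c u) (o u) = 0 :=
    Finset.sum_eq_zero fun o _ => by rw [hz, mul_zero]
  have h2 : ∀ c : Fin d → Bool, ∑ o : Fin d → ι, ∏ u, (H (b u) (o u) * s (c u) (o u)) =
      if b = c then 1 else 0 := by
    intro c
    have := Finset.prod_univ_sum (fun _ : Fin d => (Finset.univ : Finset ι))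
      fun u o => H (b u) o * s (c u) o
    rw [Fintype.piFinset_univ] at this
    rw [← this]
    simp only [hH]
    by_cases hbc : b = c
    · simp [hbc]
    · obtain ⟨u, hu⟩ := Function.ne_iff.mp hbc
      rw [if_neg hbc]
      exact Finset.prod_eq_zero (Finset.mem_univ u) (if_neg hu)
  simp only [Finset.mul_sum] at h1
  rw [Finset.sum_comm] at h1
  have h3 : ∀ c : Fin d → Bool, ∑ o : Fin d → ι, (∏ u, H (b u) (o u)) *
      (z c * ∏ u, s (c u) (o u)) = z c * if b = c then 1 else 0 := by
    intro c
    rw [← h2 c, Finset.mul_sum]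
    refine Finset.sum_congr rfl fun o _ => ?_
    rw [Finset.prod_mul_distrib]
    ring
  simp only [h3] at h1
  simpa using h1

/-- The product of a type with `Fin k`, with the `i`-th components split off. -/
def splitIndex (d : ℕ) {k : ℕ} (i : Fin k) :
    Fin d × Fin k ≃ Fin d ⊕ (Fin d × {j : Fin k // j ≠ i}) where
  toFun p := if h : p.2 = i then .inl p.1 else .inr (p.1, ⟨p.2, h⟩)
  invFun := Sum.elim (fun u => (u, i)) fun p => (p.1, p.2)
  left_inv p := by
    obtain ⟨u, j⟩ := p
    by_cases h : j = i
    · subst h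
      simp
    · simp [h]
  right_inv p := by
    rcases p with u | ⟨u, j, hj⟩
    · simp
    · simp [hj]

/-- There is a gadget without trailing edges whose signature, as a matrix whose rows are indexed by
the first `d` leading edges, has full row rank. It consists of `d` copies of a generator. -/
theorem exists_starter {P : Set (Gadget G R 1 2)} (hP : IsProjectiveGadgetSet P) (d : ℕ) :
    ∃ (r : ℕ) (Γ : Gadget G R (d + r) 0), ∀ z : (Fin d → Bool) → ℂ,
      (∀ l : List Bool, l.length = r →
        ∑ c, z c * Γ.act (fun _ => 1) (List.ofFn c ++ l) = 0) → z = 0 := by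
  classical
  obtain ⟨g, hg, i, hgi⟩ := exists_slice_not_parallel hP
  let r := Fintype.card (Fin d × {j : Fin g.arity // j ≠ i})
  let ε : (Fin d × {j : Fin g.arity // j ≠ i}) ≃ Fin r := Fintype.equivFin _
  let E : (Fin d × Fin g.arity) ≃ Fin (d + r) :=
    ((splitIndex d i).trans (Equiv.sumCongr (Equiv.refl _) ε)).trans finSumFinEquiv
  have E1 : ∀ u, E (u, i) = Fin.castAdd r u := fun u => by simp [E, splitIndex]
  have E2 : ∀ u j (h : j ≠ i), E (u, j) = Fin.natAdd d (ε (u, ⟨j, h⟩)) := fun u j h => by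
    simp [E, splitIndex, h]
  let Γ : Gadget G R (d + r) 0 :=
    { numGen := d
      numRec := 0
      numEdge := 0
      genSig := fun _ => g
      genSig_mem := fun _ => hg
      recSig := fun v => v.elim0
      recSig_mem := fun v => v.elim0
      genEdge := (Equiv.sigmaEquivProd _ _).trans (E.trans (Equiv.emptySum _ _).symm)
      recEdge := Equiv.equivOfIsEmpty _ _ }
  have hΓ : ∀ l, Γ.act (fun _ => 1) l =
      ∏ u : Fin d, g.val fun j => l.getD (E (u, j)) false := by
    intro l
    simp [Gadget.act, Gadget.transition, Γ]
  refine ⟨r, Γ, fun z hz => tensorPower_injective hgi z fun o => ?_⟩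
  -- the string of the values of all inputs of the copies, except the distinguished ones
  let l : List Bool := List.ofFn fun k : Fin r => o (ε.symm k).1 (ε.symm k).2
  rw [← hz l (by simp [l])]
  refine Finset.sum_congr rfl fun c _ => ?_
  rw [hΓ]
  congr 1
  refine Finset.prod_congr rfl fun u _ => ?_
  unfold slice
  congr 1
  funext j
  by_cases hj : j = i
  · subst hj
    rw [Function.update_self, E1]
    simp [List.getD_eq_getElem?_getD, List.getElem?_append_left]
  · rw [Function.update_of_ne hj, E2 u j hj]
    simp [List.getD_eq_getElem?_getD, l]

end Starter

/-! ### Infinitely many words -/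

section Words

open Tensor

variable {G R : Set Signature} {d r : ℕ} {S : Set (Gadget G R d d)}

/-- The word of gadgets that consists of recursive gadgets followed by a starter. -/
def starterWord (Γ : Gadget G R (d + r) 0) (w : List S) : List (Piece G R) :=
  w.map (fun s : S => (⟨d, d, s.1⟩ : Piece G R)) ++ [⟨d + r, 0, Γ⟩]

theorem starterWord_fits (Γ : Gadget G R (d + r) 0) (w : List S) :
    Piece.Fits (starterWord Γ w) (d + r) := by
  induction w with
  | nil => exact ⟨le_rfl, by simp [Piece.Fits]⟩
  | cons s w ih =>
    refine ⟨Nat.le_add_right d r, ?_⟩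
    simpa [starterWord] using ih

/-- The product of the transition matrices of a word. -/
noncomputable def wordMatrix (w : List S) : Matrix (Fin d → Bool) (Fin d → Bool) ℂ :=
  (w.map fun s : S => s.1.transition).prod

theorem starterWord_tensor (Γ : Gadget G R (d + r) 0) (w : List S) (b : Fin d → Bool)
    (l : List Bool) :
    Piece.tensor (starterWord Γ w) (List.ofFn b ++ l) =
      ∑ c, wordMatrix w b c * Γ.act (fun _ => 1) (List.ofFn c ++ l) := by
  induction w generalizing b with
  | nil => simp [wordMatrix, Matrix.one_apply, starterWord, Piece.tensor, Piece.actList]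
  | cons s w ih =>
    have h1 : Piece.tensor (starterWord Γ (s :: w)) = s.1.act (Piece.tensor (starterWord Γ w)) :=
        rfl
    have h2 : wordMatrix (s :: w) = s.1.transition * wordMatrix w := by simp [wordMatrix]
    rw [h1, h2, Gadget.act]
    have h3 : (List.ofFn b ++ l).drop d = l := by
      rw [List.drop_append_of_le_length (by simp), List.drop_eq_nil_of_le (by simp)]
      rfl
    have h4 : (fun i : Fin d => (List.ofFn b ++ l).getD i false) = b := by
      funext i
      simp [List.getD_eq_getElem?_getD, List.getElem?_append_left]
    rw [h3, h4]
    simp only [ih, Matrix.mul_apply, Finset.sum_mul, Finset.mul_sum]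
    rw [Finset.sum_comm]
    exact Finset.sum_congr rfl fun c _ => Finset.sum_congr rfl fun c' _ => by ring

/-- For a starter of full rank, the tensors of two words of nonsingular gadgets are dependent only
if the products of the transition matrices agree up to a scalar. -/
theorem wordMatrix_eq_smul {Γ : Gadget G R (d + r) 0}
    (hΓ : ∀ z : (Fin d → Bool) → ℂ, (∀ l : List Bool, l.length = r →
      ∑ c, z c * Γ.act (fun _ => 1) (List.ofFn c ++ l) = 0) → z = 0)
    {w w' : List S} (hw : wordMatrix w ≠ 0)
    (h : ParallelOn (d + r) (Piece.tensor (starterWord Γ w)) (Piece.tensor (starterWord Γ w'))) :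
    ∃ a : ℂ, wordMatrix w' = a • wordMatrix w := by
  rw [parallelOn_iff] at h
  obtain ⟨b, l, hl, hbl⟩ : ∃ (b : Fin d → Bool) (l : List Bool), l.length = r ∧
      Piece.tensor (starterWord Γ w) (List.ofFn b ++ l) ≠ 0 := by
    by_contra! h0
    apply hw
    funext b
    refine hΓ _ fun l hl => ?_
    rw [← starterWord_tensor]
    exact h0 b l hl
  refine ⟨Piece.tensor (starterWord Γ w') (List.ofFn b ++ l) /
    Piece.tensor (starterWord Γ w) (List.ofFn b ++ l), ?_⟩
  set a := Piece.tensor (starterWord Γ w') (List.ofFn b ++ l) /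
    Piece.tensor (starterWord Γ w) (List.ofFn b ++ l) with ha
  rw [← sub_eq_zero]
  funext b'
  refine hΓ _ fun l' hl' => ?_
  have h1 := h (List.ofFn b ++ l) (List.ofFn b' ++ l') (by simp [hl]) (by simp [hl'])
  have h2 : Piece.tensor (starterWord Γ w') (List.ofFn b' ++ l') =
      a * Piece.tensor (starterWord Γ w) (List.ofFn b' ++ l') := by
    rw [ha]
    field_simp
    linear_combination h1
  rw [starterWord_tensor, starterWord_tensor, Finset.mul_sum] at h2
  simp only [Matrix.sub_apply, Matrix.smul_apply, smul_eq_mul, sub_mul, Finset.sum_sub_distrib]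
  rw [h2, sub_eq_zero]
  exact Finset.sum_congr rfl fun c _ => by ring

/-- No finite list of words represents all lines: if the group generated by the transition matrices
modulo scalars is infinite, then some word of the list, extended by a letter, gives a new line. A
finite set of group elements that contains `1` and is closed under left multiplication by the
generators contains the group, so that inverses of the generators are not needed. -/
theorem exists_new_word (hSnonsing : ∀ s ∈ S, IsUnit s.transition.det)
    (hH : Infinite (transitionGroup S)) {Γ : Gadget G R (d + r) 0}
    (hΓ : ∀ z : (Fin d → Bool) → ℂ, (∀ l : List Bool, l.length = r →
      ∑ c, z c * Γ.act (fun _ => 1) (List.ofFn c ++ l) = 0) → z = 0)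
    {L : List (List S)} (hL : [] ∈ L) :
    ∃ w ∈ L, ∃ s : S, ∀ w' ∈ L, ¬ ParallelOn (d + r) (Piece.tensor (starterWord Γ (s :: w)))
      (Piece.tensor (starterWord Γ w')) := by
  by_contra! hcl
  let γ : S → GL (Fin d → Bool) ℂ := fun s =>
    Matrix.GeneralLinearGroup.mk'' s.1.transition (hSnonsing s.1 s.2)
  let W : List S → GL (Fin d → Bool) ℂ := fun w => (w.map γ).prod
  have hW : ∀ w, (W w : Matrix (Fin d → Bool) (Fin d → Bool) ℂ) = wordMatrix w := by
    intro w
    induction w with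
    | nil => simp [W, wordMatrix]
    | cons s w ih =>
      have : W (s :: w) = γ s * W w := by simp [W]
      rw [this, Units.val_mul, ih]
      exact (List.prod_cons ..).symm
  have hW0 : ∀ w : List S, wordMatrix w ≠ 0 := by
    intro w h0
    have h1 : ((W w)⁻¹ : GL (Fin d → Bool) ℂ).val * (W w).val = 1 := by
      rw [← Units.val_mul, inv_mul_cancel, Units.val_one]
    rw [hW, h0, mul_zero] at h1
    exact zero_ne_one h1
  have hpar : ∀ w w' : List S, ParallelOn (d + r) (Piece.tensor (starterWord Γ w))
      (Piece.tensor (starterWord Γ w')) →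
      Matrix.ProjGenLinGroup.mk (W w) = Matrix.ProjGenLinGroup.mk (W w') := by
    intro w w' h
    obtain ⟨a, ha⟩ := wordMatrix_eq_smul hΓ (hW0 w) h
    have ha0 : a ≠ 0 := by
      rintro rfl
      exact hW0 w' (by rw [ha, zero_smul])
    refine Matrix.ProjGenLinGroup.mk_eq_mk_iff.mpr ⟨Units.mk0 a ha0, Units.ext ?_⟩
    rw [hW w', ha, ← hW w, Units.val_mul]
    simp [Matrix.smul_eq_mul_diagonal]
  let T : Set (Matrix.ProjGenLinGroup (Fin d → Bool) ℂ) :=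
    (fun w => Matrix.ProjGenLinGroup.mk (W w)) '' {w | w ∈ L}
  have hT : T.Finite := (List.finite_toSet L).image _
  have hmul : ∀ s, ∀ y ∈ T, Matrix.ProjGenLinGroup.mk (γ s) * y ∈ T := by
    rintro s _ ⟨w, hw, rfl⟩
    obtain ⟨w', hw', h⟩ := hcl w hw s
    refine ⟨w', hw', ?_⟩
    beta_reduce
    rw [← hpar _ _ h, ← map_mul]
    simp [W]
  have hinv : ∀ s, ∀ y ∈ T, (Matrix.ProjGenLinGroup.mk (γ s))⁻¹ * y ∈ T := by
    intro s y hy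
    have himg : (fun y => Matrix.ProjGenLinGroup.mk (γ s) * y) '' T = T :=
      Set.eq_of_subset_of_ncard_le (Set.image_subset_iff.mpr (hmul s))
        (Set.ncard_image_of_injective _ (mul_right_injective _)).ge hT
    rw [← himg] at hy
    obtain ⟨x, hx, rfl⟩ := hy
    simpa using hx
  have hsub : (transitionGroup S : Set (Matrix.ProjGenLinGroup (Fin d → Bool) ℂ)) ⊆ T := by
    have hgen : ∀ x ∈ Matrix.ProjGenLinGroup.mk ''
        {A : GL (Fin d → Bool) ℂ | ∃ s ∈ S, (A : Matrix (Fin d → Bool) (Fin d → Bool) ℂ) =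
          s.transition}, ∃ s, x = Matrix.ProjGenLinGroup.mk (γ s) := by
      rintro _ ⟨A, ⟨s, hs, hA⟩, rfl⟩
      exact ⟨⟨s, hs⟩, congrArg _ (Units.ext hA)⟩
    intro x hx
    induction hx using Subgroup.closure_induction_left with
    | one => exact ⟨[], hL, by simp [W]⟩
    | mul_left x hx y _ ih =>
      obtain ⟨s, rfl⟩ := hgen x hx
      exact hmul s y ih
    | inv_mul_cancel x hx y _ ih =>
      obtain ⟨s, rfl⟩ := hgen x hx
      exact hinv s y ih
  exact (Set.infinite_coe_iff.mp hH) (hT.subset hsub)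

end Words

/-! ### Computing with the tensors of words -/

open Tensor

section Letters

open Data (nil num pair SizeLE ofList ofNat ofBool ofTable)

variable {A : Set ℂ} {O : Data → Data → Prop} {α β : Type} {n : α → ℕ} {x : α → Data}
variable {G R : Set Signature}

theorem Gadget.transition_hasIntHeight (hA : ∀ f ∈ G ∪ R, ∀ b, f.val b ∈ A) {m k : ℕ}
    (Γ : Gadget G R m k) (b : Fin m → Bool) (c : Fin k → Bool) :
    HasIntHeight A (Γ.transition b c) (Γ.numGen + Γ.numRec) (2 ^ Γ.numEdge) := by
  rw [Gadget.transition]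
  refine (HasIntHeight.sum Finset.univ fun ξ _ => (HasIntHeight.prod Finset.univ fun u _ =>
    HasIntHeight.of_mem (hA _ (.inl (Γ.genSig_mem u)) _)).mul (HasIntHeight.prod Finset.univ
    fun u _ => HasIntHeight.of_mem (hA _ (.inr (Γ.recSig_mem u)) _))).mono ?_ ?_
  · simp
  · simp

/-- The heights of the answers of the oracle are polynomially bounded. -/
theorem OpenGrid.value_hasHeight (hA : ∀ f ∈ G ∪ R, ∀ b, f.val b ∈ A) {st : OpenGrid}
    (h : st.Valid G R) :
    HasHeight A (st.value fun _ => 1) (st.gens.length + st.recs.length + st.fresh) := by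
  have h1 : HasIntHeight A (st.value fun _ => 1) (st.gens.length + st.recs.length)
      (2 ^ st.fresh) := by
    rw [OpenGrid.value]
    simp only [mul_one]
    refine (HasIntHeight.sum Finset.univ fun ξ _ => (HasIntHeight.list_prod st.gens
      (f := LabelledVertex.eval (extendAssignment ξ)) (D := 1) (B := 1) fun v hv => ?_).mul
      (HasIntHeight.list_prod st.recs (f := LabelledVertex.eval (extendAssignment ξ)) (D := 1)
        (B := 1) fun v hv => ?_)).mono ?_ ?_
    · exact HasIntHeight.of_mem (hA _ (.inl (h.gen_mem v hv)) _)
    · exact HasIntHeight.of_mem (hA _ (.inr (h.rec_mem v hv)) _)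
    · simp
    · simp
  exact h1.hasHeight (by omega) (Nat.pow_le_pow_right (by norm_num) (by omega))

theorem Gadget.act_hasIntHeight (hA : ∀ f ∈ G ∪ R, ∀ b, f.val b ∈ A) {m k : ℕ}
    (Γ : Gadget G R m k) {t : Tensor} {D B : ℕ} (ht : ∀ l, HasIntHeight A (t l) D B)
        (l : List Bool) :
    HasIntHeight A (Γ.act t l) (Γ.numGen + Γ.numRec + D) (2 ^ (k + Γ.numEdge) * B) := by
  rw [Gadget.act]
  refine (HasIntHeight.sum Finset.univ fun c _ =>
    (Γ.transition_hasIntHeight hA _ c).mul (ht _)).mono le_rfl (le_of_eq ?_)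
  simp [pow_add, mul_assoc]

variable {Λ : Type} (pc : Λ → Piece G R) (code : Λ → Data)

/-- The tensor realized by a word over an alphabet of gadgets. -/
noncomputable def letterTensor (c : List Λ) : Tensor := Piece.tensor (c.map pc)

/-- The data kept for a word: its letters and the table of its tensor of arity `k`. -/
noncomputable def encWord (k : ℕ) (c : List Λ) : Data :=
  Data.pair (ofList (c.map code)) (Data.ofTable k fun b => letterTensor pc c (List.ofFn b))

theorem letterTensor_cons (s : Λ) (c : List Λ) :
    letterTensor pc (s :: c) = (pc s).gadget.act (letterTensor pc c) := rfl

/-- The heights of the entries of the tensor of a word grow linearly with the length of the word.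
Integral representations are essential here: bringing sums of quotients to a common denominator in
each step would multiply the heights by a constant. -/
theorem letterTensor_hasHeight [Finite Λ] (hA : ∀ f ∈ G ∪ R, ∀ b, f.val b ∈ A) :
    ∃ E : ℕ, ∀ c l, HasHeight A (letterTensor pc c l) (c.length * E) := by
  have := Fintype.ofFinite Λ
  let E := ∑ s, ((pc s).gadget.numGen + (pc s).gadget.numRec + ((pc s).n + (pc s).gadget.numEdge))
  have hE : ∀ s, (pc s).gadget.numGen + (pc s).gadget.numRec +
      ((pc s).n + (pc s).gadget.numEdge) ≤ E := fun s =>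
    Finset.single_le_sum (f := fun s => (pc s).gadget.numGen + (pc s).gadget.numRec +
      ((pc s).n + (pc s).gadget.numEdge)) (fun _ _ => Nat.zero_le _) (Finset.mem_univ s)
  have key : ∀ c l, HasIntHeight A (letterTensor pc c l) (c.length * E) (2 ^ (c.length * E)) := by
    intro c
    induction c with
    | nil =>
      intro l
      simpa [letterTensor, Piece.tensor, Piece.actList] using HasIntHeight.one
    | cons s c ih =>
      intro l
      rw [letterTensor_cons]
      have := hE s
      refine ((pc s).gadget.act_hasIntHeight hA ih l).mono ?_ ?_
      · simp only [List.length_cons, add_mul]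
        omega
      · rw [← pow_add]
        refine Nat.pow_le_pow_right (by norm_num) ?_
        simp only [List.length_cons, add_mul]
        omega
  exact ⟨E, fun c l => (key c l).hasHeight le_rfl le_rfl⟩

variable {pc code}

/-- The action of a fixed gadget on tensors of a fixed arity is computable in polynomial time. -/
theorem FP.act (hA : ∀ f ∈ G ∪ R, ∀ b, f.val b ∈ A) (p : Piece G R) {k k' : ℕ}
    (hk' : k = p.n + (k' - p.m)) {t : α → Tensor}
    (ht : FP A O n x fun a => Data.ofTable k fun b => t a (List.ofFn b)) :
    FP A O n x fun a => Data.ofTable k' fun b => p.gadget.act (t a) (List.ofFn b) := by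
  refine FP.ofTable fun b => ?_
  simp only [Gadget.act]
  refine FP.finsetSum _ ht.left fun c => FP.mul ?_ ?_
  · exact FP.constNum ht.left ((p.gadget.transition_hasIntHeight hA _ c).hasHeight
      (N := p.gadget.numGen + p.gadget.numRec + p.gadget.numEdge) (by omega)
      (Nat.pow_le_pow_right (by norm_num) (by omega)))
  · have hl : (List.ofFn c ++ (List.ofFn b).drop p.m).length = k := by simp [hk']
    have := FP.ofTable_apply ht fun i => (List.ofFn c ++ (List.ofFn b).drop p.m).get
        (Fin.cast hl.symm i)
    convert this using 4 with a
    apply List.ext_getElem <;> simp [hk']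

theorem FP.consLetter (hA : ∀ f ∈ G ∪ R, ∀ b, f.val b ∈ A) (hcode : ∀ s, ∃ N, SizeLE A (code s) N)
    (s : Λ) {k k' : ℕ} (hk' : k = (pc s).n + (k' - (pc s).m))
    {c : α → List Λ} (hc : FP A O n x fun a => encWord pc code k (c a)) :
    FP A O n x fun a => encWord pc code k' (s :: c a) :=
  FP.pair ((FP.const hc.left _ (hcode s)).pair hc.fst) (FP.act hA (pc s) hk' hc.snd)

open Classical in
theorem FP.parallelOn {k : ℕ} {t t' : α → Tensor}
    (ht : FP A O n x fun a => Data.ofTable k fun b => t a (List.ofFn b))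
    (ht' : FP A O n x fun a => Data.ofTable k fun b => t' a (List.ofFn b)) :
    FP A O n x fun a => ofBool (decide (ParallelOn k (t a) (t' a))) := by
  unfold ParallelOn Parallel
  have h := fun b => FP.ofTable_apply (f := fun a b => t a (List.ofFn b)) ht b
  have h' := fun b => FP.ofTable_apply (f := fun a b => t' a (List.ofFn b)) ht' b
  exact FP.forallFinite ht.left fun b => FP.forallFinite ht.left fun b' =>
    FP.numEq (FP.mul (h b) (h' b')) (FP.mul (h b') (h' b))

/-- The data of words of polynomially bounded length have polynomially bounded size. -/
theorem encWord_polySize [Finite Λ] (hA : ∀ f ∈ G ∪ R, ∀ b, f.val b ∈ A)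
    (hcode : ∀ s, ∃ N, SizeLE A (code s) N) (k : ℕ) {c : α → List Λ}
    (hc : PolyBounded n fun a => (c a).length) :
    PolySize A n fun a => encWord pc code k (c a) := by
  have := Fintype.ofFinite Λ
  obtain ⟨E, hE⟩ := letterTensor_hasHeight (A := A) pc hA
  choose N hN using hcode
  refine PolySize.pair ?_ ?_
  · refine PolySize.listOf (e := fun _ => code) hc (fun _ => le_rfl)
      ⟨fun _ => ∑ s, N s, .const _, fun p => (hN _).mono ?_⟩
    exact Finset.single_le_sum (f := N) (fun _ _ => Nat.zero_le _) (Finset.mem_univ _)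
  · refine ⟨fun a => 2 ^ k * ((c a).length * E + 2),
      (PolyBounded.const _).mul ((hc.mul (.const E)).add (.const 2)), fun a => ?_⟩
    exact (SizeLE.ofTable fun b => hE _ _).mono (Nat.sub_le _ _)

theorem FP.letterValue {c : α → List Λ} (hc : FP A O n x fun a => encWord pc code 1 (c a))
    (b : Bool) :
    FP A O n x fun a => num (letterTensor pc (c a) [b]) := by
  have h := FP.ofTable_apply hc.snd fun _ => b
  simpa using h

end Letters

/-! ### The search for pairwise independent unary tensors -/

open Tensor

section Search

open Data (nil num pair SizeLE ofList ofNat ofBool)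

variable {G R : Set Signature} {Λ : Type} (pc : Λ → Piece G R)

/-- The values of the tensor of a word of arity `1`. -/
noncomputable def letterVec (c : List Λ) (b : Bool) : ℂ := letterTensor pc c [b]

open Classical in
/-- The extensions by a letter of the words in a list whose tensors are independent of those of all
words in the list. -/
noncomputable def newWords (k : ℕ) (SL : List Λ) (L : List (List Λ)) : List (List Λ) :=
  (L.flatMap fun c => SL.map fun s => s :: c).filter fun c' =>
    L.all fun c => !decide (ParallelOn k (letterTensor pc c') (letterTensor pc c))

/-- Starting from a list of words, add repeatedly one new word. -/
noncomputable def growStep (k : ℕ) (SL : List Λ) (L : List (List Λ)) : List (List Λ) :=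
  (newWords pc k SL L).take 1 ++ L

open Classical in
/-- Greedy choice of at most `N` words with nonzero, pairwise independent unary tensors. -/
noncomputable def selectStep (N : ℕ) (acc : List (List Λ)) (c : List Λ) : List (List Λ) :=
  if (!decide (ofNat acc.length = ofNat N) &&
    (!(decide (letterVec pc c false = 0) && decide (letterVec pc c true = 0)) &&
    acc.all fun c' => !decide (det2 (letterVec pc c) (letterVec pc c') = 0))) = true
  then c :: acc else acc

variable {pc}

theorem Data.ofNat_injective : Function.Injective Data.ofNat := by
  intro i
  induction i with
  | zero => intro j h; cases j with
    | zero => rfl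
    | succ j => cases h
  | succ i ih => intro j h; cases j with
    | zero => cases h
    | succ j =>
      injection h with _ h
      rw [ih h]

section Correctness

variable {k : ℕ} {SL : List Λ} {PL : List (List Λ)} {s0 : Λ}

/-- The supply of new words does not end. -/
def SupplyOfWords (pc : Λ → Piece G R) (k : ℕ) (SL : List Λ) (s0 : Λ) : Prop :=
  ∀ L : List (List Λ), [s0] ∈ L → (∀ c ∈ L, ∃ w : List Λ, (∀ s ∈ w, s ∈ SL) ∧ c = w ++ [s0]) →
    ∃ c ∈ L, ∃ s ∈ SL, ∀ c' ∈ L, ¬ ParallelOn k (letterTensor pc (s :: c)) (letterTensor pc c')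

theorem growStep_iterate (h : SupplyOfWords pc k SL s0) (j : ℕ) :
    ((growStep pc k SL)^[j] [[s0]]).length = j + 1 ∧
    ((growStep pc k SL)^[j] [[s0]]).Pairwise (fun c c' =>
      ¬ ParallelOn k (letterTensor pc c) (letterTensor pc c')) ∧
    [s0] ∈ (growStep pc k SL)^[j] [[s0]] ∧
    ∀ c ∈ (growStep pc k SL)^[j] [[s0]], c.length ≤ j + 1 ∧
      ∃ w : List Λ, (∀ s ∈ w, s ∈ SL) ∧ c = w ++ [s0] := by
  induction j with
  | zero => simp
  | succ j ih =>
    rw [Function.iterate_succ_apply']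
    set L := (growStep pc k SL)^[j] [[s0]]
    obtain ⟨h1, h2, h3, h4⟩ := ih
    obtain ⟨c, hc, s, hs, hcs⟩ := h L h3 fun c hc => (h4 c hc).2
    have hmem : s :: c ∈ newWords pc k SL L := by
      refine List.mem_filter.mpr ⟨List.mem_flatMap.mpr ⟨c, hc, List.mem_map_of_mem hs⟩, ?_⟩
      simpa using hcs
    obtain ⟨c', l, hl⟩ := List.exists_cons_of_ne_nil (List.ne_nil_of_mem hmem)
    have hstep : growStep pc k SL L = c' :: L := by simp [growStep, hl]
    have hc' : c' ∈ newWords pc k SL L := by simp [hl]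
    obtain ⟨h5, h6⟩ := List.mem_filter.mp hc'
    obtain ⟨c'', hc'', h7⟩ := List.mem_flatMap.mp h5
    obtain ⟨s', hs', rfl⟩ := List.mem_map.mp h7
    rw [hstep]
    refine ⟨by simp [h1], List.pairwise_cons.mpr ⟨by simpa using h6, h2⟩,
      List.mem_cons_of_mem _ h3, fun c hc => ?_⟩
    rcases List.mem_cons.mp hc with rfl | hc
    · obtain ⟨h8, w, hw, rfl⟩ := h4 c'' hc''
      refine ⟨by simpa using h8, s' :: w, ?_, rfl⟩
      intro s hs
      rcases List.mem_cons.mp hs with rfl | hs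
      · exact hs'
      · exact hw s hs
    · obtain ⟨h8, h9⟩ := h4 c hc
      exact ⟨by omega, h9⟩

theorem selectStep_eq (N : ℕ) (acc : List (List Λ)) (c : List Λ) [Decidable (acc.length ≠ N ∧
      ¬ (letterVec pc c false = 0 ∧ letterVec pc c true = 0) ∧
      ∀ c' ∈ acc, det2 (letterVec pc c) (letterVec pc c') ≠ 0)] :
    selectStep pc N acc c = if acc.length ≠ N ∧
      ¬ (letterVec pc c false = 0 ∧ letterVec pc c true = 0) ∧
      ∀ c' ∈ acc, det2 (letterVec pc c) (letterVec pc c') ≠ 0 then c :: acc else acc := by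
  unfold selectStep
  refine if_congr ?_ rfl rfl
  simp [Data.ofNat_injective.eq_iff]
  tauto

/-- The chosen words are pairwise independent, and if fewer than `N` words are chosen, then every
nonzero candidate is dependent on one of them. -/
theorem select_spec (N : ℕ) (C : List (List Λ)) :
    (C.foldl (selectStep pc N) []).length ≤ N ∧
    (C.foldl (selectStep pc N) []).Pairwise
      (fun c c' => det2 (letterVec pc c) (letterVec pc c') ≠ 0) ∧
    (∀ c ∈ C.foldl (selectStep pc N) [], c ∈ C ∧
      ¬ (letterVec pc c false = 0 ∧ letterVec pc c true = 0)) ∧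
    ((C.foldl (selectStep pc N) []).length ≠ N → ∀ c ∈ C,
      ¬ (letterVec pc c false = 0 ∧ letterVec pc c true = 0) →
      ∃ c' ∈ C.foldl (selectStep pc N) [], det2 (letterVec pc c) (letterVec pc c') = 0) := by
  classical
  induction C using List.reverseRecOn with
  | nil => simp
  | append_singleton C c ih =>
    rw [List.foldl_append, List.foldl_cons, List.foldl_nil, selectStep_eq]
    set acc := C.foldl (selectStep pc N) []
    obtain ⟨h1, h2, h3, h4⟩ := ih
    split_ifs with h
    · obtain ⟨h5, h6, h7⟩ := h
      refine ⟨by simp only [List.length_cons]; omega, List.pairwise_cons.mpr ⟨h7, h2⟩, ?_, ?_⟩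
      · intro c' hc'
        rcases List.mem_cons.mp hc' with rfl | hc'
        · exact ⟨by simp, h6⟩
        · exact ⟨by simp [(h3 c' hc').1], (h3 c' hc').2⟩
      · intro _ c' hc' hne
        rcases List.mem_append.mp hc' with hc' | hc'
        · obtain ⟨c'', hc'', h8⟩ := h4 h5 c' hc' hne
          exact ⟨c'', List.mem_cons_of_mem _ hc'', h8⟩
        · obtain rfl := List.mem_singleton.mp hc'
          exact ⟨_, List.mem_cons_self, det2_self _⟩
    · refine ⟨h1, h2, fun c' hc' => ⟨by simp [(h3 c' hc').1], (h3 c' hc').2⟩, ?_⟩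
      intro h5 c' hc' hne
      rcases List.mem_append.mp hc' with hc' | hc'
      · exact h4 h5 c' hc' hne
      · obtain rfl := List.mem_singleton.mp hc'
        by_contra! h8
        exact h ⟨h5, hne, h8⟩

theorem parallelOn_one_of_det2 {c c' : List Λ} (h : det2 (letterVec pc c) (letterVec pc c') = 0) :
    ParallelOn 1 (letterTensor pc c) (letterTensor pc c') := by
  intro p q
  rw [det2, sub_eq_zero] at h
  simp only [letterVec] at h
  simp only [List.ofFn_succ, List.ofFn_zero]
  cases p 0 <;> cases q 0
  · ring
  · exact h
  · exact h.symm
  · ring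

/-- The greedy choice among the reductions of more than `N ^ K` pairwise independent tensors, where
`K` is the number of words of projections, finds `N` independent unary tensors: with fewer, a tensor
would be determined up to a scalar by the lines of its `K` reductions, which are `0` or one of fewer
than `N` lines. -/
theorem select_length {N : ℕ} {L : List (List Λ)}
    (hL : L.Pairwise fun c c' => ¬ ParallelOn k (letterTensor pc c) (letterTensor pc c'))
    (hlen : N ^ PL.length < L.length)
    (hsep : ∀ c c' : List Λ, ¬ ParallelOn k (letterTensor pc c) (letterTensor pc c') →
      ∃ σ ∈ PL, ¬ ParallelOn 1 (letterTensor pc (σ ++ c)) (letterTensor pc (σ ++ c'))) :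
    ((L.flatMap fun c => PL.map fun σ => σ ++ c).foldl (selectStep pc N) []).length = N := by
  classical
  by_contra hne
  obtain ⟨h1, -, h3, h4⟩ := select_spec (pc := pc) N (L.flatMap fun c => PL.map fun σ => σ ++ c)
  set sel := (L.flatMap fun c => PL.map fun σ => σ ++ c).foldl (selectStep pc N) []
  have hline : ∀ (i : Fin L.length) (j : Fin PL.length), ∃ o : Option (Fin sel.length),
      (∀ m, o = some m →
        det2 (letterVec pc (PL.get j ++ L.get i)) (letterVec pc (sel.get m)) = 0) ∧
      (o = none → letterVec pc (PL.get j ++ L.get i) false = 0 ∧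
        letterVec pc (PL.get j ++ L.get i) true = 0) := by
    intro i j
    by_cases hz : letterVec pc (PL.get j ++ L.get i) false = 0 ∧
        letterVec pc (PL.get j ++ L.get i) true = 0
    · exact ⟨none, by simp, fun _ => hz⟩
    · obtain ⟨c', hc', h5⟩ := h4 hne _ (List.mem_flatMap.mpr ⟨L.get i, List.get_mem _ _,
        List.mem_map_of_mem (List.get_mem PL j)⟩) hz
      obtain ⟨m, rfl⟩ := List.mem_iff_get.mp hc'
      refine ⟨some m, fun m' hm' => ?_, by simp⟩
      rw [← Option.some.inj hm']
      exact h5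
  choose φ hφ1 hφ2 using hline
  have hinj : Function.Injective φ := by
    intro i i' hii
    by_contra hne'
    have hnp : ¬ ParallelOn k (letterTensor pc (L.get i)) (letterTensor pc (L.get i')) := by
      rcases lt_or_gt_of_ne hne' with h | h
      · exact List.pairwise_iff_get.mp hL i i' h
      · exact fun hp => List.pairwise_iff_get.mp hL i' i h hp.symm
    obtain ⟨σ, hσ, hnp1⟩ := hsep _ _ hnp
    obtain ⟨j, rfl⟩ := List.mem_iff_get.mp hσ
    apply hnp1
    apply parallelOn_one_of_det2
    have hj := congrFun hii j
    cases hm : φ i j with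
    | none =>
      obtain ⟨h5, h6⟩ := hφ2 i j hm
      rw [det2, h5, h6]
      ring
    | some m =>
      have h5 := hφ1 i j m hm
      have h6 := hφ1 i' j m (hj ▸ hm)
      have h7 := (h3 _ (List.get_mem sel m)).2
      rw [det2] at h5 h6 ⊢
      by_cases h8 : letterVec pc (sel.get m) false = 0
      · have h9 : letterVec pc (sel.get m) true ≠ 0 := fun h9 => h7 ⟨h8, h9⟩
        apply mul_left_cancel₀ h9
        linear_combination letterVec pc (PL.get j ++ L.get i') true * h5 -
          letterVec pc (PL.get j ++ L.get i) true * h6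
      · apply mul_left_cancel₀ h8
        linear_combination letterVec pc (PL.get j ++ L.get i') false * h5 -
          letterVec pc (PL.get j ++ L.get i) false * h6
  have hcard := Fintype.card_le_of_injective φ hinj
  simp only [Fintype.card_fin, Fintype.card_fun, Fintype.card_option] at hcard
  have : (sel.length + 1) ^ PL.length ≤ N ^ PL.length := Nat.pow_le_pow_left (by omega) _
  omega

end Correctness

end Search

/-! ### The search in polynomial time -/

open Tensor

namespace FP

open Data (nil num pair SizeLE ofList ofNat ofBool)

variable {A : Set ℂ} {O : Data → Data → Prop} {α : Type} {n : α → ℕ} {x : α → Data}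
variable {G R : Set Signature} {Λ : Type} {pc : Λ → Piece G R} {code : Λ → Data}
variable {k : ℕ} {SL : List Λ} {PL : List (List Λ)} {s0 : Λ}

theorem ofNat_polyBounded {f : α → ℕ} (hf : PolySize A n fun a => ofNat (f a)) :
    PolyBounded n f := by
  simp only [ofNat_eq] at hf
  simpa using hf.length

theorem growStep (hA : ∀ f ∈ G ∪ R, ∀ b, f.val b ∈ A) (hcode : ∀ s, ∃ N, SizeLE A (code s) N)
    (hSL : ∀ s ∈ SL, k = (pc s).n + (k - (pc s).m)) {L : α → List (List Λ)}
    (hL : FP A O n x fun a => ofList ((L a).map (encWord pc code k))) :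
    FP A O n x fun a => ofList ((_root_.growStep pc k SL (L a)).map (encWord pc code k)) := by
  classical
  have hin := memCtx_input hL.left hL.right
  have hcand : FP A O n x fun a => ofList
      (((L a).flatMap fun c => SL.map fun s => s :: c).map (encWord pc code k)) :=
    flatMap (g := fun _ c => SL.map fun s => s :: c) (e' := fun _ => encWord pc code k) hL
      (constList hin SL fun s hs => consLetter hA hcode s (hSL s hs) (refl hin).snd)
  have hin' := memCtx_input hL.left hcand.right
  have hL' := lift hL hin'
  have hin'' := memCtx_input hin' hL'.right
  have hnew : FP A O n x fun a => ofList ((newWords pc k SL (L a)).map (encWord pc code k)) := by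
    refine filter (g := fun a c' => (L a).all fun c =>
      !decide (ParallelOn k (letterTensor pc c') (letterTensor pc c))) hcand ?_
    refine all (g := fun (p : MemCtx _) c =>
      !decide (ParallelOn k (letterTensor pc p.1.2) (letterTensor pc c))) hL' ?_
    have h := refl (O := O) hin''
    have := parallelOn (t := fun p : MemCtx fun p : MemCtx _ => L p.1.1 =>
        letterTensor pc p.1.1.1.2)
      (t' := fun p : MemCtx fun p : MemCtx _ => L p.1.1 => letterTensor pc p.1.2)
      h.fst.snd.snd h.snd.snd
    convert this.not using 5
  exact append hnew.takeOne hL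

/-- The list of words found in a number of rounds is computable in time polynomial in this
number. -/
theorem growStep_iterate [Finite Λ] (hA : ∀ f ∈ G ∪ R, ∀ b, f.val b ∈ A)
    (hcode : ∀ s, ∃ N, SizeLE A (code s) N)
    (hSL : ∀ s ∈ SL, k = (pc s).n + (k - (pc s).m)) (hsup : SupplyOfWords pc k SL s0)
    {f : α → ℕ} (hf : FP A O n x fun a => ofNat (f a)) :
    FP A O n x fun a => ofList
      (((_root_.growStep pc k SL)^[f a] [[s0]]).map (encWord pc code k)) := by
  have hbd := ofNat_polyBounded hf.right
  simp only [ofNat_eq] at hf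
  have key : ∀ a, (_root_.growStep pc k SL)^[f a] [[s0]] =
      (List.replicate (f a) ()).foldl (fun L _ => _root_.growStep pc k SL L) [[s0]] := by
    intro a
    rw [List.foldl_const, List.length_replicate]
  simp only [key]
  have h0 : PolySize A n fun _ => encWord pc code k [s0] :=
    encWord_polySize hA hcode k (.const 1)
  have h0' : ∃ N, SizeLE A (encWord pc code k [s0]) N := by
    obtain ⟨g, -, hg⟩ := encWord_polySize (α := Unit) (n := fun _ => 0)
        (c := fun _ => [s0]) hA hcode k
      (.const 1)
    exact ⟨_, hg ()⟩
  refine foldl (s0 := fun _ => [[s0]]) (eσ := fun _ L => ofList (L.map (encWord pc code k)))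
    (f := fun _ L _ => _root_.growStep pc k SL L) hf ((const hf.left _ h0').pair (nil hf.left)) ?_
  have hs : PolySize A (fun c : FoldCtx fun a => List.replicate (f a) () => n c.base)
      fun c => ofList
      ((c.pre.foldl (fun L _ => _root_.growStep pc k SL L) [[s0]]).map (encWord pc code k)) := by
    have hpre : ∀ c : FoldCtx fun a => List.replicate (f a) (), c.pre.length ≤ f c.base := by
      intro c
      have := congrArg List.length c.eq
      simp at this
      omega
    have hspec := fun c : FoldCtx fun a => List.replicate (f a) () =>
      _root_.growStep_iterate hsup c.pre.length
    simp only [List.foldl_const]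
    refine PolySize.listOf (e := fun _ => encWord pc code k) (f := fun c => f c.base + 1)
      ((hbd.comp _).add (.const 1)) (fun c => ?_) ?_
    · have := hpre c
      rw [(hspec c).1]
      omega
    · refine encWord_polySize hA hcode k (PolyBounded.mono
        ((hbd.comp fun p : MemCtx fun c : FoldCtx fun a => List.replicate (f a) () =>
        (_root_.growStep pc k SL)^[c.pre.length] [[s0]] => p.1.1.base).add (.const 1)) fun p => ?_)
      have h1 := hpre p.1.1
      have h2 := ((hspec p.1.1).2.2.2 p.1.2 p.2).1
      omega
  have h := refl (O := O) ((hf.left.comp FoldCtx.base).pair ((foldCtx_cur_size hf.right).pair hs))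
  exact growStep hA hcode hSL h.snd.snd

theorem selectStep {N : α → ℕ} {acc : α → List (List Λ)} {c : α → List Λ}
    (hN : FP A O n x fun a => ofNat (N a))
    (hacc : FP A O n x fun a => ofList ((acc a).map (encWord pc code 1)))
    (hc : FP A O n x fun a => encWord pc code 1 (c a)) :
    FP A O n x fun a => ofList
      ((_root_.selectStep pc (N a) (acc a) (c a)).map (encWord pc code 1)) := by
  classical
  have h0 := constNum (O := O) hN.left HasHeight.zero
  have hin := memCtx_input hacc.left hacc.right
  have h := refl (O := O) hin
  have hc' := lift (g := fun p : MemCtx acc => p.1.1) hc hin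
  have hz := constNum (O := O) hin HasHeight.zero
  have hd : FP A O (fun p : MemCtx acc => n p.1.1)
      (fun p => Data.pair (x p.1.1) (encWord pc code 1 p.1.2))
      fun p => ofBool !decide (det2 (letterVec pc (c p.1.1)) (letterVec pc p.1.2) = 0) :=
    not (numEq (sub (mul (letterValue hc' false) (letterValue h.snd true))
      (mul (letterValue hc' true) (letterValue h.snd false))) hz)
  have hdet := all (g := fun a c' => !decide (det2 (letterVec pc (c a)) (letterVec pc c') = 0)) hacc
    hd
  have hb := and (not (eq hacc.length hN))
    (and (not (and (numEq (letterValue hc false) h0) (numEq (letterValue hc true) h0))) hdet)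
  have := ite (y := fun a => ofList ((c a :: acc a).map (encWord pc code 1)))
    (z := fun a => ofList ((acc a).map (encWord pc code 1)))
    (b := fun a => _ = true) (hb := by simpa only [Bool.decide_eq_true] using hb)
    (hc.pair hacc) hacc
  convert this using 2 with a
  rw [← apply_ite (fun L => ofList (List.map (encWord pc code 1) L))]
  rfl

theorem select {N : α → ℕ} {C : α → List (List Λ)} (hN : FP A O n x fun a => ofNat (N a))
    (hC : FP A O n x fun a => ofList ((C a).map (encWord pc code 1))) :
    FP A O n x fun a => ofList
      (((C a).foldl (_root_.selectStep pc (N a)) []).map (encWord pc code 1)) := by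
  refine foldl (s0 := fun _ => []) (eσ := fun _ L => ofList (L.map (encWord pc code 1)))
    (f := fun a => _root_.selectStep pc (N a)) hC (nil hC.left) ?_
  have hs : PolySize A (fun c : FoldCtx C => n c.base) fun c => ofList
      ((c.pre.foldl (_root_.selectStep pc (N c.base)) []).map (encWord pc code 1)) := by
    refine PolySize.listOf (e := fun _ => encWord pc code 1) (f := fun c => N c.base)
      ((ofNat_polyBounded hN.right).comp _) (fun c => (select_spec _ _).1) ?_
    exact hC.right.mem.comp fun p : MemCtx fun c : FoldCtx C =>
        c.pre.foldl (_root_.selectStep pc (N c.base)) [] =>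
      (⟨(p.1.1.base, p.1.2), by
        have := ((select_spec _ _).2.2.1 _ p.2).1
        rw [p.1.1.eq]
        exact List.mem_append_left _ this⟩ : MemCtx C)
  have hin := (hC.left.comp FoldCtx.base).pair ((foldCtx_cur_size hC.right).pair hs)
  have h := refl (O := O) hin
  exact selectStep (lift hN hin) h.snd.snd h.snd.fst

/-- Words extended by enough gadgets with one leading and two trailing edges have unary tensors. -/
theorem reduceWord (hA : ∀ f ∈ G ∪ R, ∀ b, f.val b ∈ A) (hcode : ∀ s, ∃ N, SizeLE A (code s) N)
    (σ : List Λ) (hσ : ∀ s ∈ σ, (pc s).m = 1 ∧ (pc s).n = 2) {c : α → List Λ}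
    (hc : FP A O n x fun a => encWord pc code (1 + σ.length) (c a)) :
    FP A O n x fun a => encWord pc code 1 (σ ++ c a) := by
  have key : ∀ (σ : List Λ) (j : ℕ), (∀ s ∈ σ, (pc s).m = 1 ∧ (pc s).n = 2) →
      (FP A O n x fun a => encWord pc code (1 + j + σ.length) (c a)) →
      FP A O n x fun a => encWord pc code (1 + j) (σ ++ c a) := by
    intro σ
    induction σ with
    | nil => exact fun j _ h => h
    | cons s σ ih =>
      intro j hσ h
      obtain ⟨h1, h2⟩ := hσ s (by simp)
      refine consLetter hA hcode s (k := 1 + (j + 1)) (by omega)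
        (ih (j + 1) (fun s hs => hσ s (by simp [hs])) ?_)
      have e : 1 + j + (s :: σ).length = 1 + (j + 1) + σ.length := by
        simp only [List.length_cons]; omega
      rwa [e] at h
  exact key σ 0 hσ hc

/-- The points of the interpolation are computable in polynomial time. -/
theorem selectWords [Finite Λ] (hA : ∀ f ∈ G ∪ R, ∀ b, f.val b ∈ A)
    (hcode : ∀ s, ∃ N, SizeLE A (code s) N)
    (hSL : ∀ s ∈ SL, k = (pc s).n + (k - (pc s).m)) (hsup : SupplyOfWords pc k SL s0)
    (hPL : ∀ σ ∈ PL, (∀ s ∈ σ, (pc s).m = 1 ∧ (pc s).n = 2) ∧ k = 1 + σ.length)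
    {N : α → ℕ} (hN : FP A O n x fun a => ofNat (N a)) :
    FP A O n x fun a => ofList ((List.foldl (_root_.selectStep pc (N a)) []
      (((_root_.growStep pc k SL)^[N a ^ PL.length] [[s0]]).flatMap fun c =>
        PL.map fun σ => σ ++ c)).map (encWord pc code 1)) := by
  refine select hN ?_
  have hL := growStep_iterate hA hcode hSL hsup (natPow hN PL.length)
  have hin := memCtx_input hL.left hL.right
  refine flatMap (g := fun _ c => PL.map fun σ => σ ++ c) (e' := fun _ => encWord pc code 1) hL
    (constList hin PL fun σ hσ => ?_)
  obtain ⟨h1, h2⟩ := hPL σ hσ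
  refine reduceWord hA hcode σ h1 ?_
  rw [← h2]
  exact (refl hin).snd

end FP

/-! ### Building a grid in polynomial time -/

namespace OpenGrid

open Data (nil num pair SizeLE ofList ofNat ofBool)

variable {A : Set ℂ} {O : Data → Data → Prop} {α : Type} {n : α → ℕ} {x : α → Data}
variable {G R : Set Signature} {F : Set Signature}

/-- The encoding of an open grid. -/
def enc (st : OpenGrid) : Data :=
  pair (ofList (st.gens.map LabelledVertex.enc)) (pair (ofList (st.recs.map LabelledVertex.enc))
    (pair (ofNat st.fresh) (ofList (st.bd.map ofNat))))

/-- The labels of the open grid belong to `F`, and all numbers in its description are at most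
`N`. -/
structure BoundedBy (F : Set Signature) (N : ℕ) (st : OpenGrid) : Prop where
  gens_length : st.gens.length ≤ N
  recs_length : st.recs.length ≤ N
  fresh_le : st.fresh ≤ N
  bd_length : st.bd.length ≤ N
  gens_le : ∀ v ∈ st.gens, v.1 ∈ F ∧ ∀ e ∈ v.edges, e ≤ N
  recs_le : ∀ v ∈ st.recs, v.1 ∈ F ∧ ∀ e ∈ v.edges, e ≤ N
  bd_le : ∀ e ∈ st.bd, e ≤ N

theorem BoundedBy.mono {N N' : ℕ} {st : OpenGrid} (h : st.BoundedBy F N) (hN : N ≤ N') :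
    st.BoundedBy F N' where
  gens_length := h.gens_length.trans hN
  recs_length := h.recs_length.trans hN
  fresh_le := h.fresh_le.trans hN
  bd_length := h.bd_length.trans hN
  gens_le v hv := ⟨(h.gens_le v hv).1, fun e he => ((h.gens_le v hv).2 e he).trans hN⟩
  recs_le v hv := ⟨(h.recs_le v hv).1, fun e he => ((h.recs_le v hv).2 e he).trans hN⟩
  bd_le e he := (h.bd_le e he).trans hN

/-- The growth of an open grid when a gadget is attached. -/
def growth (p : Piece G R) : ℕ := p.gadget.numGen + p.gadget.numRec + p.gadget.numEdge + p.n

theorem BoundedBy.attach {N : ℕ} {st : OpenGrid} (h : st.BoundedBy (G ∪ R) N) (p : Piece G R) :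
    (attach p.gadget st).BoundedBy (G ∪ R) (N + growth p) := by
  have h' := h.mono (Nat.le_add_right N (growth p))
  have h1 := h.gens_length
  have h2 := h.recs_length
  have h3 := h.fresh_le
  have h4 := h.bd_length
  have hbd : ∀ i, st.bd.getD i 0 ≤ N := by
    intro i
    rw [List.getD_eq_getElem?_getD]
    by_cases hi : i < st.bd.length
    · rw [List.getElem?_eq_getElem hi]
      exact h.bd_le _ (List.getElem_mem hi)
    · rw [List.getElem?_eq_none (by omega)]
      exact Nat.zero_le _
  unfold growth at h' ⊢
  refine ⟨?_, ?_, ?_, ?_, ?_, ?_, ?_⟩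
  · simp only [OpenGrid.attach, List.length_append, List.length_ofFn]; omega
  · simp only [OpenGrid.attach, List.length_append, List.length_ofFn]; omega
  · simp only [OpenGrid.attach]; omega
  · simp only [OpenGrid.attach, List.length_append, List.length_ofFn, List.length_drop]; omega
  · intro v hv
    rcases List.mem_append.mp hv with hv | hv
    · obtain ⟨u, rfl⟩ := (List.mem_ofFn' _ _).mp hv
      refine ⟨.inl (p.gadget.genSig_mem u), fun e he => ?_⟩
      obtain ⟨i, rfl⟩ := (List.mem_ofFn' _ _).mp he
      dsimp only [genLabel]
      rcases p.gadget.genEdge ⟨u, i⟩ with j | j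
      · have := j.2; simp only [Sum.elim_inl]; omega
      · have := hbd j; simp only [Sum.elim_inr]; omega
    · exact h'.gens_le v hv
  · intro v hv
    rcases List.mem_append.mp hv with hv | hv
    · obtain ⟨u, rfl⟩ := (List.mem_ofFn' _ _).mp hv
      refine ⟨.inr (p.gadget.recSig_mem u), fun e he => ?_⟩
      obtain ⟨i, rfl⟩ := (List.mem_ofFn' _ _).mp he
      dsimp only [recLabel]
      rcases p.gadget.recEdge ⟨u, i⟩ with j | j
      · have := j.2; simp only [Sum.elim_inl]; omega
      · have := j.2; simp only [Sum.elim_inr]; omega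
    · exact h'.recs_le v hv
  · intro e he
    rcases List.mem_append.mp he with he | he
    · obtain ⟨j, rfl⟩ := (List.mem_ofFn' _ _).mp he
      have := j.2
      dsimp only
      omega
    · exact h'.bd_le e (List.mem_of_mem_drop he)

theorem BoundedBy.attachList {N C : ℕ} {st : OpenGrid} (h : st.BoundedBy (G ∪ R) N)
    {c : List (Piece G R)} (hC : ∀ p ∈ c, growth p ≤ C) :
    (Piece.attachList c st).BoundedBy (G ∪ R) (N + c.length * C) := by
  induction c generalizing N st with
  | nil => exact h.mono (Nat.le_add_right _ _)
  | cons p c ih =>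
    refine (ih (h.attach p) fun q hq => hC q (by simp [hq])).mono ?_
    have := hC p (by simp)
    rw [List.length_cons, Nat.succ_mul]
    omega

/-- The tables of finitely many signatures have bounded size. -/
theorem exists_table_bound (hF : F.Finite) (hA : ∀ f ∈ F, ∀ b, f.val b ∈ A) :
    ∃ K, ∀ f ∈ F, SizeLE A (Data.ofTable f.arity f.val) K ∧ f.arity ≤ K := by
  obtain ⟨K, hK⟩ := (hF.image fun f : Signature => f.arity).bddAbove
  have hK' : ∀ f ∈ F, f.arity ≤ K := fun f hf => hK ⟨f, hf, rfl⟩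
  refine ⟨2 ^ K * 3 + K, fun f hf => ⟨?_, (hK' f hf).trans (Nat.le_add_left _ _)⟩⟩
  refine (SizeLE.ofTable (N := 1) fun b =>
    (HasIntHeight.of_mem (hA f hf b)).hasHeight le_rfl (by norm_num)).mono ?_
  have := Nat.pow_le_pow_right (n := 2) (by norm_num) (hK' f hf)
  omega

theorem vertices_polySize (hF : F.Finite) (hA : ∀ f ∈ F, ∀ b, f.val b ∈ A)
    {l : α → List LabelledVertex} {N : α → ℕ} (hN : PolyBounded n N)
    (hlen : ∀ a, (l a).length ≤ N a) (h : ∀ a, ∀ v ∈ l a, v.1 ∈ F ∧ ∀ e ∈ v.edges, e ≤ N a) :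
    PolySize A n fun a => ofList ((l a).map LabelledVertex.enc) := by
  obtain ⟨K, hK⟩ := exists_table_bound hF hA
  refine PolySize.listOf (e := fun _ => LabelledVertex.enc) hN hlen ?_
  refine PolySize.pair (PolySize.of_le (fun c => (hK _ (h _ _ c.2).1).1) (.const K)) ?_
  refine PolySize.listOf (e := fun _ => ofNat) (l := fun c : MemCtx l => c.1.2.edges)
    (f := fun _ => K) (.const K) (fun c => ?_) ?_
  · simpa [LabelledVertex.edges] using (hK _ (h _ _ c.2).1).2
  · exact PolySize.ofNat ((hN.comp fun c : MemCtx fun c : MemCtx l => c.1.2.edges =>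
      c.1.1.1.1).mono fun c => (h _ _ c.1.1.2).2 _ c.2)

theorem enc_polySize (hF : F.Finite) (hA : ∀ f ∈ F, ∀ b, f.val b ∈ A) {st : α → OpenGrid}
    {N : α → ℕ} (hN : PolyBounded n N) (h : ∀ a, (st a).BoundedBy F (N a)) :
    PolySize A n fun a => (st a).enc := by
  refine (vertices_polySize hF hA hN (fun a => (h a).gens_length) fun a => (h a).gens_le).pair
    ((vertices_polySize hF hA hN (fun a => (h a).recs_length) fun a => (h a).recs_le).pair
    ((PolySize.ofNat (hN.mono fun a => (h a).fresh_le)).pair ?_))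
  refine PolySize.listOf (e := fun _ => ofNat) hN (fun a => (h a).bd_length) ?_
  exact PolySize.ofNat ((hN.comp fun c : MemCtx fun a => (st a).bd => c.1.1).mono
    fun c => (h _).bd_le _ c.2)

theorem vertex_fp {f : Signature} (hf : ∀ b, f.val b ∈ A) {lab : α → Fin f.arity → ℕ}
    (hx : PolySize A n x) (h : ∀ i, FP A O n x fun a => ofNat (lab a i)) :
    FP A O n x fun a => LabelledVertex.enc ⟨f, lab a⟩ :=
  (FP.const hx _ ⟨_, SizeLE.ofTable (N := 1) fun b =>
    (HasIntHeight.of_mem (hf b)).hasHeight le_rfl (by norm_num)⟩).pair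
    (FP.ofFn (f := lab) (e := fun _ => ofNat) hx h)

/-- Attaching a fixed gadget is computable in polynomial time. Open edges are read off the list by
`fst` and `snd`, which return `nil`, the code of `0`, beyond the end of the list. -/
theorem attach_fp (hA : ∀ f ∈ G ∪ R, ∀ b, f.val b ∈ A) {m k : ℕ} (Γ : Gadget G R m k)
    {st : α → OpenGrid} (h : FP A O n x fun a => (st a).enc) :
    FP A O n x fun a => (attach Γ (st a)).enc := by
  have hg := h.fst
  have hr := h.snd.fst
  have hf := h.snd.snd.fst
  have hb : FP A O n x fun a => ofList ((st a).bd.map ofNat) := h.snd.snd.snd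
  have hget : ∀ j, FP A O n x fun a => ofNat ((st a).bd.getD j 0) := by
    intro j
    convert (hb.drop j).fst' using 2 with a
    by_cases hj : j < (st a).bd.length
    · rw [List.drop_eq_getElem_cons hj, List.getD_eq_getElem _ _ hj]; rfl
    · rw [List.drop_eq_nil_of_le (by omega), List.getD_eq_default _ _ (by omega)]; rfl
  refine FP.pair ?_ (FP.pair ?_ (FP.pair ?_ ?_))
  · refine FP.append (e := fun _ => LabelledVertex.enc) ?_ hg
    refine FP.ofFn (e := fun _ => LabelledVertex.enc) h.left fun u => ?_
    refine vertex_fp (hA _ (.inl (Γ.genSig_mem u))) h.left fun i => ?_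
    unfold genLabel
    rcases Γ.genEdge ⟨u, i⟩ with j | j
    · exact hf.natAdd j
    · exact hget j
  · refine FP.append (e := fun _ => LabelledVertex.enc) ?_ hr
    refine FP.ofFn (e := fun _ => LabelledVertex.enc) h.left fun u => ?_
    refine vertex_fp (hA _ (.inr (Γ.recSig_mem u))) h.left fun i => ?_
    unfold recLabel
    rcases Γ.recEdge ⟨u, i⟩ with j | j
    · exact hf.natAdd j
    · exact (hf.natAdd Γ.numEdge).natAdd j
  · exact (hf.natAdd Γ.numEdge).natAdd k
  · refine FP.append (e := fun _ => ofNat) ?_ (hb.drop m)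
    exact FP.ofFn (e := fun _ => ofNat) h.left fun j => (hf.natAdd Γ.numEdge).natAdd j

variable {Λ : Type} {pc : Λ → Piece G R} {code : Λ → Data}

/-- A word of gadgets, given by the list of its letters, can be attached in polynomial time. -/
theorem attachList_fp [Finite Λ] (hF : (G ∪ R).Finite) (hA : ∀ f ∈ G ∪ R, ∀ b, f.val b ∈ A)
    (hcode : Function.Injective code) {st : α → OpenGrid} {N : α → ℕ} (hN : PolyBounded n N)
    (hst : ∀ a, (st a).BoundedBy (G ∪ R) (N a)) (h : FP A O n x fun a => (st a).enc)
    {c : α → List Λ} (hc : FP A O n x fun a => ofList ((c a).map code)) :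
    FP A O n x fun a => (Piece.attachList ((c a).map pc) (st a)).enc := by
  simp only [Piece.attachList, List.foldl_map]
  refine FP.foldl (eσ := fun _ => enc) (f := fun _ st s => attach (pc s).gadget st) hc h ?_
  obtain ⟨C, hC⟩ := (Set.finite_range fun s => growth (pc s)).bddAbove
  have hs : PolySize A (fun c' : FoldCtx c => n c'.base) fun c' =>
      (c'.pre.foldl (fun st s => attach (pc s).gadget st) (st c'.base)).enc := by
    refine enc_polySize hF hA (N := fun c' => N c'.base + (c c'.base).length * C)
      ((hN.comp _).add ((hc.right.length.comp _).mul (.const C))) fun c' => ?_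
    have := ((hst c'.base).attachList (c := c'.pre.map pc) (C := C) fun p hp => by
      obtain ⟨s, -, rfl⟩ := List.mem_map.mp hp
      exact hC ⟨s, rfl⟩)
    rw [Piece.attachList, List.foldl_map] at this
    refine this.mono (Nat.add_le_add_left (Nat.mul_le_mul_right _ ?_) _)
    simp [c'.eq]
  have h1 := FP.refl (O := O)
    ((hc.left.comp FoldCtx.base).pair ((FP.foldCtx_cur_size hc.right).pair hs))
  refine FP.finiteCases hcode h1.snd.fst fun s => ?_
  have h2 := attach_fp hA (pc s).gadget
    (h1.snd.snd.comp (Subtype.val : {c' : FoldCtx c // c'.cur = s} → FoldCtx c))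
  convert h2 using 2 with c'
  rw [c'.2]

theorem encGrid_fp {st : α → OpenGrid} (h : FP A O n x fun a => (st a).enc) :
    FP A O n x fun a => (st a).encGrid :=
  h.fst.pair h.snd.fst

/-- The values of those valid open grids that have no open edge are obtained from the oracle. -/
theorem oracle_fp (hA : ∀ f ∈ G ∪ R, ∀ b, f.val b ∈ A) {st : α → OpenGrid}
    (hst : ∀ a, (st a).Valid G R ∧ (st a).bd = [])
    (h : FP A (holantProblem G R).oracle n x fun a => (st a).enc) :
    FP A (holantProblem G R).oracle n x fun a => num ((st a).value fun _ => 1) := by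
  refine (encGrid_fp h).trans ?_
  have h0 := (encGrid_fp h).right
  obtain ⟨f, hf, hf'⟩ := h0
  have h1 : PolyBounded n fun a => (st a).gens.length + (st a).recs.length + (st a).fresh :=
    ((PolySize.length (e := fun _ => LabelledVertex.enc) h.right.fst).add
      (PolySize.length (e := fun _ => LabelledVertex.enc) h.right.snd.fst)).add
      (FP.ofNat_polyBounded h.right.snd.snd.fst)
  refine ⟨.oracle, _, (hf.add (h1.add (.const 1))).add (.const 1), fun a => ?_⟩
  obtain ⟨M, hM, hM'⟩ := hf' a
  obtain ⟨K, hK, hK'⟩ := SizeLE.num (value_hasHeight hA (hst a).1)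
  obtain ⟨Ω, hΩ, hΩ'⟩ := (hst a).1.exists_grid (hst a).2
  exact ⟨_, by omega, .oracle ⟨Ω, hΩ.symm, congrArg num hΩ'.symm⟩ hM' hK'⟩

end OpenGrid

/-! ### Reading the given grid -/

/-- A signature is determined by the table of its values. -/
theorem Data.ofTable_injective {k l : ℕ} {f : (Fin k → Bool) → ℂ} {g : (Fin l → Bool) → ℂ}
    (h : Data.ofTable k f = Data.ofTable l g) : (⟨k, f⟩ : Signature) = ⟨l, g⟩ := by
  induction k generalizing l with
  | zero =>
    cases l with
    | zero =>
      have h' : f Fin.elim0 = g Fin.elim0 := by injection h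
      congr 1
      funext x
      rwa [Subsingleton.elim x Fin.elim0]
    | succ l => cases h
  | succ k ih =>
    cases l with
    | zero => cases h
    | succ l =>
      injection h with h1 h2
      have e1 := ih h1
      have e2 := ih h2
      injection e1 with e1 e1'
      subst e1
      injection e2 with _ e2'
      have e1' := eq_of_heq e1'
      congr 1
      funext x
      rw [← Fin.cons_self_tail x]
      cases x 0
      · exact congrFun e1' _
      · exact congrFun e2' _

namespace OpenGrid

open Data (nil num pair SizeLE ofList ofNat ofBool)

variable {A : Set ℂ} {O : Data → Data → Prop} {G R : Set Signature} {X Y : ℂ}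

theorem encode_polySize (hG : G.Finite) (hR : R.Finite) (hA : ∀ f ∈ G ∪ R, ∀ b, f.val b ∈ A) :
    PolySize A SignatureGrid.size fun Ω : SignatureGrid G R => Ω.encode := by
  have hN : PolyBounded (SignatureGrid.size (G := G) (R := R)) SignatureGrid.size :=
    .self
  simp only [encode_eq]
  refine (vertices_polySize (hG.union hR) hA hN (fun Ω => ?_) fun Ω v hv =>
      ⟨?_, fun e he => ?_⟩).pair
    (vertices_polySize (hG.union hR) hA hN (fun Ω => ?_) fun Ω v hv => ⟨?_, fun e he => ?_⟩)
  · simp [genVertices, SignatureGrid.size]; omega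
  · obtain ⟨u, rfl⟩ := (List.mem_ofFn' _ _).mp hv
    exact .inl (Ω.genSig_mem u)
  · have := (genVertices_edges Ω).mem_iff.mp (List.mem_flatMap.mpr ⟨v, hv, he⟩)
    rw [List.mem_range] at this
    unfold SignatureGrid.size
    omega
  · simp [recVertices, SignatureGrid.size]; omega
  · obtain ⟨u, rfl⟩ := (List.mem_ofFn' _ _).mp hv
    exact .inr (Ω.recSig_mem u)
  · have := (recVertices_edges Ω).mem_iff.mp (List.mem_flatMap.mpr ⟨v, hv, he⟩)
    rw [List.mem_range] at this
    unfold SignatureGrid.size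
    omega

theorem ofGrid_boundedBy (Ω : SignatureGrid (G ∪ {Signature.unary X Y}) R) :
    (ofGrid X Y Ω).BoundedBy (G ∪ R) Ω.size := by
  classical
  have h := ofGrid_valid X Y Ω
  have hf : (ofGrid X Y Ω).fresh ≤ Ω.size := by
    simp only [ofGrid, SignatureGrid.size]; omega
  have hb := h.gen_edges.length_eq
  rw [List.length_append, List.length_range] at hb
  refine ⟨?_, ?_, hf, by omega, fun v hv => ⟨.inl (h.gen_mem v hv), fun e he => ?_⟩,
    fun v hv => ⟨.inr (h.rec_mem v hv), fun e he => ?_⟩, fun e he => ?_⟩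
  · refine (List.length_filter_le _ _).trans ?_
    simp [genVertices, SignatureGrid.size]; omega
  · simp [ofGrid, recVertices, SignatureGrid.size]; omega
  · exact (h.gen_lt hv he).le.trans hf
  · exact (h.rec_lt hv he).le.trans hf
  · exact (h.bd_lt he).le.trans hf

/-- The vertices labelled with `(X, Y)` are recognized by comparing tables, and the number of edges
is found by counting the ends of edges at recognizers. -/
theorem ofGrid_fp (hG : G.Finite) (hR : R.Finite)
    (hA : ∀ f ∈ (G ∪ {Signature.unary X Y}) ∪ R, ∀ b, f.val b ∈ A) :
    FP A O SignatureGrid.size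
      (fun Ω : SignatureGrid (G ∪ {Signature.unary X Y}) R => Ω.encode)
      fun Ω => (ofGrid X Y Ω).enc := by
  classical
  have hx := encode_polySize (hG.union (Set.finite_singleton _)) hR hA
  have h := FP.refl (O := O) hx
  have hg : FP A O SignatureGrid.size
      (fun Ω : SignatureGrid (G ∪ {Signature.unary X Y}) R => Ω.encode)
      fun Ω => ofList ((genVertices Ω).map LabelledVertex.enc) := by
    refine FP.fst (z := fun Ω => ofList ((recVertices Ω).map LabelledVertex.enc)) ?_
    simpa only [← encode_eq] using h
  have hr : FP A O SignatureGrid.size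
      (fun Ω : SignatureGrid (G ∪ {Signature.unary X Y}) R => Ω.encode)
      fun Ω => ofList ((recVertices Ω).map LabelledVertex.enc) := by
    refine FP.snd (y := fun Ω => ofList ((genVertices Ω).map LabelledVertex.enc)) ?_
    simpa only [← encode_eq] using h
  have hedges : ∀ l : SignatureGrid (G ∪ {Signature.unary X Y}) R → List LabelledVertex,
      (FP A O SignatureGrid.size (fun Ω => Ω.encode)
        fun Ω => ofList ((l Ω).map LabelledVertex.enc)) →
      FP A O SignatureGrid.size (fun Ω => Ω.encode)
        fun Ω => ofList (((l Ω).flatMap LabelledVertex.edges).map ofNat) := fun l hl =>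
    FP.flatMap (e := fun _ => LabelledVertex.enc) (g := fun _ => LabelledVertex.edges)
      (e' := fun _ => ofNat) hl (FP.refl (FP.memCtx_input hl.left hl.right)).snd.snd
  have htest : FP A O (fun c : MemCtx (genVertices (G := G ∪ {Signature.unary X Y}) (R := R)) =>
      SignatureGrid.size c.1.1) (fun c => pair c.1.1.encode (LabelledVertex.enc c.1.2))
      fun c => ofBool (decide (c.1.2.1 = Signature.unary X Y)) := by
    have hin := FP.memCtx_input (e := fun _ => LabelledVertex.enc) hg.left hg.right
    have h1 := FP.eq (FP.refl (O := O) hin).snd.fst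
      (FP.const hin (Data.ofTable 1 (Signature.unary X Y).val) ⟨_, SizeLE.ofTable (N := 1) fun b =>
        (HasIntHeight.of_mem (hA (Signature.unary X Y) (by simp) b)).hasHeight
          le_rfl (by norm_num)⟩)
    convert h1 using 4 with c
    constructor
    · intro h
      rw [h]
      rfl
    · exact fun h => Data.ofTable_injective h
  refine FP.pair ?_ (FP.pair hr (FP.pair ?_ ?_))
  · exact FP.filter (e := fun _ => LabelledVertex.enc)
      (g := fun _ v => !decide (v.1 = Signature.unary X Y)) hg htest.not
  · convert (FP.length (e := fun _ => ofNat) (hedges _ hr)) using 3 with Ω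
    rw [(recVertices_edges Ω).length_eq, List.length_range]
    rfl
  · exact hedges _ (FP.filter (e := fun _ => LabelledVertex.enc)
      (g := fun _ v => decide (v.1 = Signature.unary X Y)) hg htest)

end OpenGrid

/-! ### Interpolation with the oracle -/

section Interpolation

open Data (nil num pair SizeLE ofList ofNat ofBool)
open OpenGrid

variable {A : Set ℂ} {α : Type} {n : α → ℕ} {x : α → Data}
variable {G R : Set Signature} {Λ : Type} {pc : Λ → Piece G R} {code : Λ → Data}

theorem OpenGrid.value_sum {ι : Type*} [Fintype ι] (st : OpenGrid) (z : ι → ℂ) (t : ι → Tensor) :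
    (st.value fun l => ∑ i, z i * t i l) = ∑ i, z i * st.value (t i) := by
  simp only [value, Finset.mul_sum]
  rw [Finset.sum_comm]
  exact Finset.sum_congr rfl fun i _ => Finset.sum_congr rfl fun ξ _ => by ring

/-- The value of an open grid closed by copies of a unary tensor `w` is a combination of the values
of the grids in which the open edges are closed by copies of one of sufficiently many unary
words. -/
theorem value_eq_interpolation {st : OpenGrid} (hst : st.Valid G R) {sel : List (List Λ)}
    (hfit : ∀ c ∈ sel, Piece.Fits (c.map pc) 1)
    (hpw : sel.Pairwise fun c c' => det2 (letterVec pc c) (letterVec pc c') ≠ 0)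
    (hlen : sel.length = st.bd.length + 1) (w : Bool → ℂ) :
    (st.value fun l => (l.map w).prod) = (sel.map fun c =>
      (sel.map fun c' => lagrangeFactor w (letterVec pc c) (letterVec pc c')).prod *
        (Piece.attachList ((st.bd.flatMap fun _ => c).map pc) st).value fun _ => 1).sum := by
  let u : Fin (st.bd.length + 1) → List Λ := fun i => sel.get (Fin.cast hlen.symm i)
  have hsel : sel = List.ofFn u := by
    refine List.ext_getElem (by rw [hlen, List.length_ofFn]) fun i _ _ => ?_
    rw [List.getElem_ofFn]
    rfl
  have hu : ∀ i j, i ≠ j → det2 (letterVec pc (u i)) (letterVec pc (u j)) ≠ 0 := by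
    intro i j hij
    rcases lt_or_gt_of_ne hij with h | h
    · exact List.pairwise_iff_get.mp hpw _ _ h
    · have := List.pairwise_iff_get.mp hpw (Fin.cast hlen.symm j) (Fin.cast hlen.symm i) h
      intro h0
      apply this
      rw [det2] at h0 ⊢
      linear_combination -h0
  have h1 : (st.value fun l => (l.map w).prod) = st.value fun l => ∑ i,
      (∏ j, lagrangeFactor w (letterVec pc (u i)) (letterVec pc (u j))) *
        (l.map (letterVec pc (u i))).prod :=
    Piece.value_congr fun l hl => (lagrange_interpolation _ hu w l hl).symm
  rw [h1, value_sum, hsel, List.map_ofFn, List.sum_ofFn]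
  refine Finset.sum_congr rfl fun i _ => ?_
  simp only [Function.comp_def, List.map_ofFn, List.prod_ofFn]
  congr 1
  have h2 : ((st.bd.flatMap fun _ => u i).map pc) =
      (List.replicate st.bd.length ((u i).map pc)).flatten := by
    rw [List.map_flatMap, List.flatMap_def, List.map_const']
  rw [h2]
  exact (Piece.attachList_replicate (hfit _ (List.get_mem _ _)) _ hst rfl).2.2.symm

theorem FP.lagrangeFactor {O : Data → Data → Prop} {w : Bool → ℂ}
    (hw : ∀ b, ∃ N, HasHeight A (w b) N)
    {c c' : α → List Λ} (hc : FP A O n x fun a => encWord pc code 1 (c a))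
    (hc' : FP A O n x fun a => encWord pc code 1 (c' a)) :
    FP A O n x fun a =>
      num (_root_.lagrangeFactor w (letterVec pc (c a)) (letterVec pc (c' a))) := by
  classical
  have hw' : ∀ b, FP A O n x fun _ => num (w b) := fun b =>
    FP.constNum hc.left (hw b).choose_spec
  have hdet : FP A O n x fun a => num (det2 (letterVec pc (c a)) (letterVec pc (c' a))) :=
    FP.sub (FP.mul (letterValue hc false) (letterValue hc' true))
      (FP.mul (letterValue hc true) (letterValue hc' false))
  have hdet' : FP A O n x fun a => num (det2 w (letterVec pc (c' a))) :=
    FP.sub (FP.mul (hw' false) (letterValue hc' true)) (FP.mul (hw' true) (letterValue hc' false))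
  have h := FP.ite (b := fun a => det2 (letterVec pc (c a)) (letterVec pc (c' a)) = 0)
    (FP.numEq hdet (FP.constNum hc.left HasHeight.zero)) (FP.constNum hc.left HasHeight.one)
    (FP.div hdet' hdet)
  convert h using 2 with a
  rw [_root_.lagrangeFactor, apply_ite num]

/-- The interpolation is carried out in polynomial time. -/
theorem FP.interpolation [Finite Λ] (hF : (G ∪ R).Finite) (hA : ∀ f ∈ G ∪ R, ∀ b, f.val b ∈ A)
    (hcode : Function.Injective code) {w : Bool → ℂ} (hw : ∀ b, ∃ N, HasHeight A (w b) N)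
    {st : α → OpenGrid} (hst : ∀ a, (st a).Valid G R) {N : α → ℕ} (hN : PolyBounded n N)
    (hbd : ∀ a, (st a).BoundedBy (G ∪ R) (N a))
    (h : FP A (holantProblem G R).oracle n x fun a => (st a).enc) {sel : α → List (List Λ)}
    (hfit : ∀ a, ∀ c ∈ sel a, Piece.Fits (c.map pc) 1)
    (hpw : ∀ a, (sel a).Pairwise fun c c' => det2 (letterVec pc c) (letterVec pc c') ≠ 0)
    (hlen : ∀ a, (sel a).length = (st a).bd.length + 1)
    (hsel : FP A (holantProblem G R).oracle n x
      fun a => ofList ((sel a).map (encWord pc code 1))) :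
    FP A (holantProblem G R).oracle n x
      fun a => num ((st a).value fun l => (l.map w).prod) := by
  simp only [fun a => value_eq_interpolation (hst a) (hfit a) (hpw a) (hlen a) w]
  have hin := memCtx_input (e := fun _ => encWord pc code 1) hsel.left hsel.right
  have hc := (refl (O := (holantProblem G R).oracle) hin).snd
  refine sum (e := fun _ => encWord pc code 1) (g := fun a c =>
      ((sel a).map fun c' => _root_.lagrangeFactor w (letterVec pc c) (letterVec pc c')).prod *
        (Piece.attachList (((st a).bd.flatMap fun _ => c).map pc) (st a)).value fun _ => 1)
    hsel (mul ?_ ?_)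
  · have hsel' : FP A (holantProblem G R).oracle (fun p : MemCtx sel => n p.1.1)
        (fun p => Data.pair (x p.1.1) (encWord pc code 1 p.1.2))
        fun p => ofList ((sel p.1.1).map (encWord pc code 1)) :=
      lift (g := fun p : MemCtx sel => p.1.1) hsel hin
    have hin' := memCtx_input (e := fun _ => encWord pc code 1) hin hsel'.right
    have h' := refl (O := (holantProblem G R).oracle) hin'
    exact prod (l := fun p : MemCtx sel => sel p.1.1) (e := fun _ => encWord pc code 1)
      (g := fun p c' => _root_.lagrangeFactor w (letterVec pc p.1.2) (letterVec pc c'))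
      hsel' (FP.lagrangeFactor (c := fun q : MemCtx fun p : MemCtx sel => sel p.1.1 => q.1.1.1.2)
        (c' := fun q : MemCtx fun p : MemCtx sel => sel p.1.1 => q.1.2) hw h'.fst.snd h'.snd)
  · have hst' : FP A (holantProblem G R).oracle (fun p : MemCtx sel => n p.1.1)
        (fun p => Data.pair (x p.1.1) (encWord pc code 1 p.1.2)) fun p => (st p.1.1).enc :=
      lift (g := fun p : MemCtx sel => p.1.1) h hin
    have hbd' : FP A (holantProblem G R).oracle (fun p : MemCtx sel => n p.1.1)
        (fun p => Data.pair (x p.1.1) (encWord pc code 1 p.1.2))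
        fun p => ofList ((st p.1.1).bd.map ofNat) := hst'.snd.snd.snd
    have hword := flatMap (l := fun p : MemCtx sel => (st p.1.1).bd) (e := fun _ => ofNat)
      (g := fun p _ => p.1.2) (e' := fun _ => code) hbd'
      (lift (g := fun q : MemCtx fun p : MemCtx sel => (st p.1.1).bd => q.1.1) hc.fst
        (memCtx_input (e := fun _ => ofNat) hin hbd'.right))
    refine oracle_fp hA (fun p => ?_)
      (attachList_fp hF hA hcode (hN.comp fun p : MemCtx sel => p.1.1) (fun p => hbd _) hst' hword)
    have h2 : (((st p.1.1).bd.flatMap fun _ => p.1.2).map pc) =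
        (List.replicate (st p.1.1).bd.length (p.1.2.map pc)).flatten := by
      rw [List.map_flatMap, List.flatMap_def, List.map_const']
    rw [h2]
    have h3 := Piece.attachList_replicate (hfit _ _ p.2) _ (hst p.1.1) rfl
    exact ⟨h3.1, h3.2.1⟩

end Interpolation

/-! ### The reduction -/

section Alphabet

open Tensor

variable {G R : Set Signature} {d r : ℕ} {P : Set (Gadget G R 1 2)} {S : Set (Gadget G R d d)}

/-- The gadgets that are used as letters: those of `P` and `S`, and the starter. -/
def letterPiece (P : Set (Gadget G R 1 2)) (S : Set (Gadget G R d d)) (Γ : Gadget G R (d + r) 0) :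
    P ⊕ S ⊕ Unit → Piece G R
  | .inl F => ⟨1, 2, F.1⟩
  | .inr (.inl s) => ⟨d, d, s.1⟩
  | .inr (.inr _) => ⟨d + r, 0, Γ⟩

/-- The letters of a word of recursive gadgets that is followed by the starter. -/
def starterLetters (P : Set (Gadget G R 1 2)) (w : List S) : List (P ⊕ S ⊕ Unit) :=
  w.map (fun s => .inr (.inl s)) ++ [.inr (.inr ())]

theorem starterLetters_map (Γ : Gadget G R (d + r) 0) (w : List S) :
    (starterLetters P w).map (letterPiece P S Γ) = starterWord Γ w := by
  simp [starterLetters, starterWord, letterPiece, Function.comp_def]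

theorem exists_starterLetters {c w : List (P ⊕ S ⊕ Unit)} {SL : List (P ⊕ S ⊕ Unit)}
    (hSL : ∀ s ∈ SL, ∃ s' : S, s = .inr (.inl s')) (hw : ∀ s ∈ w, s ∈ SL)
    (hc : c = w ++ [.inr (.inr ())]) : ∃ w' : List S, c = starterLetters P w' := by
  subst hc
  induction w with
  | nil => exact ⟨[], rfl⟩
  | cons s w ih =>
    obtain ⟨w', hw'⟩ := ih fun s hs => hw s (by simp [hs])
    obtain ⟨s', rfl⟩ := hSL s (hw s (by simp))
    exact ⟨s' :: w', by rw [List.cons_append, hw']; rfl⟩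

theorem supplyOfWords (hSnonsing : ∀ s ∈ S, IsUnit s.transition.det)
    (hH : Infinite (transitionGroup S)) {Γ : Gadget G R (d + r) 0}
    (hΓ : ∀ z : (Fin d → Bool) → ℂ, (∀ l : List Bool, l.length = r →
      ∑ c, z c * Γ.act (fun _ => 1) (List.ofFn c ++ l) = 0) → z = 0)
    {SL : List (P ⊕ S ⊕ Unit)} (hSL : ∀ s, s ∈ SL ↔ ∃ s' : S, s = .inr (.inl s')) :
    SupplyOfWords (letterPiece P S Γ) (d + r) SL (.inr (.inr ())) := by
  intro L h0 hL
  have hL' : ∀ c : {c // c ∈ L}, ∃ w : List S, c.1 = starterLetters P w := by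
    intro c
    obtain ⟨w, hw, hc⟩ := hL c.1 c.2
    exact exists_starterLetters (fun s hs => (hSL s).mp hs) hw hc
  choose g hg using hL'
  have hmem : [] ∈ L.attach.map g := by
    refine List.mem_map.mpr ⟨⟨_, h0⟩, List.mem_attach _ _, ?_⟩
    have := hg ⟨_, h0⟩
    simpa [starterLetters] using (congrArg List.length this).symm
  obtain ⟨w, hw, s, hs⟩ := exists_new_word hSnonsing hH hΓ hmem
  obtain ⟨c, -, rfl⟩ := List.mem_map.mp hw
  refine ⟨c.1, c.2, .inr (.inl s), (hSL _).mpr ⟨s, rfl⟩, fun c' hc' => ?_⟩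
  have h1 := hs (g ⟨c', hc'⟩) (List.mem_map_of_mem (List.mem_attach _ _))
  have e1 : letterTensor (letterPiece P S Γ) c' = Piece.tensor (starterWord Γ (g ⟨c', hc'⟩)) := by
    rw [letterTensor, ← starterLetters_map (P := P), ← hg]
  have e2 : letterTensor (letterPiece P S Γ) (.inr (.inl s) :: c.1) =
      Piece.tensor (starterWord Γ (s :: g c)) := by
    rw [letterTensor, ← starterLetters_map (P := P), hg]
    rfl
  rw [e1, e2]
  exact h1

/-- Each gadget with one leading and two trailing edges reduces the arity by one. -/
theorem fits_append {σ c : List (Piece G R)} (hσ : ∀ p ∈ σ, p.m = 1 ∧ p.n = 2) {j : ℕ}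
    (hc : Piece.Fits c (1 + j + σ.length)) : Piece.Fits (σ ++ c) (1 + j) := by
  induction σ generalizing j with
  | nil => exact hc
  | cons p σ ih =>
    obtain ⟨h1, h2⟩ := hσ p (by simp)
    refine ⟨by omega, ?_⟩
    have e : p.n + (1 + j - p.m) = 1 + (j + 1) := by omega
    show Piece.Fits (σ ++ c) _
    rw [e]
    refine ih (fun q hq => hσ q (by simp [hq])) ?_
    have e' : 1 + (j + 1) + σ.length = 1 + j + (p :: σ).length := by
      simp only [List.length_cons]; omega
    rwa [e']

end Alphabet

theorem mainTheorem3 (G R : Set Signature) (hG : G.Finite) (hR : R.Finite)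
    (P : Set (Gadget G R 1 2)) (hPfin : P.Finite) (hPproj : IsProjectiveGadgetSet P)
    (d : ℕ) (hd : 1 ≤ d)
    (S : Set (Gadget G R d d)) (hSfin : S.Finite)
    (hSnonsing : ∀ s ∈ S, IsUnit s.transition.det)
    (hH : Infinite (transitionGroup S))
    (X Y : ℂ) :
    PolyTimeTuringReducible
      (holantProblem (G ∪ {Signature.unary X Y}) R) (holantProblem G R) := by
  classical
  have := hPfin.to_subtype
  have := hSfin.to_subtype
  obtain ⟨r, Γ, hΓ⟩ := exists_starter hPproj d
  obtain ⟨j, hj⟩ : ∃ j, d + r = 1 + j := ⟨d + r - 1, by omega⟩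
  let A := (holantProblem (G ∪ {Signature.unary X Y}) R).consts ∪ (holantProblem G R).consts
  have hA : ∀ f ∈ (G ∪ {Signature.unary X Y}) ∪ R, ∀ b, f.val b ∈ A :=
    fun f hf b => .inl ⟨f, hf, b, rfl⟩
  have hA' : ∀ f ∈ G ∪ R, ∀ b, f.val b ∈ A := fun f hf b => .inr ⟨f, hf, b, rfl⟩
  let pc := letterPiece P S Γ
  let code : P ⊕ S ⊕ Unit → Data := fun s => Data.ofNat (Finite.equivFin (P ⊕ S ⊕ Unit) s)
  have hcode : Function.Injective code := fun s s' h =>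
    (Finite.equivFin _).injective (Fin.ext (Data.ofNat_injective h))
  have hcode' : ∀ s, ∃ N, Data.SizeLE A (code s) N := fun s => ⟨_, Data.SizeLE.ofNat _⟩
  obtain ⟨SL, hSL⟩ : ∃ SL : List (P ⊕ S ⊕ Unit), ∀ s, s ∈ SL ↔ ∃ s' : S, s = .inr (.inl s') := by
    have := Fintype.ofFinite S
    exact ⟨(Finset.univ : Finset S).toList.map fun s => .inr (.inl s), fun s => by
      simp [eq_comm]⟩
  obtain ⟨PL, hPL⟩ : ∃ PL : List (List (P ⊕ S ⊕ Unit)),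
      ∀ σ, σ ∈ PL ↔ ∃ σ' : List P, σ'.length = j ∧ σ = σ'.map .inl :=
    ⟨(List.finite_length_eq P j).toFinset.toList.map (List.map .inl), fun s => by
      simp [eq_comm]⟩
  have hsup := supplyOfWords hSnonsing hH hΓ hSL
  have hPL' : ∀ σ ∈ PL, (∀ s ∈ σ, (pc s).m = 1 ∧ (pc s).n = 2) ∧ d + r = 1 + σ.length := by
    intro σ hσ
    obtain ⟨σ, rfl, rfl⟩ := (hPL _).mp hσ
    refine ⟨fun s hs => ?_, by rw [List.length_map, hj]⟩
    obtain ⟨F, -, rfl⟩ := List.mem_map.mp hs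
    exact ⟨rfl, rfl⟩
  have hSL' : ∀ s ∈ SL, d + r = (pc s).n + (d + r - (pc s).m) := by
    intro s hs
    obtain ⟨s, rfl⟩ := (hSL _).mp hs
    change d + r = d + (d + r - d)
    omega
  have hsep : ∀ c c' : List (P ⊕ S ⊕ Unit),
      ¬ Tensor.ParallelOn (d + r) (letterTensor pc c) (letterTensor pc c') →
      ∃ σ ∈ PL, ¬ Tensor.ParallelOn 1 (letterTensor pc (σ ++ c)) (letterTensor pc (σ ++ c')) := by
    intro c c' h
    rw [show d + r = j + 1 by omega] at h
    obtain ⟨σ, hσ, hn⟩ := hPproj.exists_actList h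
    refine ⟨σ.map .inl, (hPL _).mpr ⟨σ, hσ, rfl⟩, ?_⟩
    have e : ∀ c, letterTensor pc (σ.map .inl ++ c) =
        Piece.actList (σ.map fun F : P => (⟨1, 2, F.1⟩ : Piece G R)) (letterTensor pc c) := by
      intro c
      rw [letterTensor, letterTensor, Piece.tensor, Piece.tensor, Piece.actList, List.map_append,
        List.foldr_append, List.map_map]
      rfl
    rwa [e, e]
  have hst := OpenGrid.ofGrid_fp (O := (holantProblem G R).oracle) hG hR hA
  have hN := FP.natAdd (FP.length (e := fun _ => Data.ofNat) hst.snd.snd.snd) 1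
  have hsel := FP.selectWords (pc := pc) hA' hcode' hSL' hsup hPL' hN
  have hfit : ∀ (N J : ℕ), ∀ c ∈ List.foldl (selectStep pc N) []
      (((growStep pc (d + r) SL)^[J] [[.inr (.inr ())]]).flatMap fun c => PL.map fun σ => σ ++ c),
      Piece.Fits (c.map pc) 1 := by
    intro N J c hc
    obtain ⟨c0, hc0, hcσ⟩ := List.mem_flatMap.mp ((select_spec _ _).2.2.1 c hc).1
    obtain ⟨σ, hσ, rfl⟩ := List.mem_map.mp hcσ
    obtain ⟨-, w, hw, hcw⟩ := (growStep_iterate hsup _).2.2.2 c0 hc0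
    obtain ⟨w, rfl⟩ := exists_starterLetters (fun s hs => (hSL s).mp hs) hw hcw
    obtain ⟨h1, h2⟩ := hPL' σ hσ
    rw [List.map_append, starterLetters_map]
    refine fits_append (j := 0) (fun p hp => ?_) ?_
    · obtain ⟨s, hs, rfl⟩ := List.mem_map.mp hp
      exact h1 s hs
    · rw [List.length_map, add_zero, ← h2]
      exact starterWord_fits Γ w
  have hfp := FP.interpolation (hG.union hR) hA' hcode (w := OpenGrid.unaryVec X Y)
    (fun b => ⟨1, (HasIntHeight.of_mem (hA (Signature.unary X Y) (by simp) fun _ => b)).hasHeight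
      le_rfl (by norm_num)⟩)
    (OpenGrid.ofGrid_valid X Y) .self OpenGrid.ofGrid_boundedBy hst
    (fun Ω => hfit _ _) (fun Ω => (select_spec _ _).2.1)
    (fun Ω => select_length (growStep_iterate hsup _).2.1
      (by rw [(growStep_iterate hsup _).1]; omega) hsep) hsel
  simp only [← OpenGrid.ofGrid_value] at hfp
  obtain ⟨c, f, ⟨p, hp⟩, hc⟩ := hfp
  exact ⟨c, p, fun Ω => (hc Ω).imp fun t ht => ⟨ht.1.trans (hp Ω), ht.2⟩⟩
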